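/- Let $k$ be a field and let $H$ be a weak Hopf algebra over $k$: an associative unital $k$-algebra which is also a coassociative counital coalgebra $(H,\Delta,\epsilon)$ such that $\Delta(hg)=\Delta(h)\Delta(g)$, $$(\Delta\otimes\mathrm{id})\Delta(1)=(\Delta(1)\otimes 1)(1\otimes\Delta(1))=(1\otimes\Delta(1))(\Delta(1)\otimes 1),$$ $$\epsilon(fgh)=\epsilon(fg_{(1)})\,\epsilon(g_{(2)}h)=\epsilon(fg_{(2)})\,\epsilon(g_{(1)}h)$$ for all $f,g,h\in H$, together with a linear map $S:H\to H$ (the antipode) such that, with $\varepsilon_t(h)=\epsilon(1_{(1)}h)1_{(2)}$ and $\varepsilon_s(h)=1_{(1)}\epsilon(h1_{(2)})$, $$h_{(1)}S(h_{(2)})=\varepsilon_t(h),\qquad S(h_{(1)})h_{(2)}=\varepsilon_s(h),\qquad S(h_{(1)})h_{(2)}S(h_{(3)})=S(h)$$ for all $h\in H$. Let $H_s=\varepsilon_s(H)$ be the source base of $H$. A weak Hopf algebra automorphism of $H$ is a bijective linear map $H\to H$ that is a unital algebra homomorphism and a counital coalgebra homomorphism and commutes with $S$. It is called trivial if there is an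 invertible $y\in H_s$ such that it equals conjugation by $S(y)y^{-1}$, that is, $h\mapsto S(y)y^{-1}\,h\,S(y)^{-1}y$. Assume that $H$ is finite-dimensional and Frobenius, i.e. there is a linear functional $\phi:H\to k$ such that the bilinear form $(a,b)\mapsto\phi(ab)$ is nondegenerate. Then there exists an integer $n\geq 1$ such that $S^{4n}$ is a trivial weak Hopf algebra automorphism of $H$. In other words, the weak Hopf algebra automorphism $S^2$ has finite order modulo trivial automorphisms: there is an integer $m\ge 1$ such that $(S^2)^m$ is a trivial weak Hopf algebra automorphism. -/

import Mathlib

open scoped TensorProduct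

/-- A weak bialgebra over `k`: an associative unital algebra and coassociative counital coalgebra
whose comultiplication is multiplicative (not necessarily unital) and whose unit and counit satisfy
the weak compatibility axioms. -/
class WeakBialgebra (k H : Type*) [Field k] [Ring H] extends Algebra k H, Coalgebra k H where
  /-- `Δ(hg) = Δ(h)Δ(g)` -/
  comul_mul : ∀ h g : H,
    (comul (h * g) : H ⊗[k] H) = comul h * comul g
  /-- `(Δ ⊗ id)Δ(1) = (Δ(1) ⊗ 1)(1 ⊗ Δ(1))` -/
  comul_one_left :
    comul.rTensor H (comul (1 : H)) =
      (comul (1 : H) ⊗ₜ[k] (1 : H)) *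
        (TensorProduct.assoc k H H H).symm ((1 : H) ⊗ₜ[k] comul (1 : H))
  /-- `(Δ ⊗ id)Δ(1) = (1 ⊗ Δ(1))(Δ(1) ⊗ 1)` -/
  comul_one_right :
    comul.rTensor H (comul (1 : H)) =
      (TensorProduct.assoc k H H H).symm ((1 : H) ⊗ₜ[k] comul (1 : H)) *
        (comul (1 : H) ⊗ₜ[k] (1 : H))
  /-- `ε(fgh) = ε(f g₍₁₎) ε(g₍₂₎ h)` -/
  counit_mul_mul : ∀ f g h : H,
    counit (f * g * h) =
      LinearMap.mul' k k (TensorProduct.map (counit ∘ₗ LinearMap.mulLeft k f)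
        (counit ∘ₗ LinearMap.mulRight k h) (comul g))
  /-- `ε(fgh) = ε(f g₍₂₎) ε(g₍₁₎ h)` -/
  counit_mul_mul_swap : ∀ f g h : H,
    counit (f * g * h) =
      LinearMap.mul' k k (TensorProduct.map (counit ∘ₗ LinearMap.mulLeft k f)
        (counit ∘ₗ LinearMap.mulRight k h) (TensorProduct.comm k H H (comul g)))

namespace WeakBialgebra

variable (k : Type*) {H : Type*} [Field k] [Ring H] [WeakBialgebra k H]

/-- The target counital map `ε_t(h) = (ε ⊗ id)(Δ(1)(h ⊗ 1)) = ε(1₍₁₎ h) 1₍₂₎`. -/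
noncomputable def targetCounital : H →ₗ[k] H :=
  (TensorProduct.lid k H).toLinearMap ∘ₗ (Coalgebra.counit (R := k) (A := H)).rTensor H ∘ₗ
    LinearMap.mulLeft k (Coalgebra.comul (R := k) (1 : H)) ∘ₗ
    (TensorProduct.mk k H H).flip 1

/-- The source counital map `ε_s(h) = (id ⊗ ε)((1 ⊗ h)Δ(1)) = 1₍₁₎ ε(h 1₍₂₎)`. -/
noncomputable def sourceCounital : H →ₗ[k] H :=
  (TensorProduct.rid k H).toLinearMap ∘ₗ (Coalgebra.counit (R := k) (A := H)).lTensor H ∘ₗ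
    LinearMap.mulRight k (Coalgebra.comul (R := k) (1 : H)) ∘ₗ
    TensorProduct.mk k H H 1

variable (H) in
/-- The source base `H_s = ε_s(H)`. -/
noncomputable def sourceBase : Submodule k H := LinearMap.range (sourceCounital k (H := H))

end WeakBialgebra

/-- A weak Hopf algebra over `k`: a weak bialgebra with an antipode `S`. -/
class WeakHopfAlgebra (k H : Type*) [Field k] [Ring H] extends WeakBialgebra k H where
  /-- The antipode `S`. -/
  antipode (k) : H →ₗ[k] H
  /-- `h₍₁₎ S(h₍₂₎) = ε_t(h)` -/
  mul_antipode : ∀ h : H,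
    LinearMap.mul' k H (antipode.lTensor H (Coalgebra.comul (R := k) h)) =
      WeakBialgebra.targetCounital k h
  /-- `S(h₍₁₎) h₍₂₎ = ε_s(h)` -/
  antipode_mul : ∀ h : H,
    LinearMap.mul' k H (antipode.rTensor H (Coalgebra.comul (R := k) h)) =
      WeakBialgebra.sourceCounital k h
  /-- `S(h) = S(h₍₁₎) h₍₂₎ S(h₍₃₎)` -/
  antipode_mul_antipode : ∀ h : H,
    antipode h =
      LinearMap.mul' k H
        (TensorProduct.map (LinearMap.mul' k H ∘ₗ antipode.rTensor H) antipode
          ((Coalgebra.comul (R := k) (A := H)).rTensor H (Coalgebra.comul (R := k) h)))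

namespace WeakHopfAlgebra

variable {k H : Type*} [Field k] [Ring H] [WeakHopfAlgebra k H]

/-- A linear endomorphism is a weak Hopf algebra automorphism if it is bijective, an algebra and
coalgebra homomorphism (preserving `1` and `ε`), and commutes with the antipode. -/
structure IsAutomorphism (σ : Module.End k H) : Prop where
  bijective : Function.Bijective σ
  map_one : σ 1 = 1
  map_mul : ∀ h g : H, σ (h * g) = σ h * σ g
  counit_map : ∀ h : H, Coalgebra.counit (R := k) (σ h) = Coalgebra.counit (R := k) h
  comul_map : ∀ h : H,
    Coalgebra.comul (R := k) (σ h) = TensorProduct.map σ σ (Coalgebra.comul (R := k) h)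
  antipode_map : ∀ h : H, σ (antipode k h) = antipode k (σ h)

/-- A weak Hopf algebra automorphism is trivial if it is conjugation by `g = S(y) y⁻¹` for some
invertible `y ∈ H_s`. (Here `g` is required to be invertible so that `g⁻¹` can be written; this is
automatic, with `S(y)⁻¹ = S(y⁻¹)`.) -/
def IsTrivialAutomorphism (σ : Module.End k H) : Prop :=
  IsAutomorphism σ ∧
    ∃ y g : Hˣ, (y : H) ∈ WeakBialgebra.sourceBase k H ∧
      (g : H) = antipode k (y : H) * ((y⁻¹ : Hˣ) : H) ∧
      ∀ h : H, σ h = (g : H) * h * ((g⁻¹ : Hˣ) : H)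

end WeakHopfAlgebra

/-- A finite-dimensional algebra is Frobenius if it has a linear functional `φ` for which the
bilinear form `(a, b) ↦ φ(ab)` is nondegenerate. -/
def IsFrobeniusAlgebra (k A : Type*) [Field k] [Ring A] [Algebra k A] : Prop :=
  FiniteDimensional k A ∧ ∃ φ : A →ₗ[k] k, ((LinearMap.mul k A).compr₂ φ).Nondegenerate

/-!
The argument follows the proof of the Radford formula for `S⁴`, with the group of grouplike elements
replaced by right grouplike units modulo units of the two bases `Hs = εs(H)` and `Ht = εt(H)`.
Computations are made with Sweedler sums `sw`, in functions whose linearity `fun_prop` checks.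

*Bases.* `Hs` and `Ht` commute, the antipode exchanges them, and `S(1₁) ⊗ 1₂`, `1₁ ⊗ S(1₂)` are
Casimir elements, so that two-sided ideals of the bases have unit elements. Every submodule of the
`H`-module `Ht` is then generated by a central idempotent of `H`
(`exists_central_unit_of_target_submodule`), and dually every subcomodule of `Hs` is generated by an
idempotent in `Hs ∩ Ht` (`exists_unit_of_source_subcomodule`).

*Integrals.* A Frobenius functional `f` gives enough right integrals, namely the elements `p` for
which `f(p ·)` factors through `εs`. The target base acts faithfully on them, so the first legs of
their coproducts span `H`; this makes `S` injective (`antipode_bijective`). The right integrals form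
a module over the semisimple algebra `Hs` of the same dimension as `Hs`. Comparing the dimensions of
the spaces of homomorphisms between this module and `Hs` shows that the two are isomorphic
(`exists_generating_integral`). A generator `r` is a nondegenerate integral, and it has a dual left
integral `l` and a dual right integral `l'` in `H*` (`exists_isDualIntegral`).

*Radford formula.* Put `σ = S²`. The Nakayama automorphisms of `l` and `l'` are `σξ` and `σ⁻¹ξ'`,
with `ξ` left colinear and `ξ'` right colinear. The unit `g` with `l = l'(· g)` is right grouplike,
and the first automorphism is the second followed by conjugation by `g` (`exists_colinear_pair`).
So `σ²ξξ'⁻¹` is conjugation by `σ(g)`, and each `σ²ⁿ(ξξ'⁻¹)ⁿ` is conjugation by a right grouplike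
unit. Here `ξ` and `ξ'` commute.

*Finiteness.* In a module of finite dimension the semisimple submodules form finitely many
isomorphism classes (`exists_lt_nonempty_linearEquiv`), over any field. Applied to the twists of
the `H`-module `Ht` by the powers of `ξ`, realized in `H*`, this shows that a power of `ξ` is
conjugation by a unit of `Hs` (`IsLeftColinear.exists_pow_eq_conjAut`); similarly for `ξ'` and `Ht`.
Applied to the subcomodules `Hs gₙ` of `H`, for right grouplike units `gₙ`, it shows that two of the
`gₙ` differ by units of the bases (`exists_lt_grouplike_eq`). Hence a power of `S⁴` is conjugation
by `yz` with units `y` of `Hs` and `z` of `Ht` (`exists_pow_antipodeSq_eq_conjAut`). As this power is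
also a homomorphism of coalgebras, `S(y)z` is central, and the automorphism is trivial
(`isTrivialAutomorphism_of_conj`).
-/

/-! ### Sweedler calculus -/

section Sweedler

/-- Linearity of an unbundled map, in a form that `fun_prop` can prove. -/
@[fun_prop]
def Lin (k : Type*) {M N : Type*} [Semiring k] [AddCommMonoid M] [AddCommMonoid N] [Module k M]
    [Module k N] (f : M → N) : Prop := IsLinearMap k f

variable {k : Type*} [Field k] {M N P : Type*} [AddCommGroup M] [AddCommGroup N] [AddCommGroup P]
  [Module k M] [Module k N] [Module k P]
  {H : Type*} [Ring H] [Algebra k H]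

namespace Lin

@[fun_prop] theorem id' : Lin k (fun x : M => x) := ⟨fun _ _ => rfl, fun _ _ => rfl⟩

@[fun_prop] theorem comp {f : N → P} {g : M → N} (hf : Lin k f) (hg : Lin k g) :
    Lin k (fun x => f (g x)) :=
  ⟨fun x y => by rw [hg.map_add, hf.map_add], fun c x => by rw [hg.map_smul, hf.map_smul]⟩

@[fun_prop] theorem map (L : N →ₗ[k] P) {g : M → N} (hg : Lin k g) : Lin k (fun x => L (g x)) :=
  ⟨fun x y => by rw [hg.map_add, map_add], fun c x => by rw [hg.map_smul, map_smul]⟩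

@[fun_prop] theorem add {f g : M → N} (hf : Lin k f) (hg : Lin k g) :
    Lin k (fun x => f x + g x) :=
  ⟨fun x y => by rw [hf.map_add, hg.map_add]; abel,
    fun c x => by rw [hf.map_smul, hg.map_smul, smul_add]⟩

@[fun_prop] theorem sub {f g : M → N} (hf : Lin k f) (hg : Lin k g) :
    Lin k (fun x => f x - g x) :=
  ⟨fun x y => by rw [hf.map_add, hg.map_add]; abel,
    fun c x => by rw [hf.map_smul, hg.map_smul, smul_sub]⟩

@[fun_prop] theorem mul_const {f : M → H} (hf : Lin k f) (c : H) : Lin k (fun x => f x * c) :=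
  ⟨fun x y => by rw [hf.map_add, add_mul], fun a x => by rw [hf.map_smul, smul_mul_assoc]⟩

@[fun_prop] theorem const_mul {f : M → H} (c : H) (hf : Lin k f) : Lin k (fun x => c * f x) :=
  ⟨fun x y => by rw [hf.map_add, mul_add], fun a x => by rw [hf.map_smul, mul_smul_comm]⟩

@[fun_prop] theorem smul_const {f : M → k} (hf : Lin k f) (n : N) : Lin k (fun x => f x • n) :=
  ⟨fun x y => by rw [hf.map_add, add_smul], fun a x => by rw [hf.map_smul, smul_assoc]⟩

@[fun_prop] theorem const_smul {f : M → N} (c : k) (hf : Lin k f) : Lin k (fun x => c • f x) :=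
  ⟨fun x y => by rw [hf.map_add, smul_add], fun a x => by rw [hf.map_smul, smul_comm]⟩

@[fun_prop] theorem tmul_const {f : M → N} (hf : Lin k f) (n : P) :
    Lin k (fun x => f x ⊗ₜ[k] n) :=
  ⟨fun x y => by rw [hf.map_add, TensorProduct.add_tmul],
    fun a x => by rw [hf.map_smul, TensorProduct.smul_tmul']⟩

@[fun_prop] theorem const_tmul {f : M → N} (n : P) (hf : Lin k f) :
    Lin k (fun x => n ⊗ₜ[k] f x) :=
  ⟨fun x y => by rw [hf.map_add, TensorProduct.tmul_add],
    fun a x => by rw [hf.map_smul, TensorProduct.tmul_smul]⟩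

theorem map_sum {f : M → N} (hf : Lin k f) {ι : Type*} (s : Finset ι) (g : ι → M) :
    f (∑ i ∈ s, g i) = ∑ i ∈ s, f (g i) :=
  _root_.map_sum (IsLinearMap.mk' f hf) g s

end Lin

open Coalgebra

variable (k) [Coalgebra k M]

/-- `sw k h F` is the Sweedler sum `∑ F h₍₁₎ h₍₂₎`, computed with a fixed representation of
`Δ h`. It only depends on `Δ h` when `F` is bilinear. -/
noncomputable def sw (h : M) (F : M → M → N) : N :=
  ∑ i ∈ (Repr.arbitrary k h).index, F ((Repr.arbitrary k h).left i) ((Repr.arbitrary k h).right i)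

theorem sw_tmul (h : M) : sw k h (fun a b => a ⊗ₜ[k] b) = comul h :=
  (Repr.arbitrary k h).eq

theorem sw_linearMap (h : M) (B : M ⊗[k] M →ₗ[k] N) :
    sw k h (fun a b => B (a ⊗ₜ[k] b)) = B (comul h) := by
  rw [← sw_tmul k h, sw, sw, map_sum]

omit [Coalgebra k M] in
/-- A bilinear function bundled as a map out of the tensor product. -/
theorem exists_lift {F : M → P → N} (h₁ : ∀ b, Lin k (fun a => F a b))
    (h₂ : ∀ a, Lin k (fun b => F a b)) :
    ∃ B : M ⊗[k] P →ₗ[k] N, F = fun a b => B (a ⊗ₜ[k] b) :=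
  ⟨TensorProduct.lift (LinearMap.mk₂ k F (fun a a' b => (h₁ b).map_add a a')
    (fun c a b => (h₁ b).map_smul c a) (fun a b b' => (h₂ a).map_add b b')
    (fun c a b => (h₂ a).map_smul c b)), by simp⟩

variable {k}

omit [Module k N] in
theorem sw_congr {h : M} {F G : M → M → N} (e : ∀ a b, F a b = G a b) : sw k h F = sw k h G :=
  Finset.sum_congr rfl fun _ _ => e _ _

theorem Lin.sw_apply {f : N → P} (hf : Lin k f) (h : M) (F : M → M → N) :
    f (sw k h F) = sw k h (fun a b => f (F a b)) := hf.map_sum _ _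

omit [Module k N] in
theorem sw_comm (h : M) (g : M) (F : M → M → M → M → N) :
    sw k h (fun a b => sw k g (fun c d => F a b c d)) =
      sw k g (fun c d => sw k h (fun a b => F a b c d)) := Finset.sum_comm

omit [Algebra k H] in
theorem sw_mul_const (h : M) (F : M → M → H) (c : H) :
    sw k h (fun a b => F a b * c) = sw k h F * c := (Finset.sum_mul ..).symm

omit [Algebra k H] in
theorem sw_const_mul (h : M) (F : M → M → H) (c : H) :
    sw k h (fun a b => c * F a b) = c * sw k h F := (Finset.mul_sum ..).symm

theorem sw_smul_const (h : M) (F : M → M → k) (c : N) :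
    sw k h (fun a b => F a b • c) = sw k h F • c := (Finset.sum_smul ..).symm

theorem sw_const_smul (h : M) (F : M → M → N) (c : k) :
    sw k h (fun a b => c • F a b) = c • sw k h F := (Finset.smul_sum ..).symm

theorem map_sw (L : N →ₗ[k] P) (h : M) (F : M → M → N) :
    L (sw k h F) = sw k h (fun a b => L (F a b)) := map_sum ..

@[fun_prop]
theorem Lin.sw_left {G : M → M → N} (h₁ : ∀ b, Lin k (fun a => G a b))
    (h₂ : ∀ a, Lin k (fun b => G a b)) {f : P → M} (hf : Lin k f) :
    Lin k (fun x => sw k (f x) G) := by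
  obtain ⟨B, rfl⟩ := exists_lift k h₁ h₂
  simp only [sw_linearMap]
  exact Lin.map (B.comp comul) hf

@[fun_prop]
theorem Lin.sw_right {G : P → M → M → N} (h : M) (hG : ∀ a b, Lin k (fun x => G x a b)) :
    Lin k (fun x => sw k h (fun a b => G x a b)) :=
  ⟨fun x y => by
    simp only [sw, ← Finset.sum_add_distrib]
    exact Finset.sum_congr rfl fun _ _ => (hG _ _).map_add _ _, fun c x => by
    simp only [sw, Finset.smul_sum]
    exact Finset.sum_congr rfl fun _ _ => (hG _ _).map_smul _ _⟩

@[fun_prop] theorem Lin.comul' : Lin k (fun x : M => comul (R := k) x) :=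
  LinearMap.isLinear (Coalgebra.comul (R := k) (A := M))

@[fun_prop] theorem Lin.counit' : Lin k (fun x : M => counit (R := k) x) :=
  LinearMap.isLinear (Coalgebra.counit (R := k) (A := M))

/-- The counit axiom `ε(h₁)h₂ = h`, under a linear map. -/
theorem sw_counit_left (h : M) {f : M → N} (hf : Lin k f) :
    sw k h (fun a b => counit (R := k) a • f b) = f h := by
  have e := congr_arg (TensorProduct.lid k M) (rTensor_counit_comul (R := k) h)
  rw [← LinearEquiv.coe_coe, ← LinearMap.comp_apply, ← sw_linearMap] at e
  simp only [LinearMap.comp_apply, LinearMap.rTensor_tmul, LinearEquiv.coe_coe,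
    TensorProduct.lid_tmul, one_smul] at e
  conv_rhs => rw [← e, hf.sw_apply]
  simp only [hf.map_smul]

/-- The counit axiom `h₁ε(h₂) = h`, under a linear map. -/
theorem sw_counit_right (h : M) {f : M → N} (hf : Lin k f) :
    sw k h (fun a b => counit (R := k) b • f a) = f h := by
  have e := congr_arg (TensorProduct.rid k M) (lTensor_counit_comul (R := k) h)
  rw [← LinearEquiv.coe_coe, ← LinearMap.comp_apply, ← sw_linearMap] at e
  simp only [LinearMap.comp_apply, LinearMap.lTensor_tmul, LinearEquiv.coe_coe,
    TensorProduct.rid_tmul, one_smul] at e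
  conv_rhs => rw [← e, hf.sw_apply]
  simp only [hf.map_smul]

omit [Coalgebra k M] in
/-- A trilinear function bundled as a map out of the tensor product. -/
theorem exists_lift₃ {F : M → M → M → N} (h₁ : ∀ b c, Lin k (fun a => F a b c))
    (h₂ : ∀ a c, Lin k (fun b => F a b c)) (h₃ : ∀ a b, Lin k (fun c => F a b c)) :
    ∃ B : M ⊗[k] (M ⊗[k] M) →ₗ[k] N, F = fun a b c => B (a ⊗ₜ[k] (b ⊗ₜ[k] c)) := by
  choose B hB using fun a => exists_lift k (h₂ a) (h₃ a)
  have hB' : ∀ a b c, F a b c = B a (b ⊗ₜ[k] c) := fun a b c => congr_fun₂ (hB a) b c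
  have hl : ∀ x, Lin k (fun a => B a x) := fun x => by
    refine x.induction_on ⟨fun a b => by simp, fun c a => by simp⟩ (fun b c => ?_)
      (fun x y hx hy => ?_)
    · simpa only [← hB'] using h₁ b c
    · simpa only [map_add] using hx.add hy
  obtain ⟨C, hC⟩ := exists_lift k (F := fun a x => B a x) hl (fun a => (B a).isLinear)
  exact ⟨C, by funext a b c; rw [hB', ← congr_fun₂ hC]⟩

/-- Coassociativity: both sides are the sum of `F h₁ h₂ h₃`. -/
theorem sw_coassoc (h : M) {F : M → M → M → N} (h₁ : ∀ b c, Lin k (fun a => F a b c))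
    (h₂ : ∀ a c, Lin k (fun b => F a b c)) (h₃ : ∀ a b, Lin k (fun c => F a b c)) :
    sw k h (fun a b => sw k a (fun p q => F p q b)) =
      sw k h (fun a b => sw k b (fun p q => F a p q)) := by
  obtain ⟨B, rfl⟩ := exists_lift₃ h₁ h₂ h₃
  have e := congr_arg B (coassoc_apply (R := k) h)
  have e₁ := sw_linearMap k h
    (B ∘ₗ (TensorProduct.assoc k M M M).toLinearMap ∘ₗ (comul (R := k) (A := M)).rTensor M)
  have e₂ := sw_linearMap k h (B ∘ₗ (comul (R := k) (A := M)).lTensor M)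
  simp only [LinearMap.comp_apply, LinearMap.rTensor_tmul, LinearMap.lTensor_tmul,
    LinearEquiv.coe_coe] at e₁ e₂
  rw [← e₁, ← e₂] at e
  convert e using 1
  · refine sw_congr fun a b => ?_
    rw [← sw_tmul k a, sw, sw, TensorProduct.sum_tmul, map_sum, map_sum]
    rfl
  · refine sw_congr fun a b => ?_
    rw [← sw_tmul k b, sw, sw, TensorProduct.tmul_sum, map_sum]

end Sweedler

/-! ### The weak bialgebra axioms in Sweedler form -/

section WeakBialgebraCalculus

open Coalgebra WeakBialgebra

variable {k H M : Type*} [Field k] [Ring H] [WeakBialgebra k H] [AddCommGroup M] [Module k M]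

@[fun_prop] theorem Lin.targetCounital' : Lin k (fun x : H => targetCounital k x) :=
  LinearMap.isLinear (targetCounital k)

@[fun_prop] theorem Lin.sourceCounital' : Lin k (fun x : H => sourceCounital k x) :=
  LinearMap.isLinear (sourceCounital k)

theorem sw_mul (h g : H) {F : H → H → M} (h₁ : ∀ b, Lin k (fun a => F a b))
    (h₂ : ∀ a, Lin k (fun b => F a b)) :
    sw k (h * g) F = sw k h fun a b => sw k g fun c d => F (a * c) (b * d) := by
  obtain ⟨B, rfl⟩ := exists_lift k h₁ h₂
  rw [sw_linearMap, comul_mul, ← sw_tmul k h, sw, Finset.sum_mul, map_sum]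
  refine Finset.sum_congr rfl fun a _ => ?_
  rw [← sw_tmul k g, sw, Finset.mul_sum, map_sum]
  simp only [Algebra.TensorProduct.tmul_mul_tmul]
  rfl

theorem sw_one_right (h : H) {F : H → H → M} (h₁ : ∀ b, Lin k (fun a => F a b))
    (h₂ : ∀ a, Lin k (fun b => F a b)) :
    (sw k h fun a b => sw k (1 : H) fun c d => F (a * c) (b * d)) = sw k h F := by
  rw [← sw_mul h 1 h₁ h₂, mul_one]

theorem sw_one_left (h : H) {F : H → H → M} (h₁ : ∀ b, Lin k (fun a => F a b))
    (h₂ : ∀ a, Lin k (fun b => F a b)) :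
    (sw k (1 : H) fun a b => sw k h fun c d => F (a * c) (b * d)) = sw k h F := by
  rw [← sw_mul 1 h h₁ h₂, one_mul]

/-- The axiom `1₁ ⊗ 1₂ ⊗ 1₃ = 1₁ ⊗ 1₂1′₁ ⊗ 1′₂`. -/
theorem sw_sw_one {F : H → H → H → M} (h₁ : ∀ b c, Lin k (fun a => F a b c))
    (h₂ : ∀ a c, Lin k (fun b => F a b c)) (h₃ : ∀ a b, Lin k (fun c => F a b c)) :
    (sw k (1 : H) fun a b => sw k a fun p q => F p q b) =
      sw k (1 : H) fun a b => sw k (1 : H) fun c d => F a (b * c) d := by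
  obtain ⟨B, rfl⟩ := exists_lift₃ h₁ h₂ h₃
  have e := congr_arg (B ∘ₗ (TensorProduct.assoc k H H H).toLinearMap)
    (comul_one_left (k := k) (H := H))
  have e₁ := sw_linearMap k (1 : H)
    (B ∘ₗ (TensorProduct.assoc k H H H).toLinearMap ∘ₗ (comul (R := k) (A := H)).rTensor H)
  simp only [LinearMap.comp_apply, LinearMap.rTensor_tmul, LinearEquiv.coe_coe] at e e₁
  rw [← e₁] at e
  convert e using 1
  · refine sw_congr fun a b => ?_
    rw [← sw_tmul k a, sw, sw, TensorProduct.sum_tmul, map_sum, map_sum]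
    rfl
  · rw [← sw_tmul k (1 : H), sw, sw]
    simp only [TensorProduct.sum_tmul, TensorProduct.tmul_sum, map_sum, Finset.sum_mul,
      Finset.mul_sum, sw, TensorProduct.assoc_symm_tmul, Algebra.TensorProduct.tmul_mul_tmul,
      TensorProduct.assoc_tmul, one_mul, mul_one]
    exact Finset.sum_comm

/-- The axiom `1₁ ⊗ 1₂ ⊗ 1₃ = 1₁ ⊗ 1′₁1₂ ⊗ 1′₂`. -/
theorem sw_sw_one' {F : H → H → H → M} (h₁ : ∀ b c, Lin k (fun a => F a b c))
    (h₂ : ∀ a c, Lin k (fun b => F a b c)) (h₃ : ∀ a b, Lin k (fun c => F a b c)) :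
    (sw k (1 : H) fun a b => sw k a fun p q => F p q b) =
      sw k (1 : H) fun a b => sw k (1 : H) fun c d => F a (c * b) d := by
  obtain ⟨B, rfl⟩ := exists_lift₃ h₁ h₂ h₃
  have e := congr_arg (B ∘ₗ (TensorProduct.assoc k H H H).toLinearMap)
    (comul_one_right (k := k) (H := H))
  have e₁ := sw_linearMap k (1 : H)
    (B ∘ₗ (TensorProduct.assoc k H H H).toLinearMap ∘ₗ (comul (R := k) (A := H)).rTensor H)
  simp only [LinearMap.comp_apply, LinearMap.rTensor_tmul, LinearEquiv.coe_coe] at e e₁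
  rw [← e₁] at e
  convert e using 1
  · refine sw_congr fun a b => ?_
    rw [← sw_tmul k a, sw, sw, TensorProduct.sum_tmul, map_sum, map_sum]
    rfl
  · rw [← sw_tmul k (1 : H), sw, sw]
    simp only [TensorProduct.sum_tmul, TensorProduct.tmul_sum, map_sum, Finset.sum_mul,
      Finset.mul_sum, sw, TensorProduct.assoc_symm_tmul, Algebra.TensorProduct.tmul_mul_tmul,
      TensorProduct.assoc_tmul, one_mul, mul_one]

theorem counit_mul_mul_sw (f g h : H) :
    counit (R := k) (f * g * h) =
      sw k g fun a b => counit (R := k) (f * a) * counit (R := k) (b * h) := by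
  rw [counit_mul_mul, ← LinearMap.comp_apply, ← sw_linearMap]
  simp

theorem counit_mul_mul_sw' (f g h : H) :
    counit (R := k) (f * g * h) =
      sw k g fun a b => counit (R := k) (f * b) * counit (R := k) (a * h) := by
  rw [counit_mul_mul_swap, ← LinearEquiv.coe_coe, ← LinearMap.comp_apply, ← LinearMap.comp_apply,
    ← sw_linearMap]
  simp

theorem targetCounital_eq (h : H) :
    targetCounital k h = sw k (1 : H) fun a b => counit (R := k) (a * h) • b := by
  simp only [targetCounital, LinearMap.comp_apply, LinearMap.mulLeft_apply]
  rw [← sw_tmul k (1 : H), sw, Finset.sum_mul, map_sum, map_sum]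
  refine Finset.sum_congr rfl fun a _ => ?_
  simp

theorem sourceCounital_eq (h : H) :
    sourceCounital k h = sw k (1 : H) fun a b => counit (R := k) (h * b) • a := by
  simp only [sourceCounital, LinearMap.comp_apply, LinearMap.mulRight_apply]
  rw [← sw_tmul k (1 : H), sw, Finset.mul_sum, map_sum, map_sum]
  refine Finset.sum_congr rfl fun a _ => ?_
  simp

end WeakBialgebraCalculus

/-! ### The counital maps -/

section WeakBialgebraBasic

open Coalgebra WeakBialgebra

variable {k H M : Type*} [Field k] [Ring H] [WeakBialgebra k H] [AddCommGroup M] [Module k M]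

local notation "ε" => Coalgebra.counit (R := k)
local notation "εt" => WeakBialgebra.targetCounital k
local notation "εs" => WeakBialgebra.sourceCounital k

theorem Lin.apply_targetCounital {f : H → M} (hf : Lin k f) (x : H) :
    f (εt x) = sw k (1 : H) fun a b => ε (a * x) • f b := by
  rw [targetCounital_eq, hf.sw_apply]
  exact sw_congr fun a b => hf.map_smul _ _

theorem Lin.apply_sourceCounital {f : H → M} (hf : Lin k f) (x : H) :
    f (εs x) = sw k (1 : H) fun a b => ε (x * b) • f a := by
  rw [sourceCounital_eq, hf.sw_apply]
  exact sw_congr fun a b => hf.map_smul _ _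

theorem counit_mul_targetCounital (g h : H) : ε (g * εt h) = ε (g * h) := by
  rw [Lin.apply_targetCounital (f := fun z => ε (g * z)) (by fun_prop), ← mul_one g,
    counit_mul_mul_sw', mul_one]
  exact sw_congr fun a b => by rw [smul_eq_mul, mul_comm]

theorem counit_sourceCounital_mul (g h : H) : ε (εs g * h) = ε (g * h) := by
  rw [Lin.apply_sourceCounital (f := fun z => ε (z * h)) (by fun_prop), ← mul_one g,
    counit_mul_mul_sw', mul_one]
  exact sw_congr fun a b => by rw [smul_eq_mul]

theorem targetCounital_mul_targetCounital (g h : H) : εt (g * εt h) = εt (g * h) := by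
  rw [targetCounital_eq (g * εt h), targetCounital_eq (g * h)]
  exact sw_congr fun a b => by rw [← mul_assoc, counit_mul_targetCounital, mul_assoc]

theorem sourceCounital_sourceCounital_mul (g h : H) : εs (εs g * h) = εs (g * h) := by
  rw [sourceCounital_eq (εs g * h), sourceCounital_eq (g * h)]
  exact sw_congr fun a b => by rw [mul_assoc, counit_sourceCounital_mul, mul_assoc]

theorem targetCounital_targetCounital (h : H) : εt (εt h) = εt h := by
  simpa using targetCounital_mul_targetCounital (k := k) 1 h

theorem sourceCounital_sourceCounital (h : H) : εs (εs h) = εs h := by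
  simpa using sourceCounital_sourceCounital_mul (k := k) h 1

theorem counit_targetCounital (h : H) : ε (εt h) = ε h := by
  simpa using counit_mul_targetCounital (k := k) 1 h

theorem counit_sourceCounital (h : H) : ε (εs h) = ε h := by
  simpa using counit_sourceCounital_mul (k := k) h 1

theorem targetCounital_one : εt (1 : H) = 1 := by
  rw [targetCounital_eq]
  simpa using sw_counit_left (k := k) (1 : H) Lin.id'

theorem sourceCounital_one : εs (1 : H) = 1 := by
  rw [sourceCounital_eq]
  simpa using sw_counit_right (k := k) (1 : H) Lin.id'

section Bilinear

variable {F : H → H → M} (h₁ : ∀ b, Lin k (fun a => F a b)) (h₂ : ∀ a, Lin k (fun b => F a b))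
include h₁ h₂

/-- `Δ(z) = 1₁z ⊗ 1₂` for `z` in the target base. -/
theorem sw_targetCounital_left (x : H) :
    sw k (εt x) F = sw k (1 : H) fun a b => F (a * εt x) b := by
  rw [Lin.apply_targetCounital (f := fun z => sw k z F) (by fun_prop)]
  simp only [← sw_const_smul]
  rw [← sw_coassoc (k := k) (1 : H) (F := fun a c d => ε (a * x) • F c d) (by fun_prop)
    (by fun_prop) (by fun_prop), sw_sw_one' (by fun_prop) (by fun_prop) (by fun_prop), sw_comm]
  refine sw_congr fun c d => ?_
  rw [Lin.apply_targetCounital (f := fun z => F (c * z) d) (by fun_prop)]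

/-- `Δ(z) = z1₁ ⊗ 1₂` for `z` in the target base. -/
theorem sw_targetCounital_left' (x : H) :
    sw k (εt x) F = sw k (1 : H) fun a b => F (εt x * a) b := by
  rw [Lin.apply_targetCounital (f := fun z => sw k z F) (by fun_prop)]
  simp only [← sw_const_smul]
  rw [← sw_coassoc (k := k) (1 : H) (F := fun a c d => ε (a * x) • F c d) (by fun_prop)
    (by fun_prop) (by fun_prop), sw_sw_one (by fun_prop) (by fun_prop) (by fun_prop), sw_comm]
  refine sw_congr fun c d => ?_
  rw [Lin.apply_targetCounital (f := fun z => F (z * c) d) (by fun_prop)]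

/-- `Δ(y) = 1₁ ⊗ 1₂y` for `y` in the source base. -/
theorem sw_sourceCounital_right (x : H) :
    sw k (εs x) F = sw k (1 : H) fun a b => F a (b * εs x) := by
  rw [Lin.apply_sourceCounital (f := fun z => sw k z F) (by fun_prop)]
  simp only [← sw_const_smul]
  rw [sw_coassoc (k := k) (1 : H) (F := fun c d b => ε (x * b) • F c d) (by fun_prop)
    (by fun_prop) (by fun_prop), ← sw_coassoc (k := k) (1 : H) (by fun_prop) (by fun_prop)
    (by fun_prop), sw_sw_one (by fun_prop) (by fun_prop) (by fun_prop)]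
  refine sw_congr fun c d => ?_
  rw [Lin.apply_sourceCounital (f := fun z => F c (d * z)) (by fun_prop)]

/-- `Δ(y) = 1₁ ⊗ y1₂` for `y` in the source base. -/
theorem sw_sourceCounital_right' (x : H) :
    sw k (εs x) F = sw k (1 : H) fun a b => F a (εs x * b) := by
  rw [Lin.apply_sourceCounital (f := fun z => sw k z F) (by fun_prop)]
  simp only [← sw_const_smul]
  rw [sw_coassoc (k := k) (1 : H) (F := fun c d b => ε (x * b) • F c d) (by fun_prop)
    (by fun_prop) (by fun_prop), ← sw_coassoc (k := k) (1 : H) (by fun_prop) (by fun_prop)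
    (by fun_prop), sw_sw_one' (by fun_prop) (by fun_prop) (by fun_prop)]
  refine sw_congr fun c d => ?_
  rw [Lin.apply_sourceCounital (f := fun z => F c (z * d)) (by fun_prop)]

/-- The first leg of `Δ(1)` lies in the source base. -/
theorem sw_one_sourceCounital :
    (sw k (1 : H) fun a b => F (εs a) b) = sw k (1 : H) F := by
  have : ∀ a b, F (εs a) b = sw k (1 : H) fun c d => ε (a * d) • F c b := fun a b =>
    Lin.apply_sourceCounital (f := fun z => F z b) (by fun_prop) a
  simp only [this]
  rw [sw_comm, ← sw_sw_one' (F := fun c u b => ε u • F c b) (by fun_prop) (by fun_prop)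
    (by fun_prop)]
  exact sw_congr fun a b => sw_counit_right (k := k) a (f := fun z => F z b) (by fun_prop)

/-- The second leg of `Δ(1)` lies in the target base. -/
theorem sw_one_targetCounital :
    (sw k (1 : H) fun a b => F a (εt b)) = sw k (1 : H) F := by
  have : ∀ a b, F a (εt b) = sw k (1 : H) fun c d => ε (c * b) • F a d := fun a b =>
    Lin.apply_targetCounital (f := fun z => F a z) (by fun_prop) b
  simp only [this]
  rw [← sw_sw_one' (F := fun a u d => ε u • F a d) (by fun_prop) (by fun_prop)
    (by fun_prop)]
  exact sw_congr fun a b => sw_counit_right (k := k) a (f := fun z => F z b) (by fun_prop)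

theorem sw_mul_targetCounital (x y : H) :
    sw k (x * εt y) F = sw k x fun a b => F (a * εt y) b := by
  rw [sw_mul _ _ h₁ h₂]
  simp (disch := fun_prop) only [sw_targetCounital_left, ← mul_assoc]
  exact sw_one_right (F := fun c d => F (c * εt y) d) x (by fun_prop) (by fun_prop)

theorem sw_targetCounital_mul (x y : H) :
    sw k (εt y * x) F = sw k x fun a b => F (εt y * a) b := by
  rw [sw_mul _ _ h₁ h₂, sw_targetCounital_left' (by fun_prop) (by fun_prop)]
  simp only [mul_assoc]
  exact sw_one_left (F := fun c d => F (εt y * c) d) x (by fun_prop) (by fun_prop)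

theorem sw_mul_sourceCounital (x y : H) :
    sw k (x * εs y) F = sw k x fun a b => F a (b * εs y) := by
  rw [sw_mul _ _ h₁ h₂]
  simp (disch := fun_prop) only [sw_sourceCounital_right, ← mul_assoc]
  exact sw_one_right (F := fun c d => F c (d * εs y)) x (by fun_prop) (by fun_prop)

theorem sw_sourceCounital_mul (x y : H) :
    sw k (εs y * x) F = sw k x fun a b => F a (εs y * b) := by
  rw [sw_mul _ _ h₁ h₂, sw_sourceCounital_right' (by fun_prop) (by fun_prop)]
  simp only [mul_assoc]
  exact sw_one_left (F := fun c d => F c (εs y * d)) x (by fun_prop) (by fun_prop)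

/-- `x₁ ⊗ ε_t(x₂) = 1₁ x ⊗ 1₂`. -/
theorem sw_targetCounital_snd (x : H) :
    (sw k x fun a b => F a (εt b)) = sw k (1 : H) fun a b => F (a * x) b := by
  have : ∀ a b, F a (εt b) = sw k (1 : H) fun c d => ε (c * b) • F a d := fun a b =>
    Lin.apply_targetCounital (f := fun z => F a z) (by fun_prop) b
  simp only [this]
  rw [← sw_one_left (F := fun a b => sw k (1 : H) fun c d => ε (c * b) • F a d) x
    (by fun_prop) (by fun_prop), sw_comm]
  simp only [← mul_assoc]
  have : ∀ a b, (sw k (1 : H) fun p q => sw k (1 : H) fun c d => ε (c * q * b) • F (p * a) d) =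
      sw k (1 : H) fun p d => sw k p fun u v => ε (v * b) • F (u * a) d := fun a b =>
    (sw_sw_one' (F := fun p u d => ε (u * b) • F (p * a) d) (by fun_prop) (by fun_prop)
      (by fun_prop)).symm
  simp only [this]
  rw [sw_comm]
  refine sw_congr fun p d => ?_
  rw [sw_comm, ← sw_mul p x (F := fun u v => ε v • F u d) (by fun_prop) (by fun_prop)]
  exact sw_counit_right (k := k) (p * x) (f := fun z => F z d) (by fun_prop)

/-- `ε_s(x₁) ⊗ x₂ = 1₁ ⊗ x 1₂`. -/
theorem sw_sourceCounital_fst (x : H) :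
    (sw k x fun a b => F (εs a) b) = sw k (1 : H) fun a b => F a (x * b) := by
  have : ∀ a b, F (εs a) b = sw k (1 : H) fun c d => ε (a * d) • F c b := fun a b =>
    Lin.apply_sourceCounital (f := fun z => F z b) (by fun_prop) a
  simp only [this]
  rw [← sw_one_right (F := fun a b => sw k (1 : H) fun c d => ε (a * d) • F c b) x
    (by fun_prop) (by fun_prop)]
  simp only [mul_assoc]
  have : ∀ a b, (sw k (1 : H) fun p q => sw k (1 : H) fun c d => ε (a * (p * d)) • F c (b * q)) =
      sw k (1 : H) fun p d => sw k d fun u v => ε (a * u) • F p (b * v) := fun a b => by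
    rw [← sw_coassoc (k := k) (1 : H) (F := fun p u v => ε (a * u) • F p (b * v)) (by fun_prop)
      (by fun_prop) (by fun_prop), sw_sw_one' (by fun_prop) (by fun_prop) (by fun_prop), sw_comm]
  simp only [this]
  rw [sw_comm]
  refine sw_congr fun p d => ?_
  rw [← sw_mul x d (F := fun u v => ε u • F p v) (by fun_prop) (by fun_prop)]
  exact sw_counit_left (k := k) (x * d) (f := fun z => F p z) (by fun_prop)

end Bilinear

/-- The two bases commute, because `1₁z ⊗ 1₂ = z1₁ ⊗ 1₂` for `z` in the target base. -/
theorem targetCounital_mul_sourceCounital (x y : H) : εt x * εs y = εs y * εt x := by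
  rw [Lin.apply_sourceCounital (f := fun z => εt x * z) (by fun_prop),
    Lin.apply_sourceCounital (f := fun z => z * εt x) (by fun_prop)]
  rw [← sw_targetCounital_left (F := fun a b => ε (y * b) • a) (by fun_prop) (by fun_prop),
    sw_targetCounital_left' (by fun_prop) (by fun_prop)]

end WeakBialgebraBasic

/-! ### The antipode -/

section Antipode

open Coalgebra WeakBialgebra WeakHopfAlgebra

variable {k H M : Type*} [Field k] [Ring H] [WeakHopfAlgebra k H] [AddCommGroup M] [Module k M]

local notation "ε" => Coalgebra.counit (R := k)
local notation "εt" => WeakBialgebra.targetCounital k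
local notation "εs" => WeakBialgebra.sourceCounital k
local notation "S" => WeakHopfAlgebra.antipode k

@[fun_prop] theorem Lin.antipode' : Lin k (fun x : H => S x) :=
  LinearMap.isLinear (antipode k)

theorem sw_mul_antipode (h : H) : (sw k h fun a b => a * S b) = εt h := by
  rw [← mul_antipode, ← LinearMap.comp_apply, ← sw_linearMap]
  simp

theorem sw_antipode_mul (h : H) : (sw k h fun a b => S a * b) = εs h := by
  rw [← antipode_mul, ← LinearMap.comp_apply, ← sw_linearMap]
  simp

theorem sw_sourceCounital_mul_antipode (h : H) : (sw k h fun a b => εs a * S b) = S h := by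
  rw [antipode_mul_antipode h, ← LinearMap.comp_apply, ← LinearMap.comp_apply, ← sw_linearMap]
  refine sw_congr fun a b => ?_
  simp only [LinearMap.comp_apply, LinearMap.rTensor_tmul, TensorProduct.map_tmul,
    LinearMap.mul'_apply]
  rw [← antipode_mul]

theorem Lin.apply_mul_antipode {f : H → M} (hf : Lin k f) (h : H) :
    (sw k h fun a b => f (a * S b)) = f (εt h) := by
  rw [← sw_mul_antipode, hf.sw_apply]

theorem Lin.apply_antipode_mul {f : H → M} (hf : Lin k f) (h : H) :
    (sw k h fun a b => f (S a * b)) = f (εs h) := by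
  rw [← sw_antipode_mul, hf.sw_apply]

theorem sw_antipode_mul_targetCounital (h : H) : (sw k h fun a b => S a * εt b) = S h := by
  simp only [← sw_mul_antipode, ← sw_const_mul, ← mul_assoc]
  rw [← sw_coassoc (k := k) h (F := fun a p q => S a * p * S q) (by fun_prop) (by fun_prop)
    (by fun_prop)]
  simp only [sw_mul_const, sw_antipode_mul]
  exact sw_sourceCounital_mul_antipode h

theorem sw_targetCounital_mul_self (h : H) : (sw k h fun a b => εt a * b) = h := by
  simp only [targetCounital_eq, ← sw_mul_const, smul_mul_assoc]
  rw [sw_comm, sw_one_left (F := fun a b => ε a • b) h (by fun_prop) (by fun_prop)]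
  exact sw_counit_left (k := k) h Lin.id'

theorem sw_self_mul_sourceCounital (h : H) : (sw k h fun a b => a * εs b) = h := by
  simp only [sourceCounital_eq, ← sw_const_mul, mul_smul_comm]
  rw [sw_one_right (F := fun a b => ε b • a) h (by fun_prop) (by fun_prop)]
  exact sw_counit_right (k := k) h Lin.id'

theorem antipode_one : S (1 : H) = 1 := by
  rw [← sw_antipode_mul_targetCounital, sw_one_targetCounital (F := fun a b => S a * b)
    (by fun_prop) (by fun_prop), sw_antipode_mul, sourceCounital_one]

theorem targetCounital_mul_eq (u v : H) : εt (u * v) = sw k u fun p q => p * εt v * S q := by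
  rw [← targetCounital_mul_targetCounital, ← sw_mul_antipode,
    sw_mul_targetCounital (by fun_prop) (by fun_prop)]

theorem sourceCounital_mul_eq (u v : H) : εs (u * v) = sw k v fun p q => S p * εs u * q := by
  rw [← sourceCounital_sourceCounital_mul, ← sw_antipode_mul,
    sw_sourceCounital_mul (by fun_prop) (by fun_prop)]
  simp only [mul_assoc]

/-- The antipode is antimultiplicative: `S(xy)` and `S(y)S(x)` are the two ways to collapse
`S(x₁y₁) x₂ y₂ S(y₃) S(x₃)`. -/
theorem antipode_mul_rev (x y : H) : S (x * y) = S y * S x := by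
  calc S (x * y) = sw k x fun x₁ x₂ => sw k y fun y₁ y₂ => S (x₁ * y₁) * εt (x₂ * y₂) := by
        rw [← sw_antipode_mul_targetCounital, sw_mul _ _ (by fun_prop) (by fun_prop)]
    _ = sw k x fun x₁ x₂ => sw k x₂ fun p q => sw k y fun y₁ y₂ =>
          S (x₁ * y₁) * (p * εt y₂ * S q) := by
        simp only [targetCounital_mul_eq, ← sw_const_mul]
        exact sw_congr fun _ _ => sw_comm _ _ _
    _ = sw k x fun a q => sw k a fun u p => sw k y fun y₁ y₂ =>
          S (u * y₁) * (p * εt y₂ * S q) :=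
        (sw_coassoc x (by fun_prop) (by fun_prop) (by fun_prop)).symm
    _ = sw k x fun a q => sw k y fun b d => sw k a fun u p => sw k b fun v c =>
          S (u * v) * (p * c) * S d * S q := by
        refine sw_congr fun a q => ?_
        refine Eq.symm ((sw_congr fun b d => sw_comm _ _ _).trans ?_)
        rw [sw_coassoc y (F := fun v c d => sw k a fun u p =>
          S (u * v) * (p * c) * S d * S q) (by fun_prop) (by fun_prop) (by fun_prop), sw_comm a y]
        refine sw_congr fun y₁ y₂ => ?_
        rw [sw_comm]
        refine sw_congr fun u p => ?_
        simp only [← sw_mul_antipode, ← sw_const_mul, ← sw_mul_const, mul_assoc]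
    _ = sw k x fun a q => sw k y fun b d => εs (a * b) * S d * S q := by
        refine sw_congr fun a q => sw_congr fun b d => ?_
        simp only [sw_mul_const]
        rw [← sw_antipode_mul, sw_mul _ _ (by fun_prop) (by fun_prop)]
    _ = sw k x fun a q => sw k y fun y₁ y₂ => S y₁ * εs a * (εt y₂ * S q) := by
        refine sw_congr fun a q => ?_
        simp only [sourceCounital_mul_eq, ← sw_mul_const, ← sw_mul_antipode, ← sw_const_mul]
        rw [sw_coassoc y (F := fun p v d => S p * εs a * v * S d * S q) (by fun_prop)
          (by fun_prop) (by fun_prop)]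
        simp only [mul_assoc]
    _ = sw k x fun a q => sw k y fun y₁ y₂ => S y₁ * εt y₂ * (εs a * S q) := by
        refine sw_congr fun a q => sw_congr fun b d => ?_
        rw [mul_assoc, ← mul_assoc (εs a), ← targetCounital_mul_sourceCounital]
        simp only [mul_assoc]
    _ = S y * S x := by
        simp only [sw_mul_const, sw_const_mul, sw_antipode_mul_targetCounital,
          sw_sourceCounital_mul_antipode]

/-- On the target base the antipode coincides with `εs`. -/
theorem antipode_targetCounital (x : H) : S (εt x) = εs (εt x) := by
  rw [← sw_antipode_mul, sw_targetCounital_left (by fun_prop) (by fun_prop)]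
  simp only [antipode_mul_rev, mul_assoc]
  rw [sw_const_mul, sw_antipode_mul, sourceCounital_one, mul_one]

/-- On the source base the antipode coincides with `εt`. -/
theorem antipode_sourceCounital (x : H) : S (εs x) = εt (εs x) := by
  rw [← sw_mul_antipode, sw_sourceCounital_right' (by fun_prop) (by fun_prop)]
  simp only [antipode_mul_rev, ← mul_assoc]
  rw [sw_mul_const, sw_mul_antipode, targetCounital_one, one_mul]

theorem targetCounital_targetCounital_mul (x y : H) : εt (εt x * y) = εt x * εt y := by
  rw [← sw_mul_antipode, sw_targetCounital_mul (by fun_prop) (by fun_prop)]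
  simp only [mul_assoc]
  rw [sw_const_mul, sw_mul_antipode]

theorem sourceCounital_mul_sourceCounital (x y : H) : εs (x * εs y) = εs x * εs y := by
  rw [← sw_antipode_mul, sw_mul_sourceCounital (by fun_prop) (by fun_prop)]
  simp only [← mul_assoc]
  rw [sw_mul_const, sw_antipode_mul]

theorem counit_antipode (h : H) : ε (S h) = ε h := by
  rw [← sw_sourceCounital_mul_antipode, map_sw]
  simp only [counit_sourceCounital_mul]
  rw [← map_sw, sw_mul_antipode, counit_targetCounital]

theorem targetCounital_eq_sw (x : H) : εt x = sw k (1 : H) fun a b => ε (εt x * a) • b := by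
  rw [← sw_targetCounital_left' (F := fun a b => ε a • b) (by fun_prop) (by fun_prop)]
  exact (sw_counit_left (k := k) (εt x) Lin.id').symm

theorem sourceCounital_eq_sw (x : H) : εs x = sw k (1 : H) fun a b => ε (b * εs x) • a := by
  rw [← sw_sourceCounital_right (F := fun a b => ε b • a) (by fun_prop) (by fun_prop)]
  exact (sw_counit_right (k := k) (εs x) Lin.id').symm

theorem targetCounital_eq_zero_of_antipode {x : H} (h : S (εt x) = 0) : εt x = 0 := by
  rw [antipode_targetCounital] at h
  rw [targetCounital_eq_sw]
  have : ∀ a, ε (εt x * a) = 0 := fun a => by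
    rw [← counit_sourceCounital_mul, h, zero_mul, map_zero]
  simp [this, sw]

theorem sourceCounital_eq_zero_of_antipode {x : H} (h : S (εs x) = 0) : εs x = 0 := by
  rw [antipode_sourceCounital] at h
  rw [sourceCounital_eq_sw]
  have : ∀ a, ε (a * εs x) = 0 := fun a => by
    rw [← counit_mul_targetCounital, h, mul_zero, map_zero]
  simp [this, sw]

section Surjective

variable [FiniteDimensional k H]

/-- The antipode maps the source base onto the target base: `S²` maps the target base injectively,
hence bijectively, to itself. -/
theorem exists_antipode_sourceCounital (x : H) : ∃ y : H, S (εs y) = εt x := by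
  have hm : ∀ z ∈ LinearMap.range (targetCounital k (H := H)), (antipode k ∘ₗ antipode k) z ∈
      LinearMap.range (targetCounital k (H := H)) := by
    rintro _ ⟨z, rfl⟩
    rw [LinearMap.comp_apply, antipode_targetCounital, antipode_sourceCounital]
    exact ⟨_, rfl⟩
  have hi : Function.Injective ((antipode k ∘ₗ antipode k).restrict hm) := by
    rw [injective_iff_map_eq_zero]
    rintro ⟨_, z, rfl⟩ hz
    replace hz : S (S (εt z)) = 0 := congr_arg Subtype.val hz
    rw [antipode_targetCounital] at hz
    have := sourceCounital_eq_zero_of_antipode hz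
    rw [← antipode_targetCounital] at this
    exact Subtype.ext (targetCounital_eq_zero_of_antipode this)
  obtain ⟨⟨_, z, rfl⟩, hz⟩ := LinearMap.injective_iff_surjective.mp hi ⟨εt x, x, rfl⟩
  replace hz : S (S (εt z)) = εt x := congr_arg Subtype.val hz
  exact ⟨εt z, by rw [← antipode_targetCounital, hz]⟩

/-- The antipode maps the target base onto the source base. -/
theorem exists_antipode_targetCounital (x : H) : ∃ y : H, S (εt y) = εs x := by
  have hm : ∀ z ∈ LinearMap.range (sourceCounital k (H := H)), (antipode k ∘ₗ antipode k) z ∈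
      LinearMap.range (sourceCounital k (H := H)) := by
    rintro _ ⟨z, rfl⟩
    rw [LinearMap.comp_apply, antipode_sourceCounital, antipode_targetCounital]
    exact ⟨_, rfl⟩
  have hi : Function.Injective ((antipode k ∘ₗ antipode k).restrict hm) := by
    rw [injective_iff_map_eq_zero]
    rintro ⟨_, z, rfl⟩ hz
    replace hz : S (S (εs z)) = 0 := congr_arg Subtype.val hz
    rw [antipode_sourceCounital] at hz
    have := targetCounital_eq_zero_of_antipode hz
    rw [← antipode_sourceCounital] at this
    exact Subtype.ext (sourceCounital_eq_zero_of_antipode this)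
  obtain ⟨⟨_, z, rfl⟩, hz⟩ := LinearMap.injective_iff_surjective.mp hi ⟨εs x, x, rfl⟩
  replace hz : S (S (εs z)) = εs x := congr_arg Subtype.val hz
  exact ⟨εs z, by rw [← antipode_sourceCounital, hz]⟩

end Surjective

section Bilinear

variable {F : H → H → M} (h₁ : ∀ b, Lin k (fun a => F a b)) (h₂ : ∀ a, Lin k (fun b => F a b))
include h₁ h₂

/-- `1₁ y ⊗ 1₂ = 1₁ ⊗ 1₂ S(y)` for `y` in the source base. -/
theorem sw_one_mul_sourceCounital (y : H) :
    (sw k (1 : H) fun a b => F (a * εs y) b) = sw k (1 : H) fun a b => F a (b * S (εs y)) := by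
  rw [← sw_targetCounital_snd h₁ h₂, sw_sourceCounital_right (by fun_prop) (by fun_prop),
    ← sw_one_targetCounital (by fun_prop) (by fun_prop),
    ← sw_one_targetCounital (F := fun a b => F a (b * S (εs y))) (by fun_prop) (by fun_prop)]
  simp only [targetCounital_targetCounital_mul, antipode_sourceCounital]

/-- `1₁ ⊗ z 1₂ = S(z) 1₁ ⊗ 1₂` for `z` in the target base. -/
theorem sw_one_targetCounital_mul (x : H) :
    (sw k (1 : H) fun a b => F a (εt x * b)) = sw k (1 : H) fun a b => F (S (εt x) * a) b := by
  rw [← sw_sourceCounital_fst h₁ h₂, sw_targetCounital_left' (by fun_prop) (by fun_prop),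
    ← sw_one_sourceCounital (by fun_prop) (by fun_prop),
    ← sw_one_sourceCounital (F := fun a b => F (S (εt x) * a) b) (by fun_prop) (by fun_prop)]
  simp only [sourceCounital_mul_sourceCounital, antipode_targetCounital]

/-- `S(1₂) ⊗ S(1₁) = 1₁ ⊗ 1₂`. -/
theorem sw_one_antipode_antipode :
    (sw k (1 : H) fun a b => F (S b) (S a)) = sw k (1 : H) F := by
  calc (sw k (1 : H) fun a b => F (S b) (S a)) = sw k (1 : H) fun a b => F (εs b) (εt a) := by
        rw [← sw_one_targetCounital (by fun_prop) (by fun_prop),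
          ← sw_one_sourceCounital (by fun_prop) (by fun_prop),
          ← sw_one_targetCounital (F := fun a b => F (εs b) (εt a)) (by fun_prop) (by fun_prop),
          ← sw_one_sourceCounital (F := fun a b => F (εs (εt b)) (εt a)) (by fun_prop)
            (by fun_prop)]
        simp only [antipode_targetCounital, antipode_sourceCounital]
    _ = sw k (1 : H) fun a b => sw k (1 : H) fun c d => sw k (1 : H) fun e f =>
          (ε (e * a) * ε (b * d)) • F c f := by
        refine sw_congr fun a b => ?_
        rw [Lin.apply_sourceCounital (f := fun z => F z (εt a)) (by fun_prop)]
        refine sw_congr fun c d => ?_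
        rw [Lin.apply_targetCounital (f := fun z => F c z) (by fun_prop), ← sw_const_smul]
        exact sw_congr fun e f => by rw [smul_smul, mul_comm]
    _ = sw k (1 : H) fun c d => sw k (1 : H) fun e f => ε (e * d) • F c f := by
        rw [sw_comm]
        refine sw_congr fun c d => ?_
        rw [sw_comm]
        refine sw_congr fun e f => ?_
        rw [sw_smul_const, ← counit_mul_mul_sw, mul_one]
    _ = sw k (1 : H) F := by
        rw [← sw_one_targetCounital h₁ h₂]
        refine sw_congr fun c d => ?_
        rw [Lin.apply_targetCounital (f := fun z => F c z) (by fun_prop)]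

variable [FiniteDimensional k H]

/-- `S(1₁) ⊗ 1₂` is a Casimir element of the target base. -/
theorem sw_one_casimir_target (x : H) :
    (sw k (1 : H) fun a b => F (εt x * S a) b) = sw k (1 : H) fun a b => F (S a) (b * εt x) := by
  obtain ⟨y, hy⟩ := exists_antipode_sourceCounital (k := k) x
  rw [← hy, ← sw_one_mul_sourceCounital (F := fun a b => F (S a) b) (by fun_prop) (by fun_prop)]
  simp only [antipode_mul_rev]

/-- `1₁ ⊗ S(1₂)` is a Casimir element of the source base. -/
theorem sw_one_casimir_source (y : H) :
    (sw k (1 : H) fun a b => F (εs y * a) (S b)) = sw k (1 : H) fun a b => F a (S b * εs y) := by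
  obtain ⟨x, hx⟩ := exists_antipode_targetCounital (k := k) y
  rw [← hx, ← sw_one_targetCounital_mul (F := fun a b => F a (S b)) (by fun_prop) (by fun_prop)]
  simp only [antipode_mul_rev]

/-- `ε_t(x₁) ⊗ x₂ = S(1₁) ⊗ 1₂ x`. -/
theorem sw_targetCounital_fst (x : H) :
    (sw k x fun a b => F (εt a) b) = sw k (1 : H) fun a b => F (S a) (b * x) := by
  symm
  have e : ∀ a b, F (S a) (b * x) = sw k x fun p q => F (S a) (b * εt p * q) := fun a b => by
    conv_lhs => rw [← sw_targetCounital_mul_self (k := k) x, ← sw_const_mul]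
    rw [Lin.sw_apply (f := fun z => F (S a) z) (by fun_prop)]
    simp only [mul_assoc]
  simp only [e]
  rw [sw_comm]
  calc _ = sw k x fun p q => sw k (1 : H) fun a b => F (εt p * S a) (b * q) :=
        sw_congr fun p q => (sw_one_casimir_target (F := fun a b => F a (b * q)) (by fun_prop)
          (by fun_prop) p).symm
    _ = sw k x fun p q => sw k p fun u v => sw k (1 : H) fun a b => F (u * S (a * v)) (b * q) := by
        refine sw_congr fun p q => ?_
        rw [sw_comm]
        refine sw_congr fun a b => ?_
        rw [← Lin.apply_mul_antipode (f := fun z => F (z * S a) (b * q)) (by fun_prop)]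
        simp only [antipode_mul_rev, mul_assoc]
    _ = sw k x fun p q => sw k p fun u v => F (u * S v) q := by
        rw [sw_coassoc x (F := fun u v q => sw k (1 : H) fun a b => F (u * S (a * v)) (b * q))
            (by fun_prop) (by fun_prop) (by fun_prop),
          sw_coassoc x (F := fun u v q => F (u * S v) q) (by fun_prop) (by fun_prop) (by fun_prop)]
        refine sw_congr fun u w => ?_
        rw [sw_comm, sw_one_left (F := fun c d => F (u * S c) d) w (by fun_prop) (by fun_prop)]
    _ = _ := sw_congr fun p q => Lin.apply_mul_antipode (f := fun z => F z q) (by fun_prop) p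

/-- `x₁ ⊗ ε_s(x₂) = x 1₁ ⊗ S(1₂)`. -/
theorem sw_sourceCounital_snd (x : H) :
    (sw k x fun a b => F a (εs b)) = sw k (1 : H) fun a b => F (x * a) (S b) := by
  symm
  have e : ∀ a b, F (x * a) (S b) = sw k x fun p q => F (p * (εs q * a)) (S b) := fun a b => by
    conv_lhs => rw [← sw_self_mul_sourceCounital (k := k) x, ← sw_mul_const]
    rw [Lin.sw_apply (f := fun z => F z (S b)) (by fun_prop)]
    simp only [mul_assoc]
  simp only [e]
  rw [sw_comm]
  calc _ = sw k x fun p q => sw k (1 : H) fun a b => F (p * a) (S b * εs q) :=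
        sw_congr fun p q => (sw_one_casimir_source (F := fun a b => F (p * a) b) (by fun_prop)
          (by fun_prop) q)
    _ = sw k x fun p q => sw k q fun u v => sw k (1 : H) fun a b => F (p * a) (S (u * b) * v) := by
        refine sw_congr fun p q => ?_
        rw [sw_comm]
        refine sw_congr fun a b => ?_
        rw [← Lin.apply_antipode_mul (f := fun z => F (p * a) (S b * z)) (by fun_prop)]
        simp only [antipode_mul_rev, mul_assoc]
    _ = sw k x fun p q => sw k q fun u v => F p (S u * v) := by
        rw [← sw_coassoc x (F := fun p u v => sw k (1 : H) fun a b => F (p * a) (S (u * b) * v))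
            (by fun_prop) (by fun_prop) (by fun_prop),
          ← sw_coassoc x (F := fun p u v => F p (S u * v)) (by fun_prop) (by fun_prop)
            (by fun_prop)]
        refine sw_congr fun u w => ?_
        rw [sw_one_right (F := fun c d => F c (S d * w)) u (by fun_prop) (by fun_prop)]
    _ = _ := sw_congr fun p q => Lin.apply_antipode_mul (f := fun z => F p z) (by fun_prop) q

end Bilinear

section Anticomultiplicative

local notation "Δ" => Coalgebra.comul (R := k)

/-- `Δ(x₁S(x₂)) = Δ(x₁)(S(x₃) ⊗ S(x₂))`: the flipped `S ⊗ S` behaves as a convolution inverse of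
`Δ`. -/
theorem comul_targetCounital_eq (x : H) :
    Δ (εt x) = sw k x fun a b => Δ a * sw k b fun c d => S d ⊗ₜ[k] S c := by
  calc Δ (εt x) = sw k x fun a d => sw k (1 : H) fun u v => (u * a * S d) ⊗ₜ[k] v := by
        rw [sw_comm, ← sw_tmul k (εt x), sw_targetCounital_left (by fun_prop) (by fun_prop)]
        refine sw_congr fun u v => ?_
        simp only [mul_assoc]
        rw [Lin.apply_mul_antipode (f := fun z => (u * z) ⊗ₜ[k] v) (by fun_prop)]
    _ = sw k x fun a d => sw k a fun p w => sw k w fun q c => (p * S d) ⊗ₜ[k] (q * S c) := by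
        refine sw_congr fun a d => ?_
        rw [← sw_targetCounital_snd (F := fun p w => (p * S d) ⊗ₜ[k] w) (by fun_prop) (by fun_prop)]
        refine sw_congr fun p w => ?_
        rw [Lin.apply_mul_antipode (f := fun z => (p * S d) ⊗ₜ[k] z) (by fun_prop)]
    _ = sw k x fun a d => sw k a fun w c => sw k w fun p q => (p * S d) ⊗ₜ[k] (q * S c) :=
        sw_congr fun a d => (sw_coassoc a (by fun_prop) (by fun_prop) (by fun_prop)).symm
    _ = sw k x fun a b => sw k b fun c d => sw k a fun p q => (p * S d) ⊗ₜ[k] (q * S c) :=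
        sw_coassoc x (F := fun w c d => sw k w fun p q => (p * S d) ⊗ₜ[k] (q * S c))
          (by fun_prop) (by fun_prop) (by fun_prop)
    _ = _ := by
        simp only [← sw_const_mul]
        refine sw_congr fun a b => sw_congr fun c d => ?_
        rw [← sw_tmul k a, ← sw_mul_const]
        simp only [Algebra.TensorProduct.tmul_mul_tmul]

theorem comul_sourceCounital_eq (x : H) :
    Δ (εs x) = sw k x fun a b => (sw k a fun c d => S d ⊗ₜ[k] S c) * Δ b := by
  calc Δ (εs x) = sw k x fun p w => sw k (1 : H) fun u v => u ⊗ₜ[k] (S p * (w * v)) := by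
        rw [sw_comm, ← sw_tmul k (εs x), sw_sourceCounital_right' (by fun_prop) (by fun_prop)]
        refine sw_congr fun u v => ?_
        simp only [← mul_assoc]
        rw [Lin.apply_antipode_mul (f := fun z => u ⊗ₜ[k] (z * v)) (by fun_prop)]
    _ = sw k x fun p w => sw k w fun v d => sw k v fun q c => (S q * c) ⊗ₜ[k] (S p * d) := by
        refine sw_congr fun p w => ?_
        rw [← sw_sourceCounital_fst (F := fun u v => u ⊗ₜ[k] (S p * v)) (by fun_prop) (by fun_prop)]
        refine sw_congr fun v d => ?_
        rw [Lin.apply_antipode_mul (f := fun z => z ⊗ₜ[k] (S p * d)) (by fun_prop)]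
    _ = sw k x fun p w => sw k w fun q b => sw k b fun c d => (S q * c) ⊗ₜ[k] (S p * d) :=
        sw_congr fun a d => (sw_coassoc d (F := fun q c d => (S q * c) ⊗ₜ[k] (S a * d))
          (by fun_prop) (by fun_prop) (by fun_prop))
    _ = sw k x fun a b => sw k a fun p q => sw k b fun c d => (S q * c) ⊗ₜ[k] (S p * d) :=
        (sw_coassoc x (F := fun p q b => sw k b fun c d => (S q * c) ⊗ₜ[k] (S p * d))
          (by fun_prop) (by fun_prop) (by fun_prop)).symm
    _ = _ := by
        simp only [← sw_mul_const]
        refine sw_congr fun a b => sw_congr fun c d => ?_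
        rw [← sw_tmul k b, ← sw_const_mul]
        simp only [Algebra.TensorProduct.tmul_mul_tmul]

/-- The antipode is anticomultiplicative: `Δ ∘ S` and `h ↦ S(h₂) ⊗ S(h₁)` are the two ways to
collapse `Δ(S(h₁)) Δ(h₂) (S(h₄) ⊗ S(h₃))`. -/
theorem comul_antipode (h : H) : Δ (S h) = sw k h fun a b => S b ⊗ₜ[k] S a := by
  calc Δ (S h) = sw k h fun a b => Δ (S a) * Δ (εt b) := by
        rw [← sw_antipode_mul_targetCounital, map_sw]
        simp only [WeakBialgebra.comul_mul]
    _ = sw k h fun a b => sw k b fun c d => Δ (S a) * Δ c * sw k d fun u v => S v ⊗ₜ[k] S u := by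
        simp only [comul_targetCounital_eq, ← sw_const_mul, mul_assoc]
    _ = sw k h fun a b => sw k a fun p c => Δ (S p) * Δ c * sw k b fun u v => S v ⊗ₜ[k] S u :=
        (sw_coassoc h (F := fun p c d => Δ (S p) * Δ c * sw k d fun u v => S v ⊗ₜ[k] S u)
          (by fun_prop) (by fun_prop) (by fun_prop)).symm
    _ = sw k h fun a b => Δ (εs a) * sw k b fun u v => S v ⊗ₜ[k] S u := by
        simp only [← WeakBialgebra.comul_mul, sw_mul_const, ← map_sw, sw_antipode_mul]
    _ = sw k h fun a b => sw k a fun p c => (sw k p fun u v => S v ⊗ₜ[k] S u) *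
          (Δ c * sw k b fun u v => S v ⊗ₜ[k] S u) := by
        simp only [comul_sourceCounital_eq, ← sw_mul_const, mul_assoc]
    _ = sw k h fun a b => (sw k a fun u v => S v ⊗ₜ[k] S u) * Δ (εt b) := by
        rw [sw_coassoc h (F := fun p c b => (sw k p fun u v => S v ⊗ₜ[k] S u) *
          (Δ c * sw k b fun u v => S v ⊗ₜ[k] S u)) (by fun_prop) (by fun_prop) (by fun_prop)]
        simp only [comul_targetCounital_eq, ← sw_const_mul]
    _ = sw k h fun a b => sw k a fun u v => (S v * εt b) ⊗ₜ[k] S u * Δ (1 : H) := by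
        refine sw_congr fun a b => ?_
        rw [← sw_mul_const]
        refine sw_congr fun u v => ?_
        rw [← sw_tmul k (εt b), sw_targetCounital_left' (by fun_prop) (by fun_prop),
          ← sw_tmul k (1 : H), ← sw_const_mul, ← sw_const_mul]
        simp only [Algebra.TensorProduct.tmul_mul_tmul, mul_assoc]
    _ = sw k h fun u b => S b ⊗ₜ[k] S u * Δ (1 : H) := by
        rw [sw_coassoc h (F := fun u v b => (S v * εt b) ⊗ₜ[k] S u * Δ (1 : H)) (by fun_prop)
          (by fun_prop) (by fun_prop)]
        refine sw_congr fun u w => ?_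
        conv_rhs => rw [← sw_antipode_mul_targetCounital]
        rw [Lin.sw_apply (f := fun z => z ⊗ₜ[k] S u * Δ (1 : H)) (by fun_prop)]
    _ = _ := by
        rw [← sw_one_left (F := fun a b => S b ⊗ₜ[k] S a) h (by fun_prop) (by fun_prop), sw_comm]
        refine sw_congr fun a b => ?_
        rw [← sw_tmul k (1 : H), ← sw_one_antipode_antipode (by fun_prop) (by fun_prop),
          ← sw_const_mul]
        simp only [Algebra.TensorProduct.tmul_mul_tmul, antipode_mul_rev]

theorem sw_antipode (h : H) {F : H → H → M} (h₁ : ∀ b, Lin k (fun a => F a b))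
    (h₂ : ∀ a, Lin k (fun b => F a b)) : sw k (S h) F = sw k h fun a b => F (S b) (S a) := by
  obtain ⟨B, rfl⟩ := exists_lift k h₁ h₂
  rw [sw_linearMap, comul_antipode, map_sw]

end Anticomultiplicative

end Antipode

/-! ### Ideals of the bases -/

section BaseIdeals

open Coalgebra WeakBialgebra WeakHopfAlgebra

variable {k H M : Type*} [Field k] [Ring H] [WeakHopfAlgebra k H] [AddCommGroup M] [Module k M]

local notation "ε" => Coalgebra.counit (R := k)
local notation "εt" => WeakBialgebra.targetCounital k
local notation "εs" => WeakBialgebra.sourceCounital k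
local notation "S" => WeakHopfAlgebra.antipode k

theorem sw_mem {N : Type*} [AddCommGroup N] [Module k N] [Coalgebra k M] {h : M} {F : M → M → N}
    {I : Submodule k N} (hF : ∀ a b, F a b ∈ I) : sw k h F ∈ I :=
  Submodule.sum_mem _ fun _ _ => hF _ _

/-- A linear projection onto a subspace. -/
theorem exists_projection {N : Type*} [AddCommGroup N] [Module k N] (I : Submodule k N) :
    ∃ q : N →ₗ[k] N, (∀ x, q x ∈ I) ∧ ∀ x ∈ I, q x = x := by
  obtain ⟨g, hg⟩ := LinearMap.exists_leftInverse_of_injective I.subtype (by simp)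
  exact ⟨I.subtype ∘ₗ g, fun x => (g x).2, fun x hx =>
    congr_arg Subtype.val (LinearMap.congr_fun hg ⟨x, hx⟩)⟩

theorem targetCounital_commute {z y : H} (hz : εt z = z) (hy : εs y = y) : z * y = y * z := by
  rw [← hz, ← hy, targetCounital_mul_sourceCounital]

theorem sourceCounital_antipode_of_target {z : H} (hz : εt z = z) : εs (S z) = S z := by
  rw [← hz, antipode_targetCounital, sourceCounital_sourceCounital]

theorem targetCounital_antipode_of_source {y : H} (hy : εs y = y) : εt (S y) = S y := by
  rw [← hy, antipode_sourceCounital, targetCounital_targetCounital]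

theorem sourceCounital_of_target {z : H} (hz : εt z = z) : εs z = S z := by
  rw [← hz, antipode_targetCounital]

theorem targetCounital_of_source {y : H} (hy : εs y = y) : εt y = S y := by
  rw [← hy, antipode_sourceCounital]

theorem counit_antipode_mul_of_target {z : H} (hz : εt z = z) (g : H) :
    ε (S z * g) = ε (z * g) := by
  rw [← sourceCounital_of_target hz, counit_sourceCounital_mul]

theorem counit_mul_antipode_of_source {y : H} (hy : εs y = y) (g : H) :
    ε (g * S y) = ε (g * y) := by
  rw [← targetCounital_of_source hy, counit_mul_targetCounital]

theorem targetCounital_mul_of_target {z : H} (hz : εt z = z) (y : H) :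
    εt (z * y) = z * εt y := by
  rw [← hz, targetCounital_targetCounital_mul, hz]

theorem sourceCounital_mul_of_source {y : H} (hy : εs y = y) (x : H) :
    εs (x * y) = εs x * y := by
  rw [← hy, sourceCounital_mul_sourceCounital, hy]

theorem targetCounital_source_mul_target {z y : H} (hz : εt z = z) (hy : εs y = y) :
    εt (y * z) = z * S y := by
  rw [← targetCounital_commute hz hy, targetCounital_mul_of_target hz, targetCounital_of_source hy]

theorem target_mul_mem {z w : H} (hz : εt z = z) (hw : εt w = w) : εt (z * w) = z * w := by
  rw [targetCounital_mul_of_target hz, hw]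

theorem source_mul_mem {z w : H} (hz : εs z = z) (hw : εs w = w) : εs (z * w) = z * w := by
  rw [sourceCounital_mul_of_source hw, hz]

variable [FiniteDimensional k H]

theorem exists_source_antipode_eq {z : H} (hz : εt z = z) : ∃ y, εs y = y ∧ S y = z := by
  obtain ⟨y, hy⟩ := exists_antipode_sourceCounital (k := k) z
  exact ⟨εs y, sourceCounital_sourceCounital _, by rw [hy, hz]⟩

theorem exists_target_antipode_eq {y : H} (hy : εs y = y) : ∃ z, εt z = z ∧ S z = y := by
  obtain ⟨z, hz⟩ := exists_antipode_targetCounital (k := k) y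
  exact ⟨εt z, targetCounital_targetCounital _, by rw [hz, hy]⟩

/-- The functional `ε` is nondegenerate on the target base. -/
theorem eq_zero_of_counit_mul_target {d : H} (hd : εt d = d)
    (h : ∀ w, εt w = w → ε (w * d) = 0) : d = 0 := by
  rw [← hd, targetCounital_eq,
    ← sw_one_sourceCounital (F := fun a b => ε (a * d) • b) (by fun_prop) (by fun_prop)]
  have : ∀ a, ε (εs a * d) = 0 := fun a => by
    obtain ⟨w, hw, hw'⟩ := exists_target_antipode_eq (k := k) (sourceCounital_sourceCounital a)
    rw [← hw', counit_antipode_mul_of_target hw, h w hw]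
  simp [this, sw]

/-- `S²` is the Nakayama automorphism of the functional `ε` on the target base, hence fixes its
central elements. -/
theorem antipode_antipode_of_target_central {e : H} (he : εt e = e)
    (hc : ∀ w, εt w = w → e * w = w * e) : S (S e) = e := by
  have hse := sourceCounital_antipode_of_target he
  rw [← sub_eq_zero]
  refine eq_zero_of_counit_mul_target (k := k)
    (by rw [map_sub, he, targetCounital_antipode_of_source hse]) fun w hw => ?_
  rw [mul_sub, map_sub, counit_mul_antipode_of_source hse, ← counit_antipode_mul_of_target hw,
    ← antipode_mul_rev, counit_antipode, hc w hw, sub_self]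

theorem antipode_antipode_of_source_central {e : H} (he : εs e = e)
    (hc : ∀ w, εs w = w → e * w = w * e) : S (S e) = e := by
  have hse := targetCounital_antipode_of_source he
  have h := antipode_antipode_of_target_central hse fun w hw => by
    obtain ⟨y, hy, rfl⟩ := exists_source_antipode_eq hw
    rw [← antipode_mul_rev, ← antipode_mul_rev, hc y hy]
  have hs := sourceCounital_antipode_of_target hse
  have h0 : εs (S (S e) - e) = 0 := sourceCounital_eq_zero_of_antipode (k := k) (by
    rw [map_sub, hs, he, map_sub, h, sub_self])
  rwa [map_sub, hs, he, sub_eq_zero] at h0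

/-- A two-sided ideal of the target base has a unit element. -/
theorem exists_unit_of_target_ideal {I : Submodule k H} (hI : ∀ z ∈ I, εt z = z)
    (hl : ∀ w, εt w = w → ∀ z ∈ I, w * z ∈ I) (hr : ∀ w, εt w = w → ∀ z ∈ I, z * w ∈ I) :
    ∃ e ∈ I, (∀ z ∈ I, e * z = z ∧ z * e = z) ∧ ∀ w, εt w = w → e * w = w * e := by
  obtain ⟨q, hq, hq'⟩ := exists_projection I
  have hS : ∀ a : H, εt (S (εs a)) = S (εs a) := fun a =>
    targetCounital_antipode_of_source (sourceCounital_sourceCounital a)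
  -- the Casimir element `S(1₁) ⊗ 1₂` averages the projection `q` to a right and a left unit
  set e := sw k (1 : H) fun a b => S a * q b with he
  set e' := sw k (1 : H) fun a b => q (S a) * b with he'
  have heI : e ∈ I := by
    rw [he, ← sw_one_sourceCounital (by fun_prop) (by fun_prop)]
    exact sw_mem fun a b => hl _ (hS a) _ (hq b)
  have heI' : e' ∈ I := by
    rw [he', ← sw_one_targetCounital (by fun_prop) (by fun_prop)]
    exact sw_mem fun a b => hr _ (targetCounital_targetCounital _) _ (hq _)
  have h₁ : ∀ z ∈ I, z * e = z := fun z hz => by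
    rw [he, ← sw_const_mul]
    simp only [← mul_assoc]
    have := sw_one_casimir_target (k := k) (F := fun a b => a * q b) (by fun_prop) (by fun_prop) z
    rw [hI z hz] at this
    rw [this, ← sw_one_targetCounital (by fun_prop) (by fun_prop)]
    simp only [hq' _ (hl _ (targetCounital_targetCounital _) z hz), ← mul_assoc]
    rw [sw_mul_const, sw_one_targetCounital (F := fun a b => S a * b) (by fun_prop) (by fun_prop),
      sw_antipode_mul, sourceCounital_one, one_mul]
  have h₂ : ∀ z ∈ I, e' * z = z := fun z hz => by
    rw [he', ← sw_mul_const]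
    simp only [mul_assoc]
    have := sw_one_casimir_target (k := k) (F := fun a b => q a * b) (by fun_prop) (by fun_prop) z
    rw [hI z hz] at this
    rw [← this, ← sw_one_sourceCounital (by fun_prop) (by fun_prop)]
    simp only [hq' _ (hr _ (hS _) z hz), mul_assoc]
    rw [sw_const_mul, sw_one_sourceCounital (F := fun a b => S a * b) (by fun_prop) (by fun_prop),
      sw_antipode_mul, sourceCounital_one, mul_one]
  have hee : e' = e := by rw [← h₁ e' heI', h₂ e heI]
  rw [hee] at h₂
  refine ⟨e, heI, fun z hz => ⟨h₂ z hz, h₁ z hz⟩, fun w hw => ?_⟩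
  rw [← h₁ _ (hr w hw e heI), mul_assoc, h₂ _ (hl w hw e heI)]

/-- A two-sided ideal of the source base has a unit element. -/
theorem exists_unit_of_source_ideal {I : Submodule k H} (hI : ∀ z ∈ I, εs z = z)
    (hl : ∀ w, εs w = w → ∀ z ∈ I, w * z ∈ I) (hr : ∀ w, εs w = w → ∀ z ∈ I, z * w ∈ I) :
    ∃ e ∈ I, (∀ z ∈ I, e * z = z ∧ z * e = z) ∧ ∀ w, εs w = w → e * w = w * e := by
  obtain ⟨q, hq, hq'⟩ := exists_projection I
  have hS : ∀ a : H, εs (S (εt a)) = S (εt a) := fun a =>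
    sourceCounital_antipode_of_target (targetCounital_targetCounital a)
  set e := sw k (1 : H) fun a b => a * q (S b) with he
  set e' := sw k (1 : H) fun a b => q a * S b with he'
  have heI : e ∈ I := by
    rw [he, ← sw_one_sourceCounital (by fun_prop) (by fun_prop)]
    exact sw_mem fun a b => hl _ (sourceCounital_sourceCounital a) _ (hq _)
  have heI' : e' ∈ I := by
    rw [he', ← sw_one_targetCounital (by fun_prop) (by fun_prop)]
    exact sw_mem fun a b => hr _ (hS b) _ (hq _)
  have h₁ : ∀ z ∈ I, z * e = z := fun z hz => by
    rw [he, ← sw_const_mul]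
    simp only [← mul_assoc]
    have := sw_one_casimir_source (k := k) (F := fun a b => a * q b) (by fun_prop) (by fun_prop) z
    rw [hI z hz] at this
    rw [this, ← sw_one_targetCounital (by fun_prop) (by fun_prop)]
    simp only [hq' _ (hl _ (hS _) z hz), ← mul_assoc]
    rw [sw_mul_const, sw_one_targetCounital (F := fun a b => a * S b) (by fun_prop) (by fun_prop),
      sw_mul_antipode, targetCounital_one, one_mul]
  have h₂ : ∀ z ∈ I, e' * z = z := fun z hz => by
    rw [he', ← sw_mul_const]
    simp only [mul_assoc]
    have := sw_one_casimir_source (k := k) (F := fun a b => q a * b) (by fun_prop) (by fun_prop) z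
    rw [hI z hz] at this
    rw [← this, ← sw_one_sourceCounital (by fun_prop) (by fun_prop)]
    simp only [hq' _ (hr _ (sourceCounital_sourceCounital _) z hz), mul_assoc]
    rw [sw_const_mul, sw_one_sourceCounital (F := fun a b => a * S b) (by fun_prop) (by fun_prop),
      sw_mul_antipode, targetCounital_one, mul_one]
  have hee : e' = e := by rw [← h₁ e' heI', h₂ e heI]
  rw [hee] at h₂
  refine ⟨e, heI, fun z hz => ⟨h₂ z hz, h₁ z hz⟩, fun w hw => ?_⟩
  rw [← h₁ _ (hr w hw e heI), mul_assoc, h₂ _ (hl w hw e heI)]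

omit [FiniteDimensional k H] in
/-- `hz = εt(h₁z)h₂` for `z` in the target base: right multiplication by `z` factors through the
action of `H` on the target base. -/
theorem mul_target_eq_sw {z : H} (hz : εt z = z) (h : H) :
    h * z = sw k h fun a b => εt (a * z) * b := by
  conv_lhs => rw [← sw_targetCounital_mul_self (k := k) (h * z), ← hz,
    sw_mul_targetCounital (by fun_prop) (by fun_prop), hz]

/-- An `H`-submodule of the target base, for the action `h · z = εt(hz)`, is generated by a central
idempotent of `H`. -/
theorem exists_central_unit_of_target_submodule {I : Submodule k H} (hI : ∀ z ∈ I, εt z = z)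
    (hs : ∀ h, ∀ z ∈ I, εt (h * z) ∈ I) :
    ∃ e ∈ I, (∀ z ∈ I, e * z = z) ∧ ∀ h, e * h = h * e := by
  obtain ⟨e, heI, hu, hc⟩ := exists_unit_of_target_ideal hI
    (fun w hw z hz => by
      rw [← target_mul_mem hw (hI z hz)]
      exact hs w z hz)
    (fun w hw z hz => by
      obtain ⟨y, hy, rfl⟩ := exists_source_antipode_eq hw
      rw [← targetCounital_source_mul_target (hI z hz) hy]
      exact hs y z hz)
  refine ⟨e, heI, fun z hz => (hu z hz).1, ?_⟩
  have het := hI e heI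
  have hSS := antipode_antipode_of_target_central het hc
  -- `(1 - e)He = 0` because the submodule is stable
  have h₁ : ∀ h, e * (h * e) = h * e := fun h => by
    rw [mul_target_eq_sw het h, ← sw_const_mul]
    exact sw_congr fun a b => by rw [← mul_assoc, (hu _ (hs a e heI)).1]
  have het' : εt (1 - e) = 1 - e := by rw [map_sub, targetCounital_one, het]
  -- the antipode exchanges the corners `eH(1 - e)` and `(1 - e)He`, so `ε` vanishes on the former
  have h₂ : ∀ h, ε (e * h * (1 - e)) = 0 := fun h => by
    rw [← counit_antipode, antipode_mul_rev, antipode_mul_rev, counit_antipode_mul_of_target het',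
      ← mul_assoc, ← counit_mul_antipode_of_source (sourceCounital_antipode_of_target het), hSS,
      sub_mul, sub_mul, one_mul, mul_assoc e, h₁, sub_self, map_zero]
  have h₃ : ∀ h, εt (e * h * (1 - e)) = 0 := fun h => by
    have : ∀ a, ε (a * (e * h * (1 - e))) = 0 := fun a => by
      rw [← h₂ (a * e * h)]
      congr 1
      calc a * (e * h * (1 - e)) = a * e * h * (1 - e) := by simp only [mul_assoc]
        _ = e * (a * e) * h * (1 - e) := by rw [h₁]
        _ = _ := by simp only [mul_assoc]
    rw [targetCounital_eq]
    simp [this, sw]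
  have h₄ : ∀ h, e * h * (1 - e) = 0 := fun h => by
    rw [← sw_targetCounital_mul_self (k := k) (e * h * (1 - e)), ← het',
      sw_mul_targetCounital (by fun_prop) (by fun_prop)]
    conv_lhs => rw [← het]
    rw [sw_targetCounital_mul (by fun_prop) (by fun_prop)]
    simp only [het, het', h₃, zero_mul]
    simp [sw]
  intro h
  have := h₄ h
  rwa [mul_sub, mul_one, sub_eq_zero, mul_assoc, h₁] at this

/-- A subcomodule of the source base, i.e. a subspace stable under the contractions of the second
leg of `Δ(y) = 1₁ ⊗ y1₂`, is generated by an idempotent which lies in both bases. -/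
theorem exists_unit_of_source_subcomodule {I : Submodule k H} (hI : ∀ y ∈ I, εs y = y)
    (hs : ∀ φ : H →ₗ[k] k, ∀ y ∈ I, (sw k (1 : H) fun a b => φ (y * b) • a) ∈ I) :
    ∃ e ∈ I, (∀ y ∈ I, e * y = y) ∧ (∀ y, εs y = y → e * y = y * e) ∧ εt e = e := by
  obtain ⟨e, heI, hu, hc⟩ := exists_unit_of_source_ideal hI
    (fun w hw y hy => by
      obtain ⟨z, hz, rfl⟩ := exists_target_antipode_eq hw
      rw [← sourceCounital_of_target hz, ← sourceCounital_mul_of_source (hI y hy),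
        sourceCounital_eq]
      simpa only [mul_assoc, LinearMap.comp_apply, LinearMap.mulLeft_apply] using
        hs (ε ∘ₗ LinearMap.mulLeft k z) y hy)
    (fun w hw y hy => by
      have := hs (ε ∘ₗ LinearMap.mulRight k (S w)) y hy
      simp only [LinearMap.comp_apply, LinearMap.mulRight_apply, mul_assoc] at this
      rw [← hw, ← sw_one_mul_sourceCounital (F := fun a b => ε (y * b) • a) (by fun_prop)
        (by fun_prop)] at this
      simp only [← smul_mul_assoc, sw_mul_const] at this
      rwa [← sourceCounital_eq, hI y hy, hw] at this)
  have hes := hI e heI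
  have hSS := antipode_antipode_of_source_central hes hc
  have het := targetCounital_antipode_of_source hes
  -- `e 1₁ ⊗ e 1₂ = 1₁ ⊗ e 1₂` because `e` is the unit of a subcomodule
  have key : e * S e = e := by
    have h₁ : ∀ φ : H →ₗ[k] k, φ (e * S e) = φ e := fun φ => by
      have := (hu _ (hs φ e heI)).1
      rw [← sw_const_mul] at this
      simp only [mul_smul_comm] at this
      have h2 := sw_one_targetCounital_mul (k := k) (F := fun a b => φ (e * b) • a) (by fun_prop)
        (by fun_prop) (S e)
      rw [het, hSS, this] at h2
      replace h2 := congr_arg (ε) h2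
      simp only [map_sw, map_smul, smul_eq_mul] at h2
      have e1 := sw_counit_left (k := k) (1 : H) (f := fun b => φ (e * (S e * b))) (by fun_prop)
      have e2 := sw_counit_left (k := k) (1 : H) (f := fun b => φ (e * b)) (by fun_prop)
      simp only [smul_eq_mul, mul_one] at e1 e2
      rw [← e1, ← e2]
      simpa only [mul_comm] using h2
    rw [← sub_eq_zero]
    refine (Module.forall_dual_apply_eq_zero_iff k _).mp fun φ => ?_
    rw [map_sub, h₁, sub_self]
  have hSe : S e = e := by
    have := congr_arg (S) key
    rwa [antipode_mul_rev, hSS, key, eq_comm] at this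
  refine ⟨e, heI, fun y hy => (hu y hy).1, hc, ?_⟩
  rw [targetCounital_of_source hes, hSe]

end BaseIdeals

/-! ### Semisimple modules of finite dimension -/

universe u

section SemisimpleModules

open Module

/-- The space of homomorphisms only depends on the isomorphism classes of the two modules. -/
theorem finrank_hom_congr {k B : Type*} [Field k] [Ring B] [Algebra k B]
    {X X' Y Y' : Type*} [AddCommGroup X] [AddCommGroup X'] [AddCommGroup Y] [AddCommGroup Y']
    [Module B X] [Module B X'] [Module B Y] [Module B Y'] [Module k Y] [Module k Y']
    [IsScalarTower k B Y] [IsScalarTower k B Y'] (e : X ≃ₗ[B] X') (e' : Y ≃ₗ[B] Y') :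
    finrank k (X →ₗ[B] Y) = finrank k (X' →ₗ[B] Y') := by
  refine LinearEquiv.finrank_eq
    { toFun := fun f => e'.toLinearMap ∘ₗ f ∘ₗ e.symm.toLinearMap
      invFun := fun f => e'.symm.toLinearMap ∘ₗ f ∘ₗ e.toLinearMap
      map_add' := fun f g => by ext; simp
      map_smul' := fun c f => by
        ext x
        simp only [LinearMap.comp_apply, LinearMap.smul_apply, LinearEquiv.coe_coe,
          RingHom.id_apply]
        rw [← algebraMap_smul B c, map_smul, algebraMap_smul]
      left_inv := fun f => by ext; simp
      right_inv := fun f => by ext; simp }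

instance finite_hom_of_finiteDimensional {k B : Type*} [Field k] [Ring B] [Algebra k B]
    {X Y : Type*} [AddCommGroup X] [AddCommGroup Y] [Module B X] [Module B Y] [Module k X]
    [Module k Y] [IsScalarTower k B X] [IsScalarTower k B Y] [FiniteDimensional k X]
    [FiniteDimensional k Y] : FiniteDimensional k (X →ₗ[B] Y) :=
  Module.Finite.of_injective (LinearMap.restrictScalarsₗ k B X Y k)
    (LinearMap.restrictScalars_injective k)

theorem finite_submodule_of_tower (k : Type*) {B X : Type*} [Field k] [Ring B] [Algebra k B]
    [AddCommGroup X] [Module B X] [Module k X] [IsScalarTower k B X] [FiniteDimensional k X]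
    (W : Submodule B X) : FiniteDimensional k W :=
  Module.Finite.of_injective (W.subtype.restrictScalars k) W.subtype_injective

theorem finrank_hom_prod_left {k B : Type*} [Field k] [Ring B] [Algebra k B]
    {X X' Y : Type*} [AddCommGroup X] [AddCommGroup X'] [AddCommGroup Y]
    [Module B X] [Module B X'] [Module B Y] [Module k X] [Module k X'] [Module k Y]
    [IsScalarTower k B X] [IsScalarTower k B X'] [IsScalarTower k B Y] [FiniteDimensional k X]
    [FiniteDimensional k X'] [FiniteDimensional k Y] :
    finrank k (X × X' →ₗ[B] Y) = finrank k (X →ₗ[B] Y) + finrank k (X' →ₗ[B] Y) := by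
  rw [← (LinearMap.coprodEquiv (M := X) (M₂ := X') (M₃ := Y) (R := B) k).finrank_eq,
    finrank_prod]

theorem finrank_hom_prod_right {k B : Type*} [Field k] [Ring B] [Algebra k B]
    {X Y Y' : Type*} [AddCommGroup X] [AddCommGroup Y] [AddCommGroup Y']
    [Module B X] [Module B Y] [Module B Y'] [Module k X] [Module k Y] [Module k Y']
    [IsScalarTower k B X] [IsScalarTower k B Y] [IsScalarTower k B Y'] [FiniteDimensional k X]
    [FiniteDimensional k Y] [FiniteDimensional k Y'] :
    finrank k (X →ₗ[B] Y × Y') = finrank k (X →ₗ[B] Y) + finrank k (X →ₗ[B] Y') := by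
  rw [← (LinearMap.prodEquiv (M := X) (M₂ := Y) (M₃ := Y') (R := B) k).finrank_eq,
    finrank_prod]

/-- Two semisimple modules are isomorphic if
`dim Hom(X, X) + dim Hom(Y, Y) ≤ dim Hom(X, Y) + dim Hom(Y, X)`: the form `dim Hom` is a positive
definite quadratic form in the multiplicities of the simple modules. -/
theorem nonempty_linearEquiv_of_finrank_hom_le (k : Type*) {B : Type*} [Field k] [Ring B]
    [Algebra k B] (n : ℕ) : ∀ (X Y : Type u) [AddCommGroup X] [AddCommGroup Y] [Module B X]
    [Module B Y] [Module k X] [Module k Y] [IsScalarTower k B X] [IsScalarTower k B Y]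
    [FiniteDimensional k X] [FiniteDimensional k Y] [IsSemisimpleModule B X]
    [IsSemisimpleModule B Y], finrank k X + finrank k Y ≤ n →
    finrank k (X →ₗ[B] X) + finrank k (Y →ₗ[B] Y) ≤
      finrank k (X →ₗ[B] Y) + finrank k (Y →ₗ[B] X) → Nonempty (X ≃ₗ[B] Y) := by
  induction n using Nat.strong_induction_on with
  | _ n ih =>
  -- the inductive step: a nonzero map allows to cancel a common direct summand
  have step : ∀ (X Y : Type u) [AddCommGroup X] [AddCommGroup Y] [Module B X]
      [Module B Y] [Module k X] [Module k Y] [IsScalarTower k B X] [IsScalarTower k B Y]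
      [FiniteDimensional k X] [FiniteDimensional k Y] [IsSemisimpleModule B X]
      [IsSemisimpleModule B Y], finrank k X + finrank k Y ≤ n →
      finrank k (X →ₗ[B] X) + finrank k (Y →ₗ[B] Y) ≤
        finrank k (X →ₗ[B] Y) + finrank k (Y →ₗ[B] X) → (∃ f : X →ₗ[B] Y, f ≠ 0) →
      Nonempty (X ≃ₗ[B] Y) := by
    intro X Y _ _ _ _ _ _ _ _ _ _ _ _ hn h ⟨f, hf⟩
    obtain ⟨C, hC⟩ := exists_isCompl (LinearMap.ker f)
    obtain ⟨Y', hY'⟩ := exists_isCompl (LinearMap.range f)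
    have eC : C ≃ₗ[B] LinearMap.range f :=
      (Submodule.quotientEquivOfIsCompl _ _ hC).symm.trans f.quotKerEquivRange
    have eX : X ≃ₗ[B] C × LinearMap.ker f := (Submodule.prodEquivOfIsCompl _ _ hC.symm).symm
    have eY : Y ≃ₗ[B] C × Y' := (Submodule.prodEquivOfIsCompl _ _ hY').symm.trans
      (eC.symm.prodCongr (.refl B Y'))
    have := finite_submodule_of_tower k C
    have := finite_submodule_of_tower k (LinearMap.ker f)
    have := finite_submodule_of_tower k Y'
    have hCpos : 0 < finrank k C := by
      rw [finrank_pos_iff, Submodule.nontrivial_iff_ne_bot]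
      rintro rfl
      exact hf (LinearMap.ker_eq_top.mp (by simpa using hC.sup_eq_top))
    have dX := (eX.restrictScalars k).finrank_eq
    have dY := (eY.restrictScalars k).finrank_eq
    rw [finrank_prod] at dX dY
    rw [finrank_hom_congr (k := k) eX eX, finrank_hom_congr (k := k) eX eY,
      finrank_hom_congr (k := k) eY eX, finrank_hom_congr (k := k) eY eY] at h
    simp only [finrank_hom_prod_left, finrank_hom_prod_right] at h
    obtain ⟨e⟩ := ih (finrank k (LinearMap.ker f) + finrank k Y') (by omega) (LinearMap.ker f) Y'
      le_rfl (by omega)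
    exact ⟨eX.trans (((LinearEquiv.refl B C).prodCongr e).trans eY.symm)⟩
  intro X Y _ _ _ _ _ _ _ _ _ _ _ _ hn h
  by_cases h₁ : ∃ f : X →ₗ[B] Y, f ≠ 0
  · exact step X Y hn h h₁
  by_cases h₂ : ∃ f : Y →ₗ[B] X, f ≠ 0
  · exact (step Y X (by omega) (by omega) h₂).map LinearEquiv.symm
  push Not at h₁ h₂
  have z₁ : finrank k (X →ₗ[B] Y) = 0 := by
    have : Subsingleton (X →ₗ[B] Y) := ⟨fun f g => by rw [h₁ f, h₁ g]⟩
    exact finrank_zero_of_subsingleton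
  have z₂ : finrank k (Y →ₗ[B] X) = 0 := by
    have : Subsingleton (Y →ₗ[B] X) := ⟨fun f g => by rw [h₂ f, h₂ g]⟩
    exact finrank_zero_of_subsingleton
  have sX : Subsingleton X := by
    have := finrank_zero_iff.mp (show finrank k (X →ₗ[B] X) = 0 by omega)
    exact ⟨fun x y => LinearMap.congr_fun (Subsingleton.elim (LinearMap.id (R := B))
      (0 : X →ₗ[B] X)) x |>.trans (LinearMap.congr_fun (Subsingleton.elim (LinearMap.id (R := B))
      (0 : X →ₗ[B] X)) y).symm⟩
  have sY : Subsingleton Y := by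
    have := finrank_zero_iff.mp (show finrank k (Y →ₗ[B] Y) = 0 by omega)
    exact ⟨fun x y => LinearMap.congr_fun (Subsingleton.elim (LinearMap.id (R := B))
      (0 : Y →ₗ[B] Y)) x |>.trans (LinearMap.congr_fun (Subsingleton.elim (LinearMap.id (R := B))
      (0 : Y →ₗ[B] Y)) y).symm⟩
  exact ⟨{ (0 : X →ₗ[B] Y) with
    invFun := 0
    left_inv := fun x => Subsingleton.elim _ _
    right_inv := fun x => Subsingleton.elim _ _ }⟩

/-- Among infinitely many semisimple submodules of a finite-dimensional module, two are
isomorphic. -/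
theorem exists_lt_nonempty_linearEquiv (k : Type*) {R M : Type*} [Field k] [Ring R] [Algebra k R]
    [AddCommGroup M] [Module R M] [Module k M] [IsScalarTower k R M] [FiniteDimensional k M]
    (N : ℕ → Submodule R M) (hN : ∀ n, IsSemisimpleModule R (N n)) :
    ∃ n m, n < m ∧ Nonempty (N n ≃ₗ[R] N m) := by
  have : IsNoetherian R M := isNoetherian_of_tower k inferInstance
  let d := finrank k M
  -- the type of a semisimple submodule: the list of the isotypic components of its summands
  let T := Σ l : Fin (d + 1), Fin l → isotypicComponents R M
  have key : ∀ n, ∃ t : T, ∃ L : Fin t.1 → Submodule R M,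
      (∀ i, IsSimpleModule R (L i) ∧ isotypicComponent R M (L i) = t.2 i) ∧
      Nonempty (N n ≃ₗ[R] ∀ i, L i) := fun n => by
    classical
    obtain ⟨l, L, e, hL⟩ := IsSemisimpleModule.exists_linearEquiv_fin_dfinsupp R (N n)
    have := finite_submodule_of_tower k (N n)
    have := fun i => finite_submodule_of_tower k (L i)
    let e₁ : N n ≃ₗ[R] ∀ i, L i := e.trans (DFinsupp.linearEquivFunOnFintype ..)
    have hl : l ≤ d := by
      have h₁ := (e₁.restrictScalars k).finrank_eq
      rw [finrank_pi_fintype] at h₁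
      have h₂ : ∀ i, 1 ≤ finrank k (L i) := fun i => by
        have := IsSimpleModule.nontrivial R (L i)
        exact finrank_pos
      calc l = ∑ _i : Fin l, 1 := by simp
        _ ≤ ∑ i, finrank k (L i) := Finset.sum_le_sum fun i _ => h₂ i
        _ = finrank k (N n) := h₁.symm
        _ ≤ d := Submodule.finrank_le ((N n).restrictScalars k)
    let L' : Fin l → Submodule R M := fun i => (L i).map (N n).subtype
    let e₂ : ∀ i, L i ≃ₗ[R] L' i := fun i => (L i).equivMapOfInjective _ (N n).subtype_injective
    have hL' : ∀ i, IsSimpleModule R (L' i) := fun i => IsSimpleModule.congr (e₂ i).symm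
    exact ⟨⟨⟨l, by omega⟩, fun i => ⟨isotypicComponent R M (L' i), L' i, hL' i, rfl⟩⟩, L',
      fun i => ⟨hL' i, rfl⟩, ⟨e₁.trans (LinearEquiv.piCongrRight e₂)⟩⟩
  choose t L hL e using key
  have aux : ∀ n m, t n = t m → Nonempty (N n ≃ₗ[R] N m) := fun n m h => by
    have hn := hL n
    have hm := hL m
    obtain ⟨en⟩ := e n
    obtain ⟨em⟩ := e m
    revert em en hm hn
    generalize L n = Ln
    generalize L m = Lm
    revert Ln Lm
    rw [h]
    intro Ln Lm hn hm en em
    have : ∀ i, Nonempty (Ln i ≃ₗ[R] Lm i) := fun i => by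
      have := (hn i).1
      have := (hm i).1
      refine isIsotypicOfType_submodule_iff.mp
        (IsIsotypicOfType.isotypicComponent R M (Lm i)) (Ln i) ?_
      rw [(hm i).2, ← (hn i).2]
      exact Submodule.le_isotypicComponent _
    exact ⟨en.trans ((LinearEquiv.piCongrRight fun i => (this i).some).trans em.symm)⟩
  obtain ⟨n, m, hnm, h⟩ := Finite.exists_ne_map_eq_of_infinite t
  rcases lt_or_gt_of_ne hnm with hlt | hlt
  · exact ⟨n, m, hlt, aux n m h⟩
  · exact ⟨m, n, hlt, aux m n h.symm⟩

/-- Version of `exists_lt_nonempty_linearEquiv` for subspaces stable under a set `G` of operators,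
in which every stable subspace has a stable complement. -/
theorem exists_lt_equivariant_equiv {k M : Type*} [Field k] [AddCommGroup M] [Module k M]
    [FiniteDimensional k M] (G : Set (Module.End k M)) (N : ℕ → Submodule k M)
    (hG : ∀ n, ∀ g ∈ G, ∀ x ∈ N n, g x ∈ N n)
    (hc : ∀ n, ∀ W ≤ N n, (∀ g ∈ G, ∀ x ∈ W, g x ∈ W) →
      ∃ W' ≤ N n, (∀ g ∈ G, ∀ x ∈ W', g x ∈ W') ∧ W ⊓ W' = ⊥ ∧ W ⊔ W' = N n) :
    ∃ n m, n < m ∧ ∃ T : N n ≃ₗ[k] N m, ∀ g ∈ G, ∀ x y : N n, (y : M) = g x →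
      (T y : M) = g (T x) := by
  let R := Algebra.adjoin k G
  have hR : ∀ W : Submodule k M, (∀ g ∈ G, ∀ x ∈ W, g x ∈ W) → ∀ r ∈ R, ∀ x ∈ W, r x ∈ W := by
    intro W hW r hr
    induction hr using Algebra.adjoin_induction with
    | mem g hg => exact hW g hg
    | algebraMap c => exact fun x hx => W.smul_mem c hx
    | add a b _ _ ha hb => exact fun x hx => W.add_mem (ha x hx) (hb x hx)
    | mul a b _ _ ha hb => exact fun x hx => ha _ (hb x hx)
  let mk : ∀ W : Submodule k M, (∀ g ∈ G, ∀ x ∈ W, g x ∈ W) → Submodule R M := fun W hW =>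
    { W with smul_mem' := fun r x hx => hR W hW r r.2 x hx }
  have hss : ∀ n, IsSemisimpleModule R (mk (N n) (hG n)) := fun n => by
    refine @IsSemisimpleModule.mk _ _ _ _ _ ⟨fun p => ?_⟩
    let W : Submodule k M := (p.map (mk (N n) (hG n)).subtype).restrictScalars k
    have hW : W ≤ N n := fun x hx => by
      obtain ⟨y, -, rfl⟩ := hx
      exact y.2
    obtain ⟨W', hW', hs, h₁, h₂⟩ := hc n W hW fun g hg x hx =>
      (p.map (mk (N n) (hG n)).subtype).smul_mem (⟨g, Algebra.subset_adjoin hg⟩ : R) hx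
    refine ⟨(mk W' hs).comap (mk (N n) (hG n)).subtype, ?_, ?_⟩
    · rw [disjoint_iff, eq_bot_iff]
      rintro x ⟨hx, hx'⟩
      have : (x : M) ∈ W ⊓ W' := ⟨⟨x, hx, rfl⟩, hx'⟩
      rw [h₁] at this
      exact Subtype.ext this
    · rw [codisjoint_iff, eq_top_iff]
      rintro ⟨x, hx⟩ -
      have : x ∈ W ⊔ W' := by rw [h₂]; exact hx
      obtain ⟨_, ⟨w, hw, rfl⟩, w', hw', h⟩ := Submodule.mem_sup.mp this
      exact Submodule.mem_sup.mpr ⟨w, hw, ⟨w', hW' hw'⟩, hw', Subtype.ext h⟩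
  obtain ⟨n, m, hnm, ⟨T⟩⟩ := exists_lt_nonempty_linearEquiv k (fun n => mk (N n) (hG n)) hss
  refine ⟨n, m, hnm, T.restrictScalars k, fun g hg x y hy => ?_⟩
  have : y = (⟨g, Algebra.subset_adjoin hg⟩ : R) • (show mk (N n) (hG n) from x) := Subtype.ext hy
  have h2 := congr_arg Subtype.val (congr_arg T this)
  rw [map_smul] at h2
  exact h2

end SemisimpleModules

/-! ### Right integrals -/

section RightIntegrals

open Coalgebra WeakBialgebra WeakHopfAlgebra

variable {k H M : Type*} [Field k] [Ring H] [WeakHopfAlgebra k H] [AddCommGroup M] [Module k M]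

local notation "ε" => Coalgebra.counit (R := k)
local notation "εt" => WeakBialgebra.targetCounital k
local notation "εs" => WeakBialgebra.sourceCounital k
local notation "S" => WeakHopfAlgebra.antipode k

/-- If the first legs of `Δ(v)` lie in `V`, then a sum over `Δ(v)` may be evaluated in `V`. -/
theorem sw_mem_of_left_leg {C N : Type*} [AddCommGroup C] [Module k C] [Coalgebra k C]
    [FiniteDimensional k C] [AddCommGroup N] [Module k N] {v : C}
    {V : Submodule k C} (hv : ∀ φ : C →ₗ[k] k, (sw k v fun a b => φ b • a) ∈ V)
    {F : C → C → N} (h₁ : ∀ b, Lin k (fun a => F a b)) (h₂ : ∀ a, Lin k (fun b => F a b))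
    {W : Submodule k N} (hF : ∀ a ∈ V, ∀ b, F a b ∈ W) : sw k v F ∈ W := by
  let e := Module.finBasis k C
  have h : sw k v F = ∑ i, F (sw k v fun a b => e.coord i b • a) (e i) := by
    simp only [(h₁ _).sw_apply]
    calc sw k v F = sw k v fun a b => ∑ i, F (e.coord i b • a) (e i) := sw_congr fun a b => by
          conv_lhs => rw [← e.sum_repr b]
          rw [(h₂ a).map_sum]
          refine Finset.sum_congr rfl fun i _ => ?_
          rw [(h₂ a).map_smul, (h₁ _).map_smul]
          rfl
      _ = _ := by
          simp only [sw]
          exact Finset.sum_comm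
  rw [h]
  exact Submodule.sum_mem _ fun i _ => hF _ (hv _) _

variable (k) in
/-- A right integral: `p h = p εs(h)` for all `h`. -/
def IsRightIntegral (p : H) : Prop := ∀ h, p * h = p * εs h

theorem IsRightIntegral.mul_left {p : H} (hp : IsRightIntegral k p) (x : H) :
    IsRightIntegral k (x * p) := fun h => by rw [mul_assoc, hp, mul_assoc]

/-- A right integral satisfies `p₁h ⊗ p₂ = p₁ ⊗ p₂S(h)`. -/
theorem IsRightIntegral.sw_mul_left {p : H} (hp : IsRightIntegral k p) (h : H) {F : H → H → M}
    (h₁ : ∀ b, Lin k (fun a => F a b)) (h₂ : ∀ a, Lin k (fun b => F a b)) :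
    (sw k p fun a b => F (a * h) b) = sw k p fun a b => F a (b * S h) := by
  calc (sw k p fun a b => F (a * h) b)
      = sw k p fun a b => sw k (1 : H) fun c d => F (a * (c * h)) (b * d) := by
        rw [← sw_one_right p (F := fun a b => F (a * h) b) (by fun_prop) (by fun_prop)]
        simp only [mul_assoc]
    _ = sw k p fun a b => sw k h fun c d => F (a * c) (b * εt d) := sw_congr fun a b => by
        rw [sw_targetCounital_snd (F := fun c d => F (a * c) (b * d)) (by fun_prop) (by fun_prop)]
    _ = sw k p fun a b => sw k h fun c d => sw k d fun q s => F (a * c) (b * (q * S s)) :=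
        sw_congr fun a b => sw_congr fun c d => by
        rw [Lin.apply_mul_antipode (f := fun x => F (a * c) (b * x)) (by fun_prop)]
    _ = sw k p fun a b => sw k h fun u d => sw k u fun c q => F (a * c) (b * q * S d) :=
        sw_congr fun a b => by
        rw [← sw_coassoc h (F := fun c q s => F (a * c) (b * (q * S s))) (by fun_prop)
          (by fun_prop) (by fun_prop)]
        simp only [mul_assoc]
    _ = sw k h fun u d => sw k p fun a b => sw k u fun c q => F (a * c) (b * q * S d) :=
        sw_comm _ _ _
    _ = sw k h fun u d => sw k p fun a b => F a (b * (εs u * S d)) := sw_congr fun u d => by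
        rw [← sw_mul p u (F := fun a b => F a (b * S d)) (by fun_prop) (by fun_prop), hp u,
          sw_mul_sourceCounital (by fun_prop) (by fun_prop)]
        simp only [mul_assoc]
    _ = sw k p fun a b => sw k h fun u d => F a (b * (εs u * S d)) := sw_comm _ _ _
    _ = _ := sw_congr fun a b => by
        rw [← Lin.sw_apply (f := fun x => F a (b * x)) (by fun_prop),
          sw_sourceCounital_mul_antipode]

variable (k H) in
/-- The span of the first legs of the coproducts of the right integrals. -/
def integralLegs : Submodule k H :=
  Submodule.span k {x | ∃ p, IsRightIntegral k p ∧ ∃ φ : H →ₗ[k] k, x = sw k p fun a b => φ b • a}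

theorem integralLegs_mul_mem {v : H} (hv : v ∈ integralLegs k H) (h : H) :
    v * h ∈ integralLegs k H := by
  induction hv using Submodule.span_induction with
  | mem x hx =>
    obtain ⟨p, hp, φ, rfl⟩ := hx
    refine Submodule.subset_span ⟨p, hp, φ ∘ₗ LinearMap.mulRight k (S h), ?_⟩
    rw [← sw_mul_const]
    simp only [smul_mul_assoc, LinearMap.comp_apply, LinearMap.mulRight_apply]
    exact hp.sw_mul_left h (F := fun a b => φ b • a) (by fun_prop) (by fun_prop)
  | zero => rw [zero_mul]; exact Submodule.zero_mem _
  | add x y _ _ hx hy => rw [add_mul]; exact Submodule.add_mem _ hx hy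
  | smul c x _ hx => rw [smul_mul_assoc]; exact Submodule.smul_mem _ _ hx

theorem integralLegs_comul {v : H} (hv : v ∈ integralLegs k H) (ψ : H →ₗ[k] k) :
    (sw k v fun a b => ψ b • a) ∈ integralLegs k H := by
  have hL : Lin k fun v : H => sw k v fun a b => ψ b • a := by fun_prop
  induction hv using Submodule.span_induction with
  | mem x hx =>
    obtain ⟨p, hp, φ, rfl⟩ := hx
    obtain ⟨χ, hχ⟩ : ∃ χ : H →ₗ[k] k, ∀ b, χ b = sw k b fun c d => ψ c * φ d :=
      ⟨IsLinearMap.mk' (fun b => sw k b fun c d => ψ c * φ d)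
        (show Lin k fun b => sw k b fun c d => ψ c * φ d by fun_prop), fun _ => rfl⟩
    refine Submodule.subset_span ⟨p, hp, χ, ?_⟩
    rw [hL.sw_apply]
    simp only [hL.map_smul, hχ, ← sw_smul_const]
    rw [← sw_coassoc p (F := fun a c d => (ψ c * φ d) • a) (by fun_prop) (by fun_prop)
      (by fun_prop)]
    refine sw_congr fun a b => ?_
    rw [← sw_const_smul]
    exact sw_congr fun c d => by rw [smul_smul, mul_comm]
  | zero => rw [hL.map_zero]; exact Submodule.zero_mem _
  | add x y _ _ hx hy => rw [hL.map_add]; exact Submodule.add_mem _ hx hy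
  | smul c x _ hx => rw [hL.map_smul]; exact Submodule.smul_mem _ _ hx

section Frobenius

variable [FiniteDimensional k H] {f : H →ₗ[k] k}

/-- Over a separating form every functional is represented. -/
theorem exists_forall_apply_mul (hf : ∀ p, (∀ h, f (p * h) = 0) → p = 0) (φ : H →ₗ[k] k) :
    ∃ p, ∀ h, f (p * h) = φ h := by
  have hinj : Function.Injective ((LinearMap.mul k H).compr₂ f) := by
    rw [← LinearMap.ker_eq_bot, LinearMap.ker_eq_bot']
    exact fun p hp => hf p fun h => LinearMap.congr_fun hp h
  obtain ⟨p, hp⟩ := (LinearMap.injective_iff_surjective_of_finrank_eq_finrank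
    (Subspace.dual_finrank_eq (K := k) (V := H)).symm).mp hinj φ
  exact ⟨p, fun h => LinearMap.congr_fun hp h⟩

omit [FiniteDimensional k H] in
/-- A functional which factors through `εs` is represented by a right integral. -/
theorem isRightIntegral_of_apply_mul (hf : ∀ p, (∀ h, f (p * h) = 0) → p = 0) {p : H}
    {ω : H →ₗ[k] k} (h : ∀ h, f (p * h) = ω (εs h)) : IsRightIntegral k p := fun x => by
  rw [← sub_eq_zero, ← mul_sub]
  refine hf _ fun y => ?_
  rw [mul_assoc, h, sub_mul, map_sub, sourceCounital_sourceCounital_mul, sub_self, map_zero]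

/-- The target base acts faithfully on the right integrals. -/
theorem eq_zero_of_mul_integral (hf : ∀ p, (∀ h, f (p * h) = 0) → p = 0) {z : H} (hz : εt z = z)
    (h : ∀ p, IsRightIntegral k p → z * p = 0) : z = 0 := by
  let I : Submodule k H :=
    { carrier := {z | εt z = z ∧ ∀ p, IsRightIntegral k p → z * p = 0}
      zero_mem' := ⟨map_zero _, fun p _ => zero_mul p⟩
      add_mem' := fun {a b} ha hb => ⟨by rw [map_add, ha.1, hb.1],
        fun p hp => by rw [add_mul, ha.2 p hp, hb.2 p hp, add_zero]⟩
      smul_mem' := fun c a ha => ⟨by rw [map_smul, ha.1],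
        fun p hp => by rw [smul_mul_assoc, ha.2 p hp, smul_zero]⟩ }
  obtain ⟨e, ⟨he, heI⟩, hu, hc⟩ := exists_central_unit_of_target_submodule (k := k) (I := I)
    (fun z hz => hz.1) (fun h z hz => ⟨targetCounital_targetCounital _, fun p hp => by
      rw [targetCounital_mul_eq, ← sw_mul_const]
      simp only [mul_assoc, hz.1, hz.2 _ (hp.mul_left _), mul_zero]
      simp [sw]⟩)
  -- the integral `r` representing `ε` is annihilated by the central idempotent `e`
  obtain ⟨r, hr⟩ := exists_forall_apply_mul hf (ε)
  have hri : IsRightIntegral k r := isRightIntegral_of_apply_mul (ω := ε) hf fun h => by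
    rw [hr, counit_sourceCounital]
  have h₁ : ∀ h, ε (h * e) = 0 := fun h => by
    rw [← hc, ← hr, ← mul_assoc, ← hc, heI r hri, zero_mul, map_zero]
  have h₂ : e = 0 := by
    rw [← he, targetCounital_eq]
    simp [h₁, sw]
  rw [← hu z ⟨hz, h⟩, h₂, zero_mul]

/-- The legs of the integrals form a right ideal and a subcomodule; it is all of `H`, because a
functional `φ` vanishing on it gives the element `φ(S(1₁))1₂` of the target base, which annihilates
the right integrals. -/
theorem one_mem_integralLegs (hf : ∀ p, (∀ h, f (p * h) = 0) → p = 0) :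
    (1 : H) ∈ integralLegs k H := by
  by_contra hn
  obtain ⟨φ, hφ, hφV⟩ := Submodule.exists_dual_map_eq_bot_of_notMem hn inferInstance
  replace hφV : ∀ v ∈ integralLegs k H, φ v = 0 := fun v hv => by
    have := Submodule.mem_map_of_mem (f := φ) hv
    rwa [hφV, Submodule.mem_bot] at this
  let z := sw k (1 : H) fun a b => φ (S a) • b
  have hz : εt z = z := by
    simp only [z, map_sw, map_smul]
    exact sw_one_targetCounital (F := fun a b => φ (S a) • b) (by fun_prop) (by fun_prop)
  have h₁ : ∀ v ∈ integralLegs k H, εt v ∈ integralLegs k H := fun v hv => by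
    rw [← sw_mul_antipode]
    exact sw_mem_of_left_leg (integralLegs_comul hv) (by fun_prop) (by fun_prop)
      fun a ha b => integralLegs_mul_mem ha _
  have h₂ : ∀ v ∈ integralLegs k H, z * εt v = 0 := fun v hv => by
    simp only [z, ← sw_mul_const, smul_mul_assoc]
    rw [← sw_one_casimir_target (F := fun a b => φ a • b) (by fun_prop) (by fun_prop)]
    simp only [hφV _ (integralLegs_mul_mem (h₁ v hv) _), zero_smul]
    simp [sw]
  have h₃ : ∀ v ∈ integralLegs k H, z * v = 0 := fun v hv => by
    rw [← sw_targetCounital_mul_self (k := k) v, ← sw_const_mul, ← Submodule.mem_bot k]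
    refine sw_mem_of_left_leg (integralLegs_comul hv) (by fun_prop) (by fun_prop)
      fun a ha b => ?_
    rw [Submodule.mem_bot, ← mul_assoc, h₂ a ha, zero_mul]
  have h₄ : z = 0 := eq_zero_of_mul_integral hf hz fun p hp => by
    refine (Module.forall_dual_apply_eq_zero_iff k _).mp fun ψ => ?_
    have h := sw_targetCounital_mul (k := k) (F := fun a b => ε a • ψ b) (by fun_prop)
      (by fun_prop) p z
    rw [hz, sw_counit_left (k := k) (z * p) (f := fun b => ψ b) (by fun_prop)] at h
    have h' := h₃ _ (Submodule.subset_span ⟨p, hp, ψ, rfl⟩)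
    rw [h, ← map_zero (Coalgebra.counit (R := k) (A := H)), ← h', ← sw_const_mul, map_sw]
    exact sw_congr fun a b => by simp [mul_comm]
  apply hφ
  have h := congr_arg (ε) h₄
  simp only [z, map_sw, map_smul, map_zero] at h
  have h' := sw_counit_right (k := k) (1 : H) (f := fun a => φ (S a)) (by fun_prop)
  simp only [smul_eq_mul, antipode_one] at h h'
  rw [← h', ← h]
  exact sw_congr fun a b => mul_comm _ _

/-- The antipode of a Frobenius weak Hopf algebra is bijective. -/
theorem antipode_bijective (hf : ∀ p, (∀ h, f (p * h) = 0) → p = 0) :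
    Function.Bijective (S : H → H) := by
  have : Function.Injective (antipode k (H := H)) := by
    rw [← LinearMap.ker_eq_bot, LinearMap.ker_eq_bot']
    intro h hh
    have : ∀ v ∈ integralLegs k H, v * h = 0 := fun v hv => by
      induction hv using Submodule.span_induction with
      | mem x hx =>
        obtain ⟨p, hp, φ, rfl⟩ := hx
        rw [← sw_mul_const]
        simp only [smul_mul_assoc]
        rw [hp.sw_mul_left h (F := fun a b => φ b • a) (by fun_prop) (by fun_prop)]
        simp [hh, sw]
      | zero => rw [zero_mul]
      | add x y _ _ hx hy => rw [add_mul, hx, hy, add_zero]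
      | smul c x _ hx => rw [smul_mul_assoc, hx, smul_zero]
    rw [← one_mul h, this 1 (one_mem_integralLegs hf)]
  exact ⟨this, LinearMap.injective_iff_surjective.mp this⟩

omit [FiniteDimensional k H] in
theorem antipode_sourceCounital_eq (h : H) : S (εs h) = εt (S h) := by
  rw [← sw_antipode_mul, map_sw, ← sw_mul_antipode, sw_antipode _ (by fun_prop) (by fun_prop)]
  simp only [antipode_mul_rev]

omit [FiniteDimensional k H] in
/-- The antipode maps right integrals to left integrals. -/
theorem IsRightIntegral.mul_antipode (hS : Function.Bijective (S : H → H)) {q : H}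
    (hq : IsRightIntegral k q) (h : H) : h * S q = εt h * S q := by
  obtain ⟨h, rfl⟩ := hS.2 h
  rw [← antipode_mul_rev, hq, antipode_mul_rev, antipode_sourceCounital_eq]

/-- For a right integral `q` and a functional `φ` there is an element `a` of the source base with
`εt(p₁)φ(p₂)q = ap` for all right integrals `p`. Thus the action on `q` of elements of the target
base made out of `p` is the action on `p` of elements of the source base made out of `q`. -/
theorem exists_source_coefficient (hS : Function.Bijective (S : H → H)) {q : H}
    (hq : IsRightIntegral k q) (φ : H →ₗ[k] k) :
    ∃ a, εs a = a ∧ ∀ p, IsRightIntegral k p →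
      (sw k p fun b c => φ c • εt b) * q = a * p := by
  let e := Module.finBasis k H
  refine ⟨∑ i, sw k (1 : H) fun b c =>
    (sw k (c * S q * S (S (e i))) fun u v => e.coord i u * φ v) • b, ?_, fun p hp => ?_⟩
  · rw [map_sum]
    refine Finset.sum_congr rfl fun i _ => ?_
    rw [map_sw]
    simp only [map_smul]
    exact sw_one_sourceCounital (F := fun b c =>
      (sw k (c * S q * S (S (e i))) fun u v => e.coord i u * φ v) • b) (by fun_prop) (by fun_prop)
  · have h₁ : ∀ i, (sw k p fun b c => (sw k c fun u v => e.coord i u * φ v) • (b * (S (e i) * q)))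
        = (sw k (1 : H) fun b c =>
          (sw k (c * S q * S (S (e i))) fun u v => e.coord i u * φ v) • b) * p := fun i => by
      rw [hp.sw_mul_left (S (e i) * q)
        (F := fun b c => (sw k c fun u v => e.coord i u * φ v) • b) (by fun_prop) (by fun_prop)]
      simp only [antipode_mul_rev, ← mul_assoc]
      have h₂ : ∀ c, c * S q * S (S (e i)) = εt c * S q * S (S (e i)) := fun c => by
        rw [← hq.mul_antipode hS]
      rw [sw_congr fun b c => by rw [h₂ c]]
      rw [sw_targetCounital_snd
        (F := fun b c => (sw k (c * S q * S (S (e i))) fun u v => e.coord i u * φ v) • b)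
        (by fun_prop) (by fun_prop), ← sw_mul_const]
      simp only [smul_mul_assoc]
    rw [Finset.sum_mul, ← Finset.sum_congr rfl fun i _ => h₁ i, ← sw_mul_const]
    calc (sw k p fun b c => φ c • εt b * q)
        = sw k p fun b c => sw k b fun u v => φ c • (u * (S v * q)) := sw_congr fun b c => by
          rw [← sw_mul_antipode, sw_const_smul, smul_mul_assoc, ← sw_mul_const]
          simp only [mul_assoc]
      _ = sw k p fun b c => sw k c fun u v => φ v • (b * (S u * q)) :=
          sw_coassoc p (F := fun u v c => φ c • (u * (S v * q))) (by fun_prop) (by fun_prop)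
            (by fun_prop)
      _ = sw k p fun b c => ∑ i, sw k c fun u v => (e.coord i u * φ v) • (b * (S (e i) * q)) :=
          sw_congr fun b c => by
          have h₂ : ∀ u v, φ v • (b * (S u * q)) =
              ∑ i, (e.coord i u * φ v) • (b * (S (e i) * q)) := fun u v => by
            conv_lhs => rw [← e.sum_repr u]
            simp only [map_sum, map_smul, Finset.sum_mul, Finset.mul_sum, Finset.smul_sum,
              smul_mul_assoc, mul_smul_comm, smul_smul, Module.Basis.coord_apply, mul_comm]
          rw [sw_congr h₂]
          simp only [sw]
          exact Finset.sum_comm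
      _ = _ := by
          simp only [sw_smul_const]
          simp only [sw]
          exact Finset.sum_comm

end Frobenius

end RightIntegrals

/-! ### A generating right integral -/

section FrobeniusIntegral

open Coalgebra WeakBialgebra WeakHopfAlgebra Module

variable {k : Type*} {H : Type u} {M : Type*} [Field k] [Ring H] [WeakHopfAlgebra k H]
  [AddCommGroup M] [Module k M]

local notation "ε" => Coalgebra.counit (R := k)
local notation "εt" => WeakBialgebra.targetCounital k
local notation "εs" => WeakBialgebra.sourceCounital k
local notation "S" => WeakHopfAlgebra.antipode k

variable (k H) in
/-- The source base as a subalgebra. -/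
def sourceSubalgebra : Subalgebra k H where
  carrier := {y | εs y = y}
  mul_mem' := fun ha hb => source_mul_mem ha hb
  add_mem' := fun {a b} ha hb => by rw [Set.mem_ofPred_eq, map_add, ha, hb]
  algebraMap_mem' := fun c => by
    rw [Set.mem_ofPred_eq, Algebra.algebraMap_eq_smul_one, map_smul, sourceCounital_one]

variable (k H) in
/-- The right integrals form a module over the source base. -/
def rightIntegrals : Submodule (sourceSubalgebra k H) H where
  carrier := {p | IsRightIntegral k p}
  add_mem' := fun {a b} ha hb h => by rw [add_mul, ha, hb, ← add_mul]
  zero_mem' := fun h => by rw [zero_mul, zero_mul]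
  smul_mem' := fun c p hp => hp.mul_left (c : H)

variable (k H) in
/-- The target base as a subspace. -/
def targetBase : Submodule k H where
  carrier := {z | εt z = z}
  add_mem' := fun {a b} ha hb => by rw [Set.mem_ofPred_eq, map_add, ha, hb]
  zero_mem' := map_zero _
  smul_mem' := fun c p hp => by rw [Set.mem_ofPred_eq, map_smul, hp]

variable [FiniteDimensional k H]

instance : FiniteDimensional k (sourceSubalgebra k H) :=
  inferInstanceAs (FiniteDimensional k (Subalgebra.toSubmodule (sourceSubalgebra k H)))

instance : FiniteDimensional k (rightIntegrals k H) := finite_submodule_of_tower k _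

/-- The antipode is a linear isomorphism between the bases. -/
theorem finrank_targetBase : finrank k (targetBase k H) = finrank k (sourceSubalgebra k H) := by
  refine LinearEquiv.finrank_eq (LinearEquiv.ofBijective
    ({ toFun := fun z => ⟨S (z : H), sourceCounital_antipode_of_target z.2⟩
       map_add' := fun a b => Subtype.ext (map_add _ _ _)
       map_smul' := fun c a => Subtype.ext (map_smul _ _ _) } :
      targetBase k H →ₗ[k] sourceSubalgebra k H) ⟨?_, ?_⟩)
  · rw [← LinearMap.ker_eq_bot, LinearMap.ker_eq_bot']
    rintro ⟨z, hz⟩ h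
    have h' : S z = 0 := congr_arg Subtype.val h
    refine Subtype.ext ?_
    change εt z = z at hz
    change z = 0
    rw [← hz] at h' ⊢
    exact targetCounital_eq_zero_of_antipode h'
  · rintro ⟨y, hy⟩
    obtain ⟨z, hz, h⟩ := exists_target_antipode_eq hy
    exact ⟨⟨z, hz⟩, Subtype.ext h⟩

/-- The source base is semisimple, since `1₁ ⊗ S(1₂)` is a separability idempotent. -/
instance isSemisimpleRing_sourceSubalgebra : IsSemisimpleRing (sourceSubalgebra k H) := by
  refine @IsSemisimpleModule.mk _ _ _ _ _ ⟨fun I => ?_⟩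
  let J : Submodule k H := (I.restrictScalars k).map (sourceSubalgebra k H).val.toLinearMap
  have hJ : ∀ {x}, x ∈ J ↔ ∃ hx : εs x = x, (⟨x, hx⟩ : sourceSubalgebra k H) ∈ I := fun {x} =>
    ⟨by rintro ⟨y, hy, rfl⟩; exact ⟨y.2, hy⟩, fun ⟨hx, h⟩ => ⟨_, h, rfl⟩⟩
  have hJl : ∀ y, εs y = y → ∀ x ∈ J, y * x ∈ J := fun y hy x hx => by
    obtain ⟨hx, h⟩ := hJ.mp hx
    exact hJ.mpr ⟨source_mul_mem hy hx, I.smul_mem (⟨y, hy⟩ : sourceSubalgebra k H) h⟩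
  obtain ⟨q, hq, hq'⟩ := exists_projection J
  let e := sw k (1 : H) fun a b => a * q (S b)
  have heJ : e ∈ J := by
    change (sw k (1 : H) fun a b => a * q (S b)) ∈ J
    rw [← sw_one_sourceCounital (F := fun a b => a * q (S b)) (by fun_prop) (by fun_prop)]
    exact sw_mem fun a b => hJl _ (sourceCounital_sourceCounital a) _ (hq _)
  have hwe : ∀ w ∈ J, w * e = w := fun w hw => by
    obtain ⟨hw', -⟩ := hJ.mp hw
    calc w * e = sw k (1 : H) fun a b => (w * a) * q (S b) := by
          rw [← sw_const_mul]
          simp only [mul_assoc]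
      _ = sw k (1 : H) fun a b => a * q (S b * w) := by
          rw [← hw']
          exact sw_one_casimir_source (F := fun a b => a * q b) (by fun_prop) (by fun_prop) w
      _ = sw k (1 : H) fun a b => a * q (S (εt b) * w) := Eq.symm
          (sw_one_targetCounital (F := fun a b => a * q (S b * w)) (by fun_prop) (by fun_prop))
      _ = sw k (1 : H) fun a b => a * (S (εt b) * w) := sw_congr fun a b => by
          rw [hq' _ (hJl _ (sourceCounital_antipode_of_target
            (targetCounital_targetCounital b)) w hw)]
      _ = sw k (1 : H) fun a b => a * (S b * w) :=
          sw_one_targetCounital (F := fun a b => a * (S b * w)) (by fun_prop) (by fun_prop)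
      _ = w := by
          simp only [← mul_assoc]
          rw [sw_mul_const, sw_mul_antipode, targetCounital_one, one_mul]
  obtain ⟨hes, heI⟩ := hJ.mp heJ
  let E : sourceSubalgebra k H := ⟨e, hes⟩
  have hE : ∀ w ∈ I, w * E = w := fun w hw => Subtype.ext (hwe w (hJ.mpr ⟨w.2, hw⟩))
  refine ⟨LinearMap.ker (LinearMap.toSpanSingleton (sourceSubalgebra k H) _ E), ?_, ?_⟩
  · rw [Submodule.disjoint_def]
    intro w hw h
    rw [LinearMap.mem_ker, LinearMap.toSpanSingleton_apply, smul_eq_mul, hE w hw] at h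
    exact h
  · rw [codisjoint_iff, eq_top_iff]
    rintro w -
    refine Submodule.mem_sup.mpr ⟨w * E, I.smul_mem w heI, w - w * E, ?_, by abel⟩
    rw [LinearMap.mem_ker, LinearMap.toSpanSingleton_apply, smul_eq_mul, sub_mul, mul_assoc,
      hE E heI, sub_self]

variable {f : H →ₗ[k] k}

/-- The right integrals are dual to the source base: `p ↦ f(p ·)` is an isomorphism. -/
theorem finrank_rightIntegrals (hf : ∀ p, (∀ h, f (p * h) = 0) → p = 0) :
    finrank k (rightIntegrals k H) = finrank k (sourceSubalgebra k H) := by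
  rw [← Subspace.dual_finrank_eq (K := k) (V := sourceSubalgebra k H)]
  refine LinearEquiv.finrank_eq (LinearEquiv.ofBijective
    ({ toFun := fun p => f ∘ₗ LinearMap.mulLeft k (p : H) ∘ₗ
          (sourceSubalgebra k H).val.toLinearMap
       map_add' := fun a b => by ext; simp [add_mul]
       map_smul' := fun c a => by ext; simp } :
      rightIntegrals k H →ₗ[k] Dual k (sourceSubalgebra k H)) ⟨?_, ?_⟩)
  · rw [← LinearMap.ker_eq_bot, LinearMap.ker_eq_bot']
    rintro ⟨p, hp⟩ h
    refine Subtype.ext (hf p fun x => ?_)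
    rw [show p * x = p * εs x from hp x]
    exact LinearMap.congr_fun h (⟨εs x, sourceCounital_sourceCounital x⟩ : sourceSubalgebra k H)
  · intro ω
    let ω' : H →ₗ[k] k := ω ∘ₗ ((εs).codRestrict (Subalgebra.toSubmodule (sourceSubalgebra k H))
      sourceCounital_sourceCounital)
    obtain ⟨p, hp⟩ := exists_forall_apply_mul hf ω'
    refine ⟨⟨p, isRightIntegral_of_apply_mul (ω := ω') hf fun h => ?_⟩, ?_⟩
    · rw [hp]
      exact congr_arg ω (Subtype.ext (sourceCounital_sourceCounital h).symm)
    · ext ⟨y, hy⟩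
      exact (hp y).trans (congr_arg ω (Subtype.ext hy))

/-- The endomorphisms of the module of right integrals are left multiplications by elements of the
target base. -/
theorem exists_target_mul_eq (hf : ∀ p, (∀ h, f (p * h) = 0) → p = 0)
    (T : rightIntegrals k H →ₗ[sourceSubalgebra k H] rightIntegrals k H) :
    ∃ c, εt c = c ∧ ∀ q, (T q : H) = c * q := by
  -- `c` is obtained by applying `T` inside a presentation `1 = ∑ p₁φ(p₂)`
  have key : ∀ v ∈ integralLegs k H, ∃ c, εt c = c ∧
      ∀ q q' : rightIntegrals k H, (q' : H) = εt v * q → (T q' : H) = c * q := by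
    intro v hv
    induction hv using Submodule.span_induction with
    | mem x hx =>
      obtain ⟨p, hp, φ, rfl⟩ := hx
      let p' : rightIntegrals k H := ⟨p, hp⟩
      refine ⟨sw k (T p' : H) fun a b => φ b • εt a, ?_, fun q q' hq => ?_⟩
      · simp only [map_sw, map_smul, targetCounital_targetCounital]
      · obtain ⟨a, ha, h⟩ := exists_source_coefficient (antipode_bijective hf) q.2 φ
        rw [h _ (T p').2]
        simp only [map_sw, map_smul] at hq
        rw [h _ hp] at hq
        have : q' = (⟨a, ha⟩ : sourceSubalgebra k H) • p' := Subtype.ext hq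
        rw [this, map_smul]
        rfl
    | zero =>
      refine ⟨0, map_zero _, fun q q' hq => ?_⟩
      rw [map_zero, zero_mul] at hq
      have : q' = 0 := Subtype.ext hq
      rw [this, map_zero, zero_mul]
      rfl
    | add x y _ _ hx hy =>
      obtain ⟨c, hc, h⟩ := hx
      obtain ⟨d, hd, h'⟩ := hy
      refine ⟨c + d, by rw [map_add, hc, hd], fun q q' hq => ?_⟩
      have e₁ := h q ⟨εt x * q, IsRightIntegral.mul_left q.2 _⟩ rfl
      have e₂ := h' q ⟨εt y * q, IsRightIntegral.mul_left q.2 _⟩ rfl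
      rw [add_mul, ← e₁, ← e₂, ← Submodule.coe_add, ← map_add]
      congr 2
      refine Subtype.ext ?_
      rw [hq, map_add, add_mul]
      rfl
    | smul t x _ hx =>
      obtain ⟨c, hc, h⟩ := hx
      refine ⟨t • c, by rw [map_smul, hc], fun q q' hq => ?_⟩
      have e₁ := h q ⟨εt x * q, IsRightIntegral.mul_left q.2 _⟩ rfl
      rw [smul_mul_assoc, ← e₁]
      have : q' = algebraMap k (sourceSubalgebra k H) t •
          (⟨εt x * q, IsRightIntegral.mul_left q.2 _⟩ : rightIntegrals k H) := by
        refine Subtype.ext ?_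
        rw [hq, map_smul, smul_mul_assoc, algebraMap_smul]
        rfl
      rw [this, map_smul, algebraMap_smul]
      rfl
  obtain ⟨c, hc, h⟩ := key 1 (one_mem_integralLegs hf)
  exact ⟨c, hc, fun q => h q q (by rw [targetCounital_one, one_mul])⟩

/-- The target base maps onto the endomorphisms of the module of right integrals. -/
theorem finrank_end_rightIntegrals_le (hf : ∀ p, (∀ h, f (p * h) = 0) → p = 0) :
    finrank k (rightIntegrals k H →ₗ[sourceSubalgebra k H] rightIntegrals k H) ≤
      finrank k (sourceSubalgebra k H) := by
  rw [← finrank_targetBase]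
  let L : targetBase k H →ₗ[k]
      (rightIntegrals k H →ₗ[sourceSubalgebra k H] rightIntegrals k H) :=
    { toFun := fun z =>
        { toFun := fun p => ⟨z * p, IsRightIntegral.mul_left p.2 _⟩
          map_add' := fun a b => Subtype.ext (mul_add _ _ _)
          map_smul' := fun y p => Subtype.ext (by
            change (z : H) * ((y : H) * p) = y * (z * p)
            rw [← mul_assoc, targetCounital_commute z.2 y.2, mul_assoc]) }
      map_add' := fun a b => by ext; exact add_mul _ _ _
      map_smul' := fun c a => by ext; exact smul_mul_assoc _ _ _ }
  refine LinearMap.finrank_le_finrank_of_surjective (f := L) fun T => ?_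
  obtain ⟨c, hc, h⟩ := exists_target_mul_eq hf T
  exact ⟨⟨c, hc⟩, LinearMap.ext fun q => Subtype.ext (h q).symm⟩

/-- Every functional `ω` on the right integrals gives the `Hs`-linear map `p ↦ 1₁ω(S(1₂)p)` to the
source base, and can be recovered from it by applying `ε`. -/
theorem finrank_rightIntegrals_le_hom :
    finrank k (rightIntegrals k H) ≤
      finrank k (rightIntegrals k H →ₗ[sourceSubalgebra k H] sourceSubalgebra k H) := by
  rw [← Subspace.dual_finrank_eq (K := k) (V := rightIntegrals k H)]
  -- a functional on right integrals extends to `H`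
  obtain ⟨q, hq, hq'⟩ := exists_projection ((rightIntegrals k H).restrictScalars k)
  let Q : H →ₗ[k] rightIntegrals k H := q.codRestrict ((rightIntegrals k H).restrictScalars k) hq
  have hQ : ∀ p : rightIntegrals k H, Q p = p := fun p => Subtype.ext (hq' _ p.2)
  let L : Dual k (rightIntegrals k H) →ₗ[k]
      (rightIntegrals k H →ₗ[sourceSubalgebra k H] sourceSubalgebra k H) :=
    { toFun := fun ω =>
        { toFun := fun p => ⟨sw k (1 : H) fun a b => ω (Q (S b * p)) • a, by
            change εs _ = _
            rw [map_sw]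
            simp only [map_smul]
            exact sw_one_sourceCounital (F := fun a b => ω (Q (S b * p)) • a) (by fun_prop)
              (by fun_prop)⟩
          map_add' := fun a b => Subtype.ext (by
            exact (show Lin k fun x : H => sw k (1 : H) fun a b => ω (Q (S b * x)) • a by
              fun_prop).map_add _ _)
          map_smul' := fun y p => Subtype.ext (by
            have := sw_one_casimir_source (k := k) (F := fun a b => ω (Q (b * (p : H))) • a)
              (by fun_prop) (by fun_prop) (y : H)
            rw [show εs (y : H) = y from y.2] at this
            simp only [mul_assoc] at this
            change (sw k (1 : H) fun a b => ω (Q (S b * (y * p))) • a) =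
              y * sw k (1 : H) fun a b => ω (Q (S b * p)) • a
            rw [← this, ← sw_const_mul]
            simp only [mul_smul_comm]) }
      map_add' := fun a b => by
        ext p
        exact (show Lin k fun ω : Dual k (rightIntegrals k H) => sw k (1 : H) fun a b =>
          ω (Q (S b * p)) • a from ⟨fun x y => by simp [sw, add_smul, Finset.sum_add_distrib],
            fun c x => by simp [sw, mul_smul, Finset.smul_sum]⟩).map_add _ _
      map_smul' := fun c a => by
        ext p
        exact (show Lin k fun ω : Dual k (rightIntegrals k H) => sw k (1 : H) fun a b =>
          ω (Q (S b * p)) • a from ⟨fun x y => by simp [sw, add_smul, Finset.sum_add_distrib],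
            fun c x => by simp [sw, mul_smul, Finset.smul_sum]⟩).map_smul _ _ }
  refine LinearMap.finrank_le_finrank_of_injective (f := L) ?_
  rw [← LinearMap.ker_eq_bot, LinearMap.ker_eq_bot']
  intro ω hω
  ext p
  have h : (sw k (1 : H) fun a b => ω (Q (S b * p)) • a) = 0 :=
    congr_arg Subtype.val (LinearMap.congr_fun hω p)
  have h' := congr_arg (ε) h
  simp only [map_sw, map_smul, map_zero] at h'
  have h₂ := sw_counit_left (k := k) (1 : H) (f := fun b => ω (Q (S b * p))) (by fun_prop)
  simp only [smul_eq_mul, antipode_one, one_mul, hQ] at h₂ h'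
  rw [LinearMap.zero_apply, ← h₂, ← h']
  exact sw_congr fun a b => mul_comm _ _

/-- A single right integral generates the right integrals over the source base: the dimension counts
above show that the right integrals form a module isomorphic to the source base. -/
theorem exists_generating_integral (hf : ∀ p, (∀ h, f (p * h) = 0) → p = 0) :
    ∃ r : H, IsRightIntegral k r ∧ ∀ p, IsRightIntegral k p → ∃ y, εs y = y ∧ p = y * r := by
  obtain ⟨e⟩ := nonempty_linearEquiv_of_finrank_hom_le k (B := sourceSubalgebra k H) _
    (sourceSubalgebra k H) (rightIntegrals k H) le_rfl (by
      have h₁ : ∀ (Y : Type u) [AddCommGroup Y] [Module (sourceSubalgebra k H) Y] [Module k Y]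
          [IsScalarTower k (sourceSubalgebra k H) Y],
          finrank k (sourceSubalgebra k H →ₗ[sourceSubalgebra k H] Y) = finrank k Y :=
        fun Y _ _ _ _ => (LinearMap.ringLmapEquivSelf (sourceSubalgebra k H) k Y).finrank_eq
      rw [h₁, h₁, finrank_rightIntegrals hf]
      have h₂ := finrank_end_rightIntegrals_le hf
      have h₃ := finrank_rightIntegrals_le_hom (k := k) (H := H)
      rw [finrank_rightIntegrals hf] at h₃
      omega)
  refine ⟨e 1, (e 1).2, fun p hp => ?_⟩
  obtain ⟨y, hy⟩ := e.surjective ⟨p, hp⟩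
  refine ⟨y, y.2, ?_⟩
  rw [← mul_one y, ← smul_eq_mul, map_smul] at hy
  exact (congr_arg Subtype.val hy).symm

end FrobeniusIntegral

/-! ### Nondegenerate integrals and their duals -/

section DualIntegrals

open Coalgebra WeakBialgebra WeakHopfAlgebra Module

variable {k : Type*} {H : Type*} {M : Type*} [Field k] [Ring H] [WeakHopfAlgebra k H]
  [AddCommGroup M] [Module k M]

local notation "ε" => Coalgebra.counit (R := k)
local notation "εt" => WeakBialgebra.targetCounital k
local notation "εs" => WeakBialgebra.sourceCounital k
local notation "S" => WeakHopfAlgebra.antipode k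

/-- A right integral `r` which is nondegenerate, i.e. the two maps `H* → H` given by contraction of
`Δ(r)` are injective, with functionals `l`, `l'` normalized by `r₁l(r₂) = 1 = l'(r₁)r₂`. -/
structure IsDualIntegral (r : H) (l l' : H →ₗ[k] k) : Prop where
  isRightIntegral : IsRightIntegral k r
  left_eq_one : (sw k r fun a b => l b • a) = 1
  right_eq_one : (sw k r fun a b => l' a • b) = 1
  left_injective : ∀ φ : H →ₗ[k] k, (sw k r fun a b => φ b • a) = 0 → φ = 0
  right_injective : ∀ φ : H →ₗ[k] k, (sw k r fun a b => φ a • b) = 0 → φ = 0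

/-- Contraction of the second leg of `Δ(r)`, as a linear map on functionals. -/
noncomputable def contractSnd (r : H) : Dual k H →ₗ[k] H where
  toFun φ := sw k r fun a b => φ b • a
  map_add' x y := by simp [sw, add_smul, Finset.sum_add_distrib]
  map_smul' c x := by simp [sw, mul_smul, Finset.smul_sum]

/-- Contraction of the first leg of `Δ(r)`, as a linear map on functionals. -/
noncomputable def contractFst (r : H) : Dual k H →ₗ[k] H where
  toFun φ := sw k r fun a b => φ a • b
  map_add' x y := by simp [sw, add_smul, Finset.sum_add_distrib]
  map_smul' c x := by simp [sw, mul_smul, Finset.smul_sum]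

/-- A generating right integral is nondegenerate: contraction of the second leg maps onto the right
ideal spanned by the first legs of all right integrals, which contains `1`. -/
theorem exists_isDualIntegral [FiniteDimensional k H] {f : H →ₗ[k] k}
    (hf : ∀ p, (∀ h, f (p * h) = 0) → p = 0) :
    ∃ (r : H) (l l' : H →ₗ[k] k), IsDualIntegral r l l' := by
  obtain ⟨r, hr, hgen⟩ := exists_generating_integral hf
  have hle : integralLegs k H ≤ LinearMap.range (contractSnd (k := k) r) := by
    refine Submodule.span_le.mpr ?_
    rintro _ ⟨p, hp, φ, rfl⟩
    obtain ⟨y, hy, rfl⟩ := hgen p hp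
    refine ⟨φ ∘ₗ LinearMap.mulLeft k y, ?_⟩
    rw [← hy, sw_sourceCounital_mul (F := fun a b => φ b • a) (by fun_prop) (by fun_prop)]
    rfl
  have hsurj : Function.Surjective (contractSnd (k := k) r) := fun x => by
    have := hle (integralLegs_mul_mem (one_mem_integralLegs hf) x)
    rwa [one_mul] at this
  have hdim : finrank k (Dual k H) = finrank k H := Subspace.dual_finrank_eq
  have hinj := (LinearMap.injective_iff_surjective_of_finrank_eq_finrank hdim).mpr hsurj
  have hinj' : ∀ φ : Dual k H, contractFst r φ = 0 → φ = 0 := fun φ hφ => by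
    ext x
    obtain ⟨ψ, rfl⟩ := hsurj x
    change φ (sw k r fun a b => ψ b • a) = 0
    rw [← map_zero ψ, ← hφ]
    change _ = ψ (sw k r fun a b => φ a • b)
    rw [map_sw, map_sw]
    exact sw_congr fun a b => by simp [mul_comm]
  have hsurj' := (LinearMap.injective_iff_surjective_of_finrank_eq_finrank hdim).mp
    ((injective_iff_map_eq_zero (contractFst (k := k) r)).mpr hinj')
  obtain ⟨l, hl⟩ := hsurj 1
  obtain ⟨l', hl'⟩ := hsurj' 1
  exact ⟨r, l, l', hr, hl, hl', (injective_iff_map_eq_zero (contractSnd (k := k) r)).mp hinj,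
    hinj'⟩

/-- Over a nondegenerate functional every functional is represented. -/
theorem exists_forall_mul_apply {A : Type*} [Ring A] [Algebra k A] [FiniteDimensional k A]
    {f : A →ₗ[k] k} (hf : ∀ h, (∀ x, f (x * h) = 0) → h = 0) (φ : Dual k A) :
    ∃ g : A, ∀ x, φ x = f (x * g) := by
  let B : A →ₗ[k] Dual k A := ((LinearMap.mul k A).compr₂ f).flip
  have hinj : Function.Injective B := (injective_iff_map_eq_zero B).mpr fun h hh =>
    hf h fun x => LinearMap.congr_fun hh x
  have hdim : finrank k A = finrank k (Dual k A) := Subspace.dual_finrank_eq.symm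
  obtain ⟨g, hg⟩ := (LinearMap.injective_iff_surjective_of_finrank_eq_finrank hdim).mp hinj φ
  exact ⟨g, fun x => (LinearMap.congr_fun hg x).symm⟩

/-- The Nakayama automorphism of a nondegenerate functional. -/
theorem exists_nakayama {A : Type*} [Ring A] [Algebra k A] [FiniteDimensional k A] {f : A →ₗ[k] k}
    (hf : ∀ h, (∀ x, f (x * h) = 0) → h = 0) :
    ∃ θ : A ≃ₐ[k] A, ∀ h x, f (h * x) = f (x * θ h) := by
  choose θ hθ' using fun h => exists_forall_mul_apply hf (f ∘ₗ LinearMap.mulLeft k h)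
  replace hθ' : ∀ h x, f (h * x) = f (x * θ h) := hθ'
  have huniq : ∀ a b, (∀ x, f (x * a) = f (x * b)) → a = b := fun a b h => by
    rw [← sub_eq_zero]
    exact hf _ fun x => by rw [mul_sub, map_sub, h, sub_self]
  let Θ : A →ₐ[k] A := AlgHom.ofLinearMap
    { toFun := θ
      map_add' := fun a b => huniq _ _ fun x => by
        rw [← hθ', mul_add, map_add, ← hθ', ← hθ', add_mul, map_add]
      map_smul' := fun c a => huniq _ _ fun x => by
        rw [← hθ', RingHom.id_apply, mul_smul_comm, map_smul, ← hθ', smul_mul_assoc, map_smul] }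
    (huniq _ _ fun x => by
      change f (x * θ 1) = _
      rw [← hθ', one_mul, mul_one])
    (fun a b => huniq _ _ fun x => by
      change f (x * θ (a * b)) = f (x * (θ a * θ b))
      rw [← hθ', ← mul_assoc, ← hθ', ← mul_assoc, ← hθ', ← mul_assoc])
  have hΘ : Function.Injective Θ := (injective_iff_map_eq_zero Θ).mpr fun a ha => by
    refine (Module.forall_dual_apply_eq_zero_iff k _).mp fun ψ => ?_
    obtain ⟨x, hx⟩ := exists_forall_mul_apply hf ψ
    rw [hx, hθ', show θ a = 0 from ha, mul_zero, map_zero]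
  exact ⟨AlgEquiv.ofBijective Θ ⟨hΘ, LinearMap.injective_iff_surjective.mp
    (show Function.Injective Θ.toLinearMap from hΘ)⟩, hθ'⟩

/-- Two nondegenerate functionals differ by a unit. -/
theorem exists_unit_of_nondegenerate {A : Type*} [Ring A] [Algebra k A] [FiniteDimensional k A]
    {f f' : A →ₗ[k] k} (hf : ∀ h, (∀ x, f (x * h) = 0) → h = 0)
    (hf' : ∀ h, (∀ x, f' (x * h) = 0) → h = 0) : ∃ g : Aˣ, ∀ x, f x = f' (x * g) := by
  obtain ⟨g, hg⟩ := exists_forall_mul_apply hf' f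
  obtain ⟨g', hg'⟩ := exists_forall_mul_apply hf f'
  have h₁ : g * g' = 1 := by
    rw [← sub_eq_zero]
    refine hf _ fun x => ?_
    rw [mul_sub, map_sub, ← mul_assoc, ← hg', ← hg, mul_one, sub_self]
  have h₂ : g' * g = 1 := by
    rw [← sub_eq_zero]
    refine hf' _ fun x => ?_
    rw [mul_sub, map_sub, ← mul_assoc, ← hg, ← hg', mul_one, sub_self]
  exact ⟨⟨g, g', h₁, h₂⟩, hg⟩

namespace IsDualIntegral

variable {r : H} {l l' : H →ₗ[k] k}

/-- `r₁ l(r₂S(h)) = h`. -/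
theorem sw_apply_mul_antipode (hr : IsDualIntegral r l l') (h : H) :
    (sw k r fun a b => l (b * S h) • a) = h := by
  rw [← hr.isRightIntegral.sw_mul_left h (F := fun a b => l b • a) (by fun_prop) (by fun_prop)]
  simp only [← smul_mul_assoc]
  rw [sw_mul_const, hr.left_eq_one, one_mul]

/-- `l'(r₁h) r₂ = S(h)`. -/
theorem sw_apply_mul (hr : IsDualIntegral r l l') (h : H) :
    (sw k r fun a b => l' (a * h) • b) = S h := by
  rw [hr.isRightIntegral.sw_mul_left h (F := fun a b => l' a • b) (by fun_prop) (by fun_prop)]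
  simp only [← smul_mul_assoc]
  rw [sw_mul_const, hr.right_eq_one, one_mul]

theorem left_nondegenerate (hr : IsDualIntegral r l l') (hS : Function.Bijective (S : H → H))
    (h : H) (hh : ∀ x, l (x * h) = 0) : h = 0 := by
  obtain ⟨h, rfl⟩ := hS.2 h
  rw [← hr.sw_apply_mul_antipode h]
  simp [hh, sw]

theorem right_nondegenerate (hr : IsDualIntegral r l l') (hS : Function.Bijective (S : H → H))
    (h : H) (hh : ∀ x, l' (x * h) = 0) : h = 0 := by
  apply hS.1
  rw [← hr.sw_apply_mul h, map_zero]
  simp [hh, sw]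

/-- `l` is a left integral on `H`: the element `u₁l(u₂)` lies in the target base. -/
theorem targetCounital_sw_left (hr : IsDualIntegral r l l') (u : H) :
    εt (sw k u fun a b => l b • a) = sw k u fun a b => l b • a := by
  rw [← sub_eq_zero]
  refine (Module.forall_dual_apply_eq_zero_iff k _).mp fun φ => ?_
  have hL : Lin k fun x : H => sw k x fun a b => φ (εt a - a) * l b := by fun_prop
  have h₁ : IsLinearMap.mk' _ hL = 0 := hr.left_injective _ <| by
    change (sw k r fun a b => (sw k b fun c d => φ (εt c - c) * l d) • a) = 0
    simp only [← sw_smul_const]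
    rw [← sw_coassoc r (F := fun a c d => (φ (εt c - c) * l d) • a) (by fun_prop) (by fun_prop)
      (by fun_prop)]
    have hL' : Lin k fun x : H => sw k x fun a b => φ (εt b - b) • a := by fun_prop
    calc (sw k r fun a b => sw k a fun p q => (φ (εt q - q) * l b) • p)
        = sw k r fun a b => (sw k (l b • a) fun p q => φ (εt q - q) • p) := sw_congr fun a b => by
          rw [hL'.map_smul, ← sw_const_smul]
          exact sw_congr fun p q => by rw [smul_smul, mul_comm]
      _ = sw k (1 : H) fun p q => φ (εt q - q) • p := by
          rw [← hL'.sw_apply, hr.left_eq_one]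
      _ = 0 := by
          rw [← sw_one_targetCounital (F := fun p q => φ (εt q - q) • p) (by fun_prop)
            (by fun_prop)]
          simp [targetCounital_targetCounital, sw]
  have h₂ : (sw k u fun a b => φ (εt a - a) * l b) = 0 := LinearMap.congr_fun h₁ u
  refine ((show Lin k fun x : H => φ (εt x - x) by fun_prop).sw_apply u _).trans ?_
  rw [← h₂]
  exact sw_congr fun a b => by rw [map_smul, ← smul_sub, map_smul, smul_eq_mul, mul_comm]

/-- `l'` is a right integral on `H`: the element `l'(u₁)u₂` lies in the source base. -/
theorem sourceCounital_sw_right (hr : IsDualIntegral r l l') (u : H) :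
    εs (sw k u fun a b => l' a • b) = sw k u fun a b => l' a • b := by
  rw [← sub_eq_zero]
  refine (Module.forall_dual_apply_eq_zero_iff k _).mp fun φ => ?_
  have hL : Lin k fun x : H => sw k x fun a b => l' a * φ (εs b - b) := by fun_prop
  have h₁ : IsLinearMap.mk' _ hL = 0 := hr.right_injective _ <| by
    change (sw k r fun a b => (sw k a fun c d => l' c * φ (εs d - d)) • b) = 0
    simp only [← sw_smul_const]
    rw [sw_coassoc r (F := fun c d b => (l' c * φ (εs d - d)) • b) (by fun_prop) (by fun_prop)
      (by fun_prop)]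
    have hL' : Lin k fun x : H => sw k x fun a b => φ (εs a - a) • b := by fun_prop
    calc (sw k r fun a b => sw k b fun p q => (l' a * φ (εs p - p)) • q)
        = sw k r fun a b => (sw k (l' a • b) fun p q => φ (εs p - p) • q) := sw_congr fun a b => by
          rw [hL'.map_smul, ← sw_const_smul]
          exact sw_congr fun p q => by rw [smul_smul]
      _ = sw k (1 : H) fun p q => φ (εs p - p) • q := by
          rw [← hL'.sw_apply, hr.right_eq_one]
      _ = 0 := by
          rw [← sw_one_sourceCounital (F := fun p q => φ (εs p - p) • q) (by fun_prop)
            (by fun_prop)]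
          simp [sourceCounital_sourceCounital, sw]
  have h₂ : (sw k u fun a b => l' a * φ (εs b - b)) = 0 := LinearMap.congr_fun h₁ u
  refine ((show Lin k fun x : H => φ (εs x - x) by fun_prop).sw_apply u _).trans ?_
  rw [← h₂]
  exact sw_congr fun a b => by rw [map_smul, ← smul_sub, map_smul, smul_eq_mul]

end IsDualIntegral

section InverseAntipode

variable {T : H →ₗ[k] H}

theorem inv_antipode_mul (hS : Function.Bijective (S : H → H)) (hT : ∀ h, S (T h) = h) (x y : H) :
    T (x * y) = T y * T x :=
  hS.1 (by rw [hT, antipode_mul_rev, hT, hT])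

theorem inv_antipode_antipode (hS : Function.Bijective (S : H → H)) (hT : ∀ h, S (T h) = h)
    (x : H) : T (S x) = x :=
  hS.1 (by rw [hT])

theorem inv_antipode_targetCounital (hS : Function.Bijective (S : H → H))
    (hT : ∀ h, S (T h) = h) (h : H) : T (εt h) = sw k h fun a b => b * T a := by
  rw [← sw_mul_antipode, map_sw]
  simp only [inv_antipode_mul hS hT, inv_antipode_antipode hS hT]

theorem inv_antipode_sourceCounital (hS : Function.Bijective (S : H → H))
    (hT : ∀ h, S (T h) = h) (h : H) : T (εs h) = sw k h fun a b => T b * a := by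
  rw [← sw_antipode_mul, map_sw]
  simp only [inv_antipode_mul hS hT, inv_antipode_antipode hS hT]

theorem sw_inv_antipode (hS : Function.Bijective (S : H → H)) (hT : ∀ h, S (T h) = h) (h : H)
    {F : H → H → M} (h₁ : ∀ b, Lin k (fun a => F a b)) (h₂ : ∀ a, Lin k (fun b => F a b)) :
    sw k (T h) F = sw k h fun a b => F (T b) (T a) := by
  obtain ⟨h, rfl⟩ := hS.2 h
  rw [inv_antipode_antipode hS hT, sw_antipode _ (by fun_prop) (by fun_prop)]
  simp only [inv_antipode_antipode hS hT]

end InverseAntipode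

namespace IsDualIntegral

variable [FiniteDimensional k H] {r : H} {l l' : H →ₗ[k] k} {T : H →ₗ[k] H}

/-- `u₁l(u₂) = S(1₁)l(1₂u)`. -/
theorem sw_left_eq (hr : IsDualIntegral r l l') (u : H) :
    (sw k u fun a b => l b • a) = sw k (1 : H) fun a b => l (b * u) • S a := by
  rw [← hr.targetCounital_sw_left, map_sw]
  simp only [map_smul]
  exact sw_targetCounital_fst (F := fun a b => l b • a) (by fun_prop) (by fun_prop) u

omit [FiniteDimensional k H] in
/-- `u₁l(u₂) = S⁻¹(1₁)l(u1₂)`. -/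
theorem sw_left_eq' (hr : IsDualIntegral r l l') (hS : Function.Bijective (S : H → H))
    (hT : ∀ h, S (T h) = h) (u : H) :
    (sw k u fun a b => l b • a) = sw k (1 : H) fun a b => l (u * b) • T a := by
  have hz := hr.targetCounital_sw_left u
  set z := sw k u fun a b => l b • a with hzdef
  have key : ∀ w, εt w = w → ε (z * w) = l (u * w) := fun w hw => by
    have h := sw_counit_left (k := k) (u * w) (f := fun b => l b) (by fun_prop)
    rw [← h, ← hw, sw_mul_targetCounital (by fun_prop) (by fun_prop), hw, hzdef, ← sw_mul_const,
      map_sw]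
    exact sw_congr fun a b => by rw [smul_mul_assoc, map_smul, smul_eq_mul, smul_eq_mul, mul_comm]
  rw [← inv_antipode_antipode hS hT z, ← sourceCounital_of_target hz, sourceCounital_eq,
    map_sw]
  simp only [map_smul]
  rw [← sw_one_targetCounital (F := fun a b => ε (z * b) • T a) (by fun_prop) (by fun_prop),
    ← sw_one_targetCounital (F := fun a b => l (u * b) • T a) (by fun_prop) (by fun_prop)]
  simp only [key _ (targetCounital_targetCounital _)]

/-- `l'(u₁)u₂ = l'(u1₁)S(1₂)`. -/
theorem sw_right_eq (hr : IsDualIntegral r l l') (u : H) :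
    (sw k u fun a b => l' a • b) = sw k (1 : H) fun a b => l' (u * a) • S b := by
  rw [← hr.sourceCounital_sw_right, map_sw]
  simp only [map_smul]
  exact sw_sourceCounital_snd (F := fun a b => l' a • b) (by fun_prop) (by fun_prop) u

omit [FiniteDimensional k H] in
/-- `l'(u₁)u₂ = l'(1₁u)S⁻¹(1₂)`. -/
theorem sw_right_eq' (hr : IsDualIntegral r l l') (hS : Function.Bijective (S : H → H))
    (hT : ∀ h, S (T h) = h) (u : H) :
    (sw k u fun a b => l' a • b) = sw k (1 : H) fun a b => l' (a * u) • T b := by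
  have hz := hr.sourceCounital_sw_right u
  set z := sw k u fun a b => l' a • b with hzdef
  have key : ∀ w, εs w = w → ε (w * z) = l' (w * u) := fun w hw => by
    have h := sw_counit_right (k := k) (w * u) (f := fun b => l' b) (by fun_prop)
    rw [← h, ← hw, sw_sourceCounital_mul (by fun_prop) (by fun_prop), hw, hzdef, ← sw_const_mul,
      map_sw]
    exact sw_congr fun a b => by rw [mul_smul_comm, map_smul, smul_eq_mul, smul_eq_mul, mul_comm]
  rw [← inv_antipode_antipode hS hT z, ← targetCounital_of_source hz, targetCounital_eq,
    map_sw]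
  simp only [map_smul]
  rw [← sw_one_sourceCounital (F := fun a b => ε (a * z) • T b) (by fun_prop) (by fun_prop),
    ← sw_one_sourceCounital (F := fun a b => l' (a * u) • T b) (by fun_prop) (by fun_prop)]
  simp only [key _ (sourceCounital_sourceCounital _)]

/-- `x₁l(hx₂) = S(h₁)l(h₂x)`, the invariance of a left integral. -/
theorem sw_left_mul_left (hr : IsDualIntegral r l l') (h x : H) :
    (sw k x fun a b => l (h * b) • a) = sw k h fun c d => l (d * x) • S c := by
  calc (sw k x fun a b => l (h * b) • a)
      = sw k (1 : H) fun c d => sw k x fun a b => l (h * d * b) • (c * a) := by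
        rw [← sw_one_left x (F := fun a b => l (h * b) • a) (by fun_prop) (by fun_prop)]
        simp only [mul_assoc]
    _ = sw k h fun c d => sw k x fun a b => l (d * b) • (εs c * a) := Eq.symm
        (sw_sourceCounital_fst (F := fun c d => sw k x fun a b => l (d * b) • (c * a))
          (by fun_prop) (by fun_prop) h)
    _ = sw k h fun c d => sw k c fun p q => sw k x fun a b => l (d * b) • (S p * q * a) :=
        sw_congr fun c d => by
        rw [Lin.apply_antipode_mul (f := fun y => sw k x fun a b => l (d * b) • (y * a))
          (by fun_prop)]
    _ = sw k h fun p d => sw k d fun q s => sw k x fun a b => l (s * b) • (S p * q * a) :=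
        sw_coassoc h (F := fun p q s => sw k x fun a b => l (s * b) • (S p * q * a))
          (by fun_prop) (by fun_prop) (by fun_prop)
    _ = sw k h fun p d => S p * sw k (d * x) fun a b => l b • a := sw_congr fun p d => by
        rw [sw_mul _ _ (by fun_prop) (by fun_prop), ← sw_const_mul]
        simp only [← sw_const_mul, mul_smul_comm, mul_assoc]
    _ = sw k h fun p d => sw k (1 : H) fun a b => l (b * d * x) • S (a * p) :=
        sw_congr fun p d => by
        rw [hr.sw_left_eq, ← sw_const_mul]
        simp only [mul_smul_comm, antipode_mul_rev, mul_assoc]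
    _ = _ := by
        rw [sw_comm]
        exact sw_one_left h (F := fun a b => l (b * x) • S a) (by fun_prop) (by fun_prop)

/-- `x₁l(x₂h) = S⁻¹(h₁)l(xh₂)`. -/
theorem sw_left_mul_right (hr : IsDualIntegral r l l') (hS : Function.Bijective (S : H → H))
    (hT : ∀ h, S (T h) = h) (h x : H) :
    (sw k x fun a b => l (b * h) • a) = sw k h fun c d => l (x * d) • T c := by
  calc (sw k x fun a b => l (b * h) • a)
      = sw k x fun a b => sw k (1 : H) fun c d => l (b * (d * h)) • (a * T (S c)) := by
        rw [← sw_one_right x (F := fun a b => l (b * h) • a) (by fun_prop) (by fun_prop)]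
        simp only [mul_assoc, inv_antipode_antipode hS hT]
    _ = sw k x fun a b => sw k h fun c d => l (b * d) • (a * T (εt c)) := sw_congr fun a b =>
        Eq.symm (sw_targetCounital_fst (F := fun c d => l (b * d) • (a * T c))
          (by fun_prop) (by fun_prop) h)
    _ = sw k x fun a b => sw k h fun c d => sw k c fun p q => l (b * d) • (a * (q * T p)) :=
        sw_congr fun a b => sw_congr fun c d => by
        rw [inv_antipode_targetCounital hS hT, ← sw_const_mul, ← sw_const_smul]
    _ = sw k x fun a b => sw k h fun p d => sw k d fun q s => l (b * s) • (a * (q * T p)) :=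
        sw_congr fun a b =>
        sw_coassoc h (F := fun p q s => l (b * s) • (a * (q * T p)))
          (by fun_prop) (by fun_prop) (by fun_prop)
    _ = sw k h fun p d => (sw k (x * d) fun a b => l b • a) * T p := by
        rw [sw_comm]
        refine sw_congr fun p d => ?_
        rw [sw_mul _ _ (by fun_prop) (by fun_prop), ← sw_mul_const]
        simp only [← sw_mul_const, smul_mul_assoc, mul_assoc]
    _ = sw k h fun p d => sw k (1 : H) fun a b => l (x * (d * b)) • T (p * a) :=
        sw_congr fun p d => by
        rw [hr.sw_left_eq' hS hT, ← sw_mul_const]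
        simp only [smul_mul_assoc, inv_antipode_mul hS hT, mul_assoc]
    _ = _ := sw_one_right h (F := fun a b => l (x * b) • T a) (by fun_prop) (by fun_prop)

/-- `l'(x₁h)x₂ = l'(xh₁)S(h₂)`, the invariance of a right integral. -/
theorem sw_right_mul_right (hr : IsDualIntegral r l l') (h x : H) :
    (sw k x fun a b => l' (a * h) • b) = sw k h fun c d => l' (x * c) • S d := by
  calc (sw k x fun a b => l' (a * h) • b)
      = sw k x fun a b => sw k (1 : H) fun c d => l' (a * (c * h)) • (b * d) := by
        rw [← sw_one_right x (F := fun a b => l' (a * h) • b) (by fun_prop) (by fun_prop)]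
        simp only [mul_assoc]
    _ = sw k x fun a b => sw k h fun c d => l' (a * c) • (b * εt d) := sw_congr fun a b =>
        Eq.symm (sw_targetCounital_snd (F := fun c d => l' (a * c) • (b * d))
          (by fun_prop) (by fun_prop) h)
    _ = sw k x fun a b => sw k h fun c d => sw k d fun q s => l' (a * c) • (b * (q * S s)) :=
        sw_congr fun a b => sw_congr fun c d => by
        rw [← sw_mul_antipode, ← sw_const_mul, ← sw_const_smul]
    _ = sw k x fun a b => sw k h fun u s => sw k u fun c q => l' (a * c) • (b * (q * S s)) :=
        sw_congr fun a b => Eq.symm <|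
        sw_coassoc h (F := fun c q s => l' (a * c) • (b * (q * S s)))
          (by fun_prop) (by fun_prop) (by fun_prop)
    _ = sw k h fun u s => (sw k (x * u) fun a b => l' a • b) * S s := by
        rw [sw_comm]
        refine sw_congr fun u s => ?_
        rw [sw_mul _ _ (by fun_prop) (by fun_prop), ← sw_mul_const]
        simp only [← sw_mul_const, smul_mul_assoc, mul_assoc]
    _ = sw k h fun u s => sw k (1 : H) fun a b => l' (x * (u * a)) • S (s * b) :=
        sw_congr fun u s => by
        rw [hr.sw_right_eq, ← sw_mul_const]
        simp only [smul_mul_assoc, antipode_mul_rev, mul_assoc]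
    _ = _ := sw_one_right h (F := fun a b => l' (x * a) • S b) (by fun_prop) (by fun_prop)

/-- `l'(hx₁)x₂ = l'(h₁x)S⁻¹(h₂)`. -/
theorem sw_right_mul_left (hr : IsDualIntegral r l l') (hS : Function.Bijective (S : H → H))
    (hT : ∀ h, S (T h) = h) (h x : H) :
    (sw k x fun a b => l' (h * a) • b) = sw k h fun c d => l' (c * x) • T d := by
  calc (sw k x fun a b => l' (h * a) • b)
      = sw k (1 : H) fun c d => sw k x fun a b => l' (h * c * a) • (T (S d) * b) := by
        rw [← sw_one_left x (F := fun a b => l' (h * a) • b) (by fun_prop) (by fun_prop)]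
        simp only [mul_assoc, inv_antipode_antipode hS hT]
    _ = sw k h fun c d => sw k x fun a b => l' (c * a) • (T (εs d) * b) := Eq.symm
        (sw_sourceCounital_snd (F := fun c d => sw k x fun a b => l' (c * a) • (T d * b))
          (by fun_prop) (by fun_prop) h)
    _ = sw k h fun c d => sw k d fun q s => sw k x fun a b => l' (c * a) • (T s * q * b) :=
        sw_congr fun c d => by
        rw [inv_antipode_sourceCounital hS hT]
        exact (show Lin k fun y => sw k x fun a b => l' (c * a) • (y * b) by fun_prop).sw_apply d _
    _ = sw k h fun u s => sw k u fun c q => sw k x fun a b => l' (c * a) • (T s * q * b) :=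
        Eq.symm <| sw_coassoc h (F := fun c q s => sw k x fun a b => l' (c * a) • (T s * q * b))
          (by fun_prop) (by fun_prop) (by fun_prop)
    _ = sw k h fun u s => T s * sw k (u * x) fun a b => l' a • b := sw_congr fun u s => by
        rw [sw_mul _ _ (by fun_prop) (by fun_prop), ← sw_const_mul]
        simp only [← sw_const_mul, mul_smul_comm, mul_assoc]
    _ = sw k h fun u s => sw k (1 : H) fun a b => l' (a * u * x) • T (b * s) :=
        sw_congr fun u s => by
        rw [hr.sw_right_eq' hS hT, ← sw_const_mul]
        simp only [mul_smul_comm, inv_antipode_mul hS hT, mul_assoc]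
    _ = _ := by
        rw [sw_comm]
        exact sw_one_left h (F := fun a b => l' (a * x) • T b) (by fun_prop) (by fun_prop)

end IsDualIntegral

end DualIntegrals

/-! ### Nakayama automorphisms and the modular element -/

section Nakayama

open Coalgebra WeakBialgebra WeakHopfAlgebra Module

variable {k : Type*} {H : Type*} {M : Type*} [Field k] [Ring H] [WeakHopfAlgebra k H]
  [AddCommGroup M] [Module k M]

local notation "ε" => Coalgebra.counit (R := k)
local notation "εt" => WeakBialgebra.targetCounital k
local notation "εs" => WeakBialgebra.sourceCounital k
local notation "S" => WeakHopfAlgebra.antipode k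
local notation "Δ" => Coalgebra.comul (R := k)

/-- Pairs of functionals separate the elements of a tensor square. -/
theorem tensor_ext_dual [FiniteDimensional k M] {u v : M ⊗[k] M}
    (h : ∀ φ ψ : Dual k M, LinearMap.mul' k k (TensorProduct.map φ ψ u) =
      LinearMap.mul' k k (TensorProduct.map φ ψ v)) : u = v := by
  let e := Module.finBasis k M
  refine (e.tensorProduct e).ext_elem fun ⟨i, j⟩ => ?_
  have key : (e.tensorProduct e).coord (i, j) =
      LinearMap.mul' k k ∘ₗ TensorProduct.map (e.coord i) (e.coord j) :=
    TensorProduct.ext' fun x y => by simp [mul_comm]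
  exact (LinearMap.congr_fun key u).trans ((h _ _).trans (LinearMap.congr_fun key v).symm)

/-- To compare Sweedler sums it suffices to evaluate the two legs at functionals. -/
theorem sw_eq_of_dual [FiniteDimensional k H] {u v : H} {f₁ f₂ g₁ g₂ : H → H → H}
    (h : ∀ φ ψ : Dual k H, (sw k u fun a b => φ (f₁ a b) * ψ (f₂ a b)) =
      sw k v fun a b => φ (g₁ a b) * ψ (g₂ a b))
    {F : H → H → M} (h₁ : ∀ b, Lin k (fun a => F a b)) (h₂ : ∀ a, Lin k (fun b => F a b)) :
    (sw k u fun a b => F (f₁ a b) (f₂ a b)) = sw k v fun a b => F (g₁ a b) (g₂ a b) := by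
  have key : (sw k u fun a b => f₁ a b ⊗ₜ[k] f₂ a b) = sw k v fun a b => g₁ a b ⊗ₜ[k] g₂ a b :=
    tensor_ext_dual fun φ ψ => by simpa [map_sw] using h φ ψ
  obtain ⟨B, rfl⟩ := exists_lift k h₁ h₂
  simpa only [map_sw] using congr_arg B key

variable [FiniteDimensional k H]

variable (k) in
/-- An element `g` such that right multiplication by `g` is a homomorphism of coalgebras. -/
def IsRightGrouplike (g : H) : Prop :=
  (∀ x, ε (x * g) = ε x) ∧ ∀ x, Δ (x * g) = sw k x fun a b => (a * g) ⊗ₜ[k] (b * g)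

variable (k) in
/-- An endomorphism commuting with the left coaction of `H` on itself. -/
def IsLeftColinear (f : H → H) : Prop := ∀ h, Δ (f h) = sw k h fun a b => a ⊗ₜ[k] f b

variable (k) in
/-- An endomorphism commuting with the right coaction of `H` on itself. -/
def IsRightColinear (f : H → H) : Prop := ∀ h, Δ (f h) = sw k h fun a b => f a ⊗ₜ[k] b

omit [FiniteDimensional k H] in
theorem IsRightGrouplike.sw_mul {g : H} (hg : IsRightGrouplike k g) (x : H) {F : H → H → M}
    (h₁ : ∀ b, Lin k (fun a => F a b)) (h₂ : ∀ a, Lin k (fun b => F a b)) :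
    sw k (x * g) F = sw k x fun a b => F (a * g) (b * g) := by
  obtain ⟨B, rfl⟩ := exists_lift k h₁ h₂
  rw [sw_linearMap, hg.2, map_sw]

omit [FiniteDimensional k H] in
theorem IsLeftColinear.sw_apply {f : H → H} (hf : IsLeftColinear k f) (x : H) {F : H → H → M}
    (h₁ : ∀ b, Lin k (fun a => F a b)) (h₂ : ∀ a, Lin k (fun b => F a b)) :
    sw k (f x) F = sw k x fun a b => F a (f b) := by
  obtain ⟨B, rfl⟩ := exists_lift k h₁ h₂
  rw [sw_linearMap, hf, map_sw]

omit [FiniteDimensional k H] in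
theorem IsRightColinear.sw_apply {f : H → H} (hf : IsRightColinear k f) (x : H) {F : H → H → M}
    (h₁ : ∀ b, Lin k (fun a => F a b)) (h₂ : ∀ a, Lin k (fun b => F a b)) :
    sw k (f x) F = sw k x fun a b => F (f a) b := by
  obtain ⟨B, rfl⟩ := exists_lift k h₁ h₂
  rw [sw_linearMap, hf, map_sw]

namespace IsDualIntegral

variable {r : H} {l l' : H →ₗ[k] k} {T : H →ₗ[k] H}

/-- The Nakayama automorphism of a left integral is left colinear up to the square of the
antipode. -/
theorem sw_nakayama_left (hr : IsDualIntegral r l l') (hS : Function.Bijective (S : H → H))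
    (hT : ∀ h, S (T h) = h) {θ : H ≃ₐ[k] H} (hθ : ∀ h x, l (h * x) = l (x * θ h)) (h : H)
    {F : H → H → M} (h₁ : ∀ b, Lin k (fun a => F a b)) (h₂ : ∀ a, Lin k (fun b => F a b)) :
    sw k (θ h) F = sw k h fun a b => F (S (S a)) (θ b) := by
  have key := sw_eq_of_dual (k := k) (u := θ h) (v := h) (f₁ := fun a _ => T a)
    (f₂ := fun _ b => b) (g₁ := fun a _ => S a) (g₂ := fun _ b => θ b) (fun φ ψ => by
      obtain ⟨x, hx⟩ := exists_forall_mul_apply (hr.left_nondegenerate hS) ψ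
      obtain ⟨x, rfl⟩ := θ.surjective x
      have hψ : ∀ y, ψ y = l (x * y) := fun y => by rw [hx, ← hθ]
      have e₁ := congr_arg φ (hr.sw_left_mul_right hS hT (θ h) x)
      have e₂ := congr_arg φ (hr.sw_left_mul_left h x)
      rw [sw_congr fun a b => by rw [hθ h b], e₁] at e₂
      simpa only [map_sw, map_smul, smul_eq_mul, hψ, ← hθ, mul_comm] using e₂)
    (F := fun a b => F (S a) b) (by fun_prop) (by fun_prop)
  simpa only [hT] using key

/-- The Nakayama automorphism of a right integral is right colinear up to the square of the
antipode. -/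
theorem sw_nakayama_right (hr : IsDualIntegral r l l') (hS : Function.Bijective (S : H → H))
    (hT : ∀ h, S (T h) = h) {θ : H ≃ₐ[k] H} (hθ : ∀ h x, l' (h * x) = l' (x * θ h)) (h : H)
    {F : H → H → M} (h₁ : ∀ b, Lin k (fun a => F a b)) (h₂ : ∀ a, Lin k (fun b => F a b)) :
    sw k (θ h) F = sw k h fun a b => F (θ a) (T (T b)) := by
  have key := sw_eq_of_dual (k := k) (u := θ h) (v := h) (f₁ := fun a _ => a)
    (f₂ := fun _ b => S b) (g₁ := fun a _ => θ a) (g₂ := fun _ b => T b) (fun φ ψ => by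
      obtain ⟨x, hx⟩ := exists_forall_mul_apply (hr.right_nondegenerate hS) φ
      obtain ⟨x, rfl⟩ := θ.surjective x
      have hφ : ∀ y, φ y = l' (x * y) := fun y => by rw [hx, ← hθ]
      have e₁ := congr_arg ψ (hr.sw_right_mul_right (θ h) x)
      have e₂ := congr_arg ψ (hr.sw_right_mul_left hS hT h x)
      rw [sw_congr fun a b => by rw [hθ h a], e₁] at e₂
      simpa only [map_sw, map_smul, smul_eq_mul, hφ, ← hθ] using e₂)
    (F := fun a b => F a (T b)) (by fun_prop) (by fun_prop)
  simpa only [inv_antipode_antipode hS hT] using key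

/-- The coproduct of `r` is symmetric up to the twist `Θ(x) = S(S(x)g)`: `r₁ ⊗ r₂ = r₂ ⊗ Θ(r₁)`. -/
theorem sw_flip (hr : IsDualIntegral r l l') (hS : Function.Bijective (S : H → H))
    {g : Hˣ} (hg : ∀ x, l x = l' (x * g))
    {F : H → H → M} (h₁ : ∀ b, Lin k (fun a => F a b)) (h₂ : ∀ a, Lin k (fun b => F a b)) :
    sw k r F = sw k r fun a b => F b (S (S a * g)) := by
  refine sw_eq_of_dual (k := k) (u := r) (v := r) (f₁ := fun a _ => a) (f₂ := fun _ b => b)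
    (g₁ := fun _ b => b) (g₂ := fun a _ => S (S a * g)) (fun φ ψ => ?_) h₁ h₂
  obtain ⟨w, hw⟩ := exists_forall_mul_apply (hr.right_nondegenerate hS) φ
  obtain ⟨h, hh⟩ := hS.2 (w * ↑g⁻¹)
  have hw' : w = S h * g := by rw [hh, Units.inv_mul_cancel_right]
  have e₁ := congr_arg ψ (hr.sw_apply_mul w)
  have hL : Lin k fun x : H => ψ (S (S x * g)) := by fun_prop
  have e₂ := (hL.sw_apply r _).symm.trans
    (congr_arg (fun x => ψ (S (S x * g))) (hr.sw_apply_mul_antipode h))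
  simp only [map_sw, map_smul, smul_mul_assoc, smul_eq_mul] at e₁ e₂
  simp only [hw]
  rw [e₁, hw', ← e₂]
  simp only [hg, mul_assoc]

/-- The modular element `g` is grouplike on the right: by `sw_flip` the twist `x ↦ S(S(x)g)` is a
homomorphism of coalgebras, while `S` is an antihomomorphism of coalgebras. -/
theorem isRightGrouplike (hr : IsDualIntegral r l l') (hS : Function.Bijective (S : H → H))
    (hT : ∀ h, S (T h) = h) {g : Hˣ} (hg : ∀ x, l x = l' (x * g)) :
    IsRightGrouplike k (g : H) := by
  have hdim : finrank k (Dual k H) = finrank k H := Subspace.dual_finrank_eq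
  have hsurj := (LinearMap.injective_iff_surjective_of_finrank_eq_finrank hdim).mp
    ((injective_iff_map_eq_zero (contractSnd (k := k) r)).mpr hr.left_injective)
  -- `Θ(r₁) φ(r₂) = r₂ φ(r₁)`
  have hΘ : ∀ φ : Dual k H, S (S (contractSnd r φ) * g) = sw k r fun a b => φ a • b := fun φ => by
    rw [hr.sw_flip hS hg (F := fun a b => φ a • b) (by fun_prop) (by fun_prop)]
    refine (Lin.sw_apply (k := k) (f := fun x : H => S (S x * g)) (by fun_prop) r
      (fun a b => φ b • a)).trans ?_
    simp only [map_smul, smul_mul_assoc]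
  have hcomul : ∀ (h : H) (G : H → H → H ⊗[k] H), (∀ b, Lin k (fun a => G a b)) →
      (∀ a, Lin k (fun b => G a b)) → sw k (S (S h * g)) G =
        sw k h fun a b => G (S (S a * g)) (S (S b * g)) := fun h G h₁ h₂ => by
    obtain ⟨φ, rfl⟩ := hsurj h
    have hL : Lin k fun x : H => sw k x fun a b => G (S (S a * g)) (S (S b * g)) := by fun_prop
    have hL' : Lin k fun x : H => sw k x G := by fun_prop
    rw [hΘ]
    calc sw k (sw k r fun a b => φ a • b) G
        = sw k r fun a b => sw k b fun c d => φ a • G c d := by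
          rw [hL'.sw_apply]
          simp only [hL'.map_smul, ← sw_const_smul]
      _ = sw k r fun a b => sw k a fun c d => φ c • G d b :=
          (sw_coassoc r (F := fun c d b => φ c • G d b) (by fun_prop) (by fun_prop)
            (by fun_prop)).symm
      _ = sw k r fun a b => sw k b fun c d => φ c • G d (S (S a * g)) :=
          hr.sw_flip hS hg (F := fun a b => sw k a fun c d => φ c • G d b) (by fun_prop)
            (by fun_prop)
      _ = sw k r fun a b => sw k a fun c d => φ d • G b (S (S c * g)) :=
          (sw_coassoc r (F := fun a c d => φ c • G d (S (S a * g))) (by fun_prop) (by fun_prop)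
            (by fun_prop)).symm
      _ = sw k r fun a b => sw k b fun c d => φ d • G (S (S a * g)) (S (S c * g)) :=
          hr.sw_flip hS hg (F := fun a b => sw k a fun c d => φ d • G b (S (S c * g)))
            (by fun_prop) (by fun_prop)
      _ = sw k r fun a b => sw k a fun p q => φ b • G (S (S p * g)) (S (S q * g)) :=
          (sw_coassoc r (F := fun p q b => φ b • G (S (S p * g)) (S (S q * g))) (by fun_prop)
            (by fun_prop) (by fun_prop)).symm
      _ = sw k (sw k r fun a b => φ b • a) fun a b => G (S (S a * g)) (S (S b * g)) := by
          rw [hL.sw_apply]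
          simp only [hL.map_smul, ← sw_const_smul]
  have hcounit : ∀ h : H, ε (S (S h * g)) = ε h := fun h => by
    obtain ⟨φ, rfl⟩ := hsurj h
    rw [hΘ]
    change _ = ε (sw k r fun a b => φ b • a)
    have e₁ := sw_counit_left (k := k) r (f := fun a => φ a) (by fun_prop)
    have e₂ := sw_counit_right (k := k) r (f := fun a => φ a) (by fun_prop)
    simp only [smul_eq_mul] at e₁ e₂
    simp only [map_sw, map_smul, smul_eq_mul]
    simp only [mul_comm (φ _)]
    rw [e₁, e₂]
  refine ⟨fun x => ?_, fun x => ?_⟩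
  · obtain ⟨y, rfl⟩ := hS.2 x
    rw [← counit_antipode, hcounit, counit_antipode]
  · obtain ⟨y, rfl⟩ := hS.2 x
    rw [← inv_antipode_antipode hS hT (S y * g), ← sw_tmul,
      sw_inv_antipode hS hT _ (by fun_prop) (by fun_prop),
      hcomul y (fun a b => T b ⊗ₜ[k] T a) (by fun_prop) (by fun_prop),
      sw_antipode _ (by fun_prop) (by fun_prop)]
    simp only [inv_antipode_antipode hS hT]

end IsDualIntegral

end Nakayama

/-! ### Colinear automorphisms -/

section Automorphisms

open Coalgebra WeakBialgebra WeakHopfAlgebra Module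

variable {k : Type*} {H : Type*} [Field k] [Ring H] [WeakHopfAlgebra k H]

local notation "ε" => Coalgebra.counit (R := k)
local notation "εt" => WeakBialgebra.targetCounital k
local notation "εs" => WeakBialgebra.sourceCounital k
local notation "S" => WeakHopfAlgebra.antipode k
local notation "Δ" => Coalgebra.comul (R := k)

@[fun_prop] theorem Lin.algEquiv {A N : Type*} [Ring A] [Algebra k A] [AddCommGroup N] [Module k N]
    (f : A ≃ₐ[k] A) {g : N → A} (hg : Lin k g) : Lin k (fun x => f (g x)) :=
  Lin.map f.toLinearMap hg

variable (k H) in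
/-- Conjugation by a unit, as an automorphism of the algebra. -/
def conjAut : Hˣ →* (H ≃ₐ[k] H) where
  toFun u := AlgEquiv.ofAlgHom
    (AlgHom.ofLinearMap (LinearMap.mulLeft k (u : H) ∘ₗ LinearMap.mulRight k ((u⁻¹ : Hˣ) : H))
      (by simp) fun x y => by simp [mul_assoc])
    (AlgHom.ofLinearMap (LinearMap.mulLeft k ((u⁻¹ : Hˣ) : H) ∘ₗ LinearMap.mulRight k (u : H))
      (by simp) fun x y => by simp [mul_assoc])
    (by ext x; simp [mul_assoc]) (by ext x; simp [mul_assoc])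
  map_one' := by ext x; simp
  map_mul' u v := by ext x; simp [mul_assoc]

theorem conjAut_apply (u : Hˣ) (x : H) : conjAut k H u x = u * x * ((u⁻¹ : Hˣ) : H) :=
  (mul_assoc _ _ _).symm

theorem conjAut_apply_mul (u : Hˣ) (x : H) : conjAut k H u x * u = u * x := by
  rw [conjAut_apply, Units.inv_mul_cancel_right]

theorem eq_conjAut {f : H ≃ₐ[k] H} {u : Hˣ} (h : ∀ x, f x * u = u * x) : f = conjAut k H u := by
  ext x
  rw [conjAut_apply, ← h, Units.mul_inv_cancel_right]

theorem mul_conjAut (f : H ≃ₐ[k] H) (u : Hˣ) :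
    f * conjAut k H u = conjAut k H (Units.map (f : H →* H) u) * f := by
  ext x
  simp only [AlgEquiv.mul_apply, conjAut_apply, map_mul]
  rfl

variable (k H) in
/-- The units in the source base. -/
def sourceUnits : Subgroup Hˣ where
  carrier := {u | εs (u : H) = u}
  mul_mem' := fun ha hb => source_mul_mem ha hb
  one_mem' := sourceCounital_one
  inv_mem' := fun {u} hu => by
    have h := sourceCounital_mul_of_source (k := k) hu ((u⁻¹ : Hˣ) : H)
    rw [Units.inv_mul, sourceCounital_one] at h
    exact Units.eq_inv_of_mul_eq_one_right h.symm

variable (k H) in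
/-- The units in the target base. -/
def targetUnits : Subgroup Hˣ where
  carrier := {u | εt (u : H) = u}
  mul_mem' := fun ha hb => target_mul_mem ha hb
  one_mem' := targetCounital_one
  inv_mem' := fun {u} hu => by
    have h := targetCounital_mul_of_target (k := k) hu ((u⁻¹ : Hˣ) : H)
    rw [Units.mul_inv, targetCounital_one] at h
    exact Units.eq_inv_of_mul_eq_one_left h.symm

theorem commute_of_mem_units {y z : Hˣ} (hy : y ∈ sourceUnits k H) (hz : z ∈ targetUnits k H) :
    Commute y z := Units.ext (targetCounital_commute hz hy).symm

theorem mul_eq_one_symm_of_finiteDimensional (k : Type*) {A : Type*} [Field k] [Ring A]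
    [Algebra k A] [FiniteDimensional k A] {a b : A} (h : a * b = 1) : b * a = 1 := by
  have : IsNoetherianRing A := isNoetherian_of_tower k inferInstance
  exact mul_eq_one_comm.mp h

variable [FiniteDimensional k H]

omit [FiniteDimensional k H] in
/-- A left colinear algebra automorphism is the identity on the target base. -/
theorem IsLeftColinear.apply_target {ξ : H ≃ₐ[k] H} (hξ : IsLeftColinear k ξ) {z : H}
    (hz : εt z = z) : ξ z = z := by
  have h := hξ.sw_apply (1 : H) (F := fun a b => ε (a * z) • b) (by fun_prop) (by fun_prop)
  rw [map_one, ← targetCounital_eq, hz] at h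
  conv_rhs => rw [h]
  conv_lhs => rw [← hz, targetCounital_eq]
  rw [Lin.sw_apply (k := k) (f := fun x => ξ x) (by fun_prop)]
  simp only [map_smul]

omit [FiniteDimensional k H] in
theorem IsLeftColinear.pow {ξ : H ≃ₐ[k] H} (hξ : IsLeftColinear k ξ) (n : ℕ) :
    IsLeftColinear k (ξ ^ n : H ≃ₐ[k] H) := by
  induction n with
  | zero => exact fun h => (sw_tmul k h).symm
  | succ n ih =>
    intro h
    rw [pow_succ, AlgEquiv.mul_apply, ih]
    exact hξ.sw_apply h (F := fun a b => a ⊗ₜ[k] (ξ ^ n : H ≃ₐ[k] H) b) (by fun_prop) (by fun_prop)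

/-- A left colinear automorphism of the algebra `H` has a power which is conjugation by an element
of the source base: the twisted modules `z ↦ ε(ξⁿ(·)z)` of functionals on `H` fall into finitely
many isomorphism classes. -/
theorem IsLeftColinear.exists_pow_eq_conjAut {ξ : H ≃ₐ[k] H} (hξ : IsLeftColinear k ξ)
    (hS : Function.Bijective (S : H → H)) :
    ∃ n, 0 < n ∧ ∃ v ∈ sourceUnits k H, ξ ^ n = conjAut k H v := by
  -- the functionals `x ↦ ε(ξⁿ(x)z)`, for `z` in the target base, form a submodule `N n` of `H*`
  let P : ℕ → H →ₗ[k] Dual k H := fun n =>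
    { toFun := fun z => ε ∘ₗ LinearMap.mulRight k z ∘ₗ (ξ ^ n : H ≃ₐ[k] H).toLinearMap
      map_add' := fun a b => by ext x; simp [mul_add]
      map_smul' := fun c a => by ext x; simp }
  have hP : ∀ n z x, P n z x = ε ((ξ ^ n : H ≃ₐ[k] H) x * z) := fun _ _ _ => rfl
  have hPinj : ∀ n z w, εt z = z → εt w = w → P n z = P n w → z = w := fun n z w hz hw h => by
    have : ∀ x, ε (x * z) = ε (x * w) := fun x => by
      obtain ⟨x, rfl⟩ := (ξ ^ n : H ≃ₐ[k] H).surjective x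
      exact LinearMap.congr_fun h x
    rw [← hz, ← hw, targetCounital_eq, targetCounital_eq]
    simp only [this]
  let op : H → Module.End k (Dual k H) := fun h => LinearMap.lcomp k k (LinearMap.mulRight k h)
  have hop : ∀ n h z, op h (P n z) = P n (εt ((ξ ^ n : H ≃ₐ[k] H) h * z)) := fun n h z => by
    ext x
    change ε ((ξ ^ n : H ≃ₐ[k] H) (x * h) * z) = ε ((ξ ^ n : H ≃ₐ[k] H) x * _)
    rw [counit_mul_targetCounital, map_mul (ξ ^ n : H ≃ₐ[k] H), mul_assoc]
  let N : ℕ → Submodule k (Dual k H) := fun n => (targetBase k H).map (P n)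
  have hN : ∀ n z, εt z = z → P n z ∈ N n := fun n z hz => ⟨z, hz, rfl⟩
  obtain ⟨n, m, hnm, T, hT⟩ := exists_lt_equivariant_equiv (Set.range op) N
    (by
      rintro n _ ⟨h, rfl⟩ _ ⟨z, hz, rfl⟩
      rw [hop]
      exact hN _ _ (targetCounital_targetCounital _))
    (by
      intro n W hW hs
      obtain ⟨e, he, hu, hc⟩ := exists_central_unit_of_target_submodule (k := k)
        (I := targetBase k H ⊓ W.comap (P n)) (fun z hz => hz.1) (fun h z hz => by
          refine ⟨targetCounital_targetCounital _, ?_⟩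
          obtain ⟨h, rfl⟩ := (ξ ^ n : H ≃ₐ[k] H).surjective h
          change P n _ ∈ W
          rw [← hop]
          exact hs _ ⟨h, rfl⟩ _ hz.2)
      -- a submodule of `N n` is `P n (e Ht)` for a central idempotent `e` of `H`
      have het : εt e = e := he.1
      refine ⟨(targetBase k H ⊓ LinearMap.ker (LinearMap.mulLeft k e)).map (P n),
        Submodule.map_mono inf_le_left, ?_, ?_, ?_⟩
      · rintro _ ⟨h, rfl⟩ _ ⟨z, ⟨-, hz⟩, rfl⟩
        rw [hop]
        refine ⟨_, ⟨targetCounital_targetCounital _, ?_⟩, rfl⟩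
        replace hz : e * z = 0 := hz
        change e * _ = 0
        rw [← targetCounital_mul_of_target het, ← mul_assoc, hc, mul_assoc, hz, mul_zero, map_zero]
      · rw [eq_bot_iff]
        rintro _ ⟨h₁, z, ⟨hz, hz'⟩, rfl⟩
        replace hz' : e * z = 0 := hz'
        rw [Submodule.mem_bot, ← hu z ⟨hz, h₁⟩, hz', map_zero]
      · refine le_antisymm (sup_le hW (Submodule.map_mono inf_le_left)) ?_
        rintro _ ⟨z, hz, rfl⟩
        have hez : e * z ∈ targetBase k H := target_mul_mem het hz
        refine Submodule.mem_sup.mpr ⟨P n (e * z), ?_, P n (z - e * z),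
          ⟨_, ⟨Submodule.sub_mem _ hz hez, ?_⟩, rfl⟩, by rw [← map_add, add_sub_cancel]⟩
        · obtain ⟨h, hh⟩ := (ξ ^ n : H ≃ₐ[k] H).surjective z
          have := hs _ ⟨h, rfl⟩ _ he.2
          rwa [hop, hh, ← hc, hez] at this
        · change e * _ = 0
          rw [mul_sub, ← mul_assoc, hu e he, sub_self])
  -- `T` is right multiplication by a unit `u` of the target base
  obtain ⟨u, hu, hTu⟩ := (T ⟨_, hN n 1 targetCounital_one⟩).2
  replace hu : εt u = u := hu
  have h₁ : ∀ h, ∀ hz : P n (εt ((ξ ^ n : H ≃ₐ[k] H) h)) ∈ N n,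
      (T ⟨_, hz⟩ : Dual k H) = P m (εt ((ξ ^ m : H ≃ₐ[k] H) h * u)) := fun h hz => by
    rw [hT (op h) ⟨h, rfl⟩ ⟨_, hN n 1 targetCounital_one⟩ _ (by
      change P n _ = op h (P n 1)
      rw [hop, mul_one]), ← hTu, hop]
  have h₂ : ∀ z, εt z = z → ∀ hz : P n z ∈ N n, (T ⟨_, hz⟩ : Dual k H) = P m (z * u) :=
    fun z hz hz' => by
    have := h₁ z (by rwa [(hξ.pow n).apply_target hz, hz])
    simp only [(hξ.pow _).apply_target hz, hz, targetCounital_mul_of_target hz, hu] at this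
    exact this
  have h₃ : ∀ h, εt ((ξ ^ (m - n) : H ≃ₐ[k] H) h * u) = εt h * u := fun h => by
    obtain ⟨h, rfl⟩ := (ξ ^ n : H ≃ₐ[k] H).surjective h
    rw [← AlgEquiv.mul_apply, ← pow_add, Nat.sub_add_cancel hnm.le]
    refine hPinj m _ _ (targetCounital_targetCounital _)
      (target_mul_mem (targetCounital_targetCounital _) hu) ?_
    rw [← h₁ h (hN _ _ (targetCounital_targetCounital _)),
      h₂ _ (targetCounital_targetCounital _)]
  obtain ⟨w, hw, hwu⟩ : ∃ w, εt w = w ∧ w * u = 1 := by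
    obtain ⟨⟨_, w, hw, rfl⟩, hTw⟩ := T.surjective ⟨_, hN m 1 targetCounital_one⟩
    refine ⟨w, hw, hPinj m _ _ (target_mul_mem hw hu) targetCounital_one ?_⟩
    rw [← h₂ w hw (hN n w hw), hTw]
  obtain ⟨v, hv, rfl⟩ := exists_source_antipode_eq hu
  obtain ⟨y, hy, rfl⟩ := exists_source_antipode_eq hw
  have hvy : v * y = 1 := hS.1 (by rw [antipode_mul_rev, hwu, antipode_one])
  refine ⟨m - n, by omega, ⟨v, y, hvy, mul_eq_one_symm_of_finiteDimensional k hvy⟩, hv,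
    eq_conjAut fun h => ?_⟩
  change (ξ ^ (m - n) : H ≃ₐ[k] H) h * v = v * h
  set ζ := (ξ ^ (m - n) : H ≃ₐ[k] H)
  have hζ : IsLeftColinear k ζ := hξ.pow _
  -- colinearity extends `ε(ζ(h)v) = ε(vh)` to `ζ(h)v = vh`
  have h₄ : ∀ h, ε (ζ h * v) = ε (v * h) := fun h => by
    rw [← counit_targetCounital, ← targetCounital_mul_targetCounital, targetCounital_of_source hv,
      h₃, ← targetCounital_source_mul_target (targetCounital_targetCounital h) hv,
      targetCounital_mul_targetCounital, counit_targetCounital]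
  have e₁ := sw_counit_right (k := k) (ζ h * v) (f := fun a => a) (by fun_prop)
  have e₂ := sw_counit_right (k := k) (v * h) (f := fun a => a) (by fun_prop)
  rw [← e₁, ← e₂, ← hv, sw_mul_sourceCounital (by fun_prop) (by fun_prop),
    sw_sourceCounital_mul (by fun_prop) (by fun_prop), hv,
    hζ.sw_apply h (by fun_prop) (by fun_prop)]
  simp only [h₄]

end Automorphisms

/-! ### Right grouplike elements -/

section Grouplikes

open Coalgebra WeakBialgebra WeakHopfAlgebra Module

variable {k : Type*} {H : Type*} {M : Type*} [Field k] [Ring H] [WeakHopfAlgebra k H]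
  [AddCommGroup M] [Module k M]

local notation "ε" => Coalgebra.counit (R := k)
local notation "εt" => WeakBialgebra.targetCounital k
local notation "εs" => WeakBialgebra.sourceCounital k
local notation "S" => WeakHopfAlgebra.antipode k
local notation "Δ" => Coalgebra.comul (R := k)

/-- The square of a bijective antipode, as an automorphism of the algebra. -/
noncomputable def antipodeSq (hS : Function.Bijective (S : H → H)) : H ≃ₐ[k] H :=
  AlgEquiv.ofBijective (AlgHom.ofLinearMap (antipode k ∘ₗ antipode k)
    (by simp only [LinearMap.comp_apply, antipode_one])
    (by simp only [LinearMap.comp_apply, antipode_mul_rev, implies_true]))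
    (hS.comp hS)

theorem antipodeSq_apply (hS : Function.Bijective (S : H → H)) (h : H) :
    antipodeSq hS h = S (S h) := rfl

theorem exists_inv_antipode (hS : Function.Bijective (S : H → H)) :
    ∃ T : H →ₗ[k] H, ∀ h, S (T h) = h :=
  ⟨(LinearEquiv.ofBijective (antipode k) hS).symm.toLinearMap,
    (LinearEquiv.ofBijective (antipode k) hS).apply_symm_apply⟩

theorem sw_antipodeSq (hS : Function.Bijective (S : H → H)) (h : H) {F : H → H → M}
    (h₁ : ∀ b, Lin k (fun a => F a b)) (h₂ : ∀ a, Lin k (fun b => F a b)) :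
    sw k (antipodeSq hS h) F = sw k h fun a b => F (antipodeSq hS a) (antipodeSq hS b) := by
  rw [antipodeSq_apply, sw_antipode _ (by fun_prop) (by fun_prop),
    sw_antipode _ (by fun_prop) (by fun_prop)]
  rfl

theorem antipodeSq_mem_source (hS : Function.Bijective (S : H → H)) {y : Hˣ}
    (hy : y ∈ sourceUnits k H) : Units.map (antipodeSq hS : H →* H) y ∈ sourceUnits k H :=
  sourceCounital_antipode_of_target (targetCounital_antipode_of_source hy)

theorem antipodeSq_mem_target (hS : Function.Bijective (S : H → H)) {z : Hˣ}
    (hz : z ∈ targetUnits k H) : Units.map (antipodeSq hS : H →* H) z ∈ targetUnits k H :=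
  targetCounital_antipode_of_source (sourceCounital_antipode_of_target hz)

theorem IsRightGrouplike.one : IsRightGrouplike k (1 : H) :=
  ⟨fun x => by rw [mul_one], fun x => by simp only [mul_one, sw_tmul]⟩

theorem IsRightGrouplike.mul {g g' : H} (hg : IsRightGrouplike k g) (hg' : IsRightGrouplike k g') :
    IsRightGrouplike k (g * g') :=
  ⟨fun x => by rw [← mul_assoc, hg'.1, hg.1], fun x => by
    rw [← mul_assoc, hg'.2, hg.sw_mul x (by fun_prop) (by fun_prop)]
    simp only [mul_assoc]⟩

theorem IsRightGrouplike.antipodeSq (hS : Function.Bijective (S : H → H)) {g : H}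
    (hg : IsRightGrouplike k g) : IsRightGrouplike k (antipodeSq hS g) := by
  refine ⟨fun x => ?_, fun x => ?_⟩
  · obtain ⟨x, rfl⟩ := (_root_.antipodeSq hS).surjective x
    rw [← map_mul]
    simp only [antipodeSq_apply, counit_antipode, hg.1]
  · obtain ⟨x, rfl⟩ := (_root_.antipodeSq hS).surjective x
    rw [← map_mul, ← sw_tmul, sw_antipodeSq hS _ (by fun_prop) (by fun_prop),
      hg.sw_mul _ (by fun_prop) (by fun_prop), sw_antipodeSq hS _ (by fun_prop) (by fun_prop)]
    simp only [map_mul]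

variable [FiniteDimensional k H]

/-- Version of `IsLeftColinear.exists_pow_eq_conjAut` for right colinear automorphisms, which the
antipode turns into left colinear ones. -/
theorem IsRightColinear.exists_pow_eq_conjAut {ξ : H ≃ₐ[k] H} (hξ : IsRightColinear k ξ)
    (hS : Function.Bijective (S : H → H)) :
    ∃ n, 0 < n ∧ ∃ w ∈ targetUnits k H, ξ ^ n = conjAut k H w := by
  obtain ⟨T, hT⟩ := exists_inv_antipode hS
  have hTS := inv_antipode_antipode hS hT
  have hTbij : Function.Bijective T := ⟨fun a b h => by rw [← hT a, h, hT],
    fun x => ⟨S x, hTS x⟩⟩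
  -- the antipode exchanges left and right colinear automorphisms
  let ζ : H ≃ₐ[k] H := AlgEquiv.ofBijective
    (AlgHom.ofLinearMap (antipode k ∘ₗ ξ.toLinearMap ∘ₗ T)
      (hTbij.1 (by
        change T (S (ξ (T 1))) = T 1
        rw [hTS, ← antipode_one (k := k), hTS, map_one]))
      fun x y => by
        change S (ξ (T (x * y))) = S (ξ (T x)) * S (ξ (T y))
        rw [inv_antipode_mul hS hT, map_mul, antipode_mul_rev])
    (hS.comp (ξ.bijective.comp hTbij))
  have hζ : ∀ h, ζ (S h) = S (ξ h) := fun h => by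
    change S (ξ (T (S h))) = _
    rw [hTS]
  have hζcol : IsLeftColinear k ζ := fun h => by
    obtain ⟨h, rfl⟩ := hS.2 h
    rw [hζ, ← sw_tmul, sw_antipode _ (by fun_prop) (by fun_prop),
      hξ.sw_apply _ (by fun_prop) (by fun_prop), sw_antipode _ (by fun_prop) (by fun_prop)]
    simp only [hζ]
  obtain ⟨n, hn, v, hv, h⟩ := hζcol.exists_pow_eq_conjAut hS
  have hζn : ∀ h, (ζ ^ n : H ≃ₐ[k] H) (S h) = S ((ξ ^ n : H ≃ₐ[k] H) h) := fun h => by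
    clear * - hζ
    induction n generalizing h with
    | zero => rfl
    | succ n ih => rw [pow_succ, pow_succ, AlgEquiv.mul_apply, AlgEquiv.mul_apply, hζ, ih]
  obtain ⟨w, hw, hwv⟩ := exists_target_antipode_eq (k := k) (y := (v : H)) hv
  obtain ⟨y, hy, hyv⟩ := exists_target_antipode_eq (k := k) (y := ((v⁻¹ : Hˣ) : H))
    ((sourceUnits k H).inv_mem hv)
  have h₁ : y * w = 1 := hS.1 (by rw [antipode_mul_rev, hwv, hyv, Units.mul_inv, antipode_one])
  have h₂ : w * y = 1 := hS.1 (by rw [antipode_mul_rev, hwv, hyv, Units.inv_mul, antipode_one])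
  refine ⟨n, hn, ⟨y, w, h₁, h₂⟩, hy, eq_conjAut fun x => ?_⟩
  have h₃ : w * (ξ ^ n : H ≃ₐ[k] H) x = x * w := hS.1 (by
    rw [antipode_mul_rev, antipode_mul_rev, hwv, ← hζn, h, conjAut_apply_mul])
  change (ξ ^ n : H ≃ₐ[k] H) x * y = y * x
  rw [← one_mul ((ξ ^ n : H ≃ₐ[k] H) x), ← h₁, mul_assoc y, h₃, mul_assoc, mul_assoc, h₂, mul_one]

omit [FiniteDimensional k H] in
/-- A left colinear map is `h ↦ h₁ε(ξ(h₂))`, while a right colinear map acts on the first leg. -/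
theorem commute_of_colinear {ξ ξ' : H ≃ₐ[k] H} (hξ : IsLeftColinear k ξ)
    (hξ' : IsRightColinear k ξ') : Commute ξ ξ' := by
  have h₁ : ∀ h, ξ h = sw k h fun a b => ε (ξ b) • a := fun h => by
    rw [← hξ.sw_apply h (F := fun a b => ε b • a) (by fun_prop) (by fun_prop)]
    exact (sw_counit_right (k := k) (ξ h) (f := fun a => a) (by fun_prop)).symm
  ext h
  rw [AlgEquiv.mul_apply, AlgEquiv.mul_apply, h₁ (ξ' h), h₁ h,
    hξ'.sw_apply h (by fun_prop) (by fun_prop),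
    Lin.sw_apply (k := k) (f := fun x => ξ' x) (by fun_prop)]
  simp only [map_smul]

variable (k) in
/-- Contraction of the second leg of the comultiplication with a functional. -/
noncomputable def legOp (φ : Dual k H) : Module.End k H where
  toFun x := sw k x fun a b => φ b • a
  map_add' := (show Lin k fun x : H => sw k x fun a b => φ b • a by fun_prop).map_add
  map_smul' := (show Lin k fun x : H => sw k x fun a b => φ b • a by fun_prop).map_smul

omit [FiniteDimensional k H] in
theorem sourceCounital_leg (φ : Dual k H) (y : H) :
    εs (sw k (1 : H) fun a b => φ (y * b) • a) = sw k (1 : H) fun a b => φ (y * b) • a := by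
  rw [map_sw]
  simp only [map_smul]
  exact sw_one_sourceCounital (F := fun a b => φ (y * b) • a) (by fun_prop) (by fun_prop)

omit [FiniteDimensional k H] in
theorem IsRightGrouplike.legOp_mul {g : H} (hg : IsRightGrouplike k g) (φ : Dual k H) {y : H}
    (hy : εs y = y) : legOp k φ (y * g) =
      (sw k (1 : H) fun a b => (φ ∘ₗ LinearMap.mulRight k g) (y * b) • a) * g := by
  change (sw k (y * g) fun a b => φ b • a) = _
  rw [hg.sw_mul y (by fun_prop) (by fun_prop), ← hy,
    sw_sourceCounital_right' (by fun_prop) (by fun_prop), ← sw_mul_const]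
  simp only [smul_mul_assoc]
  rfl

variable (k) in
/-- The subspace `Hs g`, which is a subcomodule of `H` if `g` is right grouplike. -/
noncomputable def sourceOrbit (g : H) : Submodule k H :=
  (Subalgebra.toSubmodule (sourceSubalgebra k H)).map (LinearMap.mulRight k g)

omit [FiniteDimensional k H] in
theorem mul_mem_sourceOrbit {y : H} (hy : εs y = y) (g : H) : y * g ∈ sourceOrbit k g :=
  ⟨y, hy, rfl⟩

/-- A subcomodule of `Hs g` has the form `eHs g` for an idempotent `e` of both bases, and `(1 - e)Hs
g` is a complement. -/
theorem exists_compl_sourceOrbit {g : Hˣ} (hg : IsRightGrouplike k (g : H)) {W : Submodule k H}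
    (hW : W ≤ sourceOrbit k (g : H)) (hs : ∀ φ : Dual k H, ∀ x ∈ W, legOp k φ x ∈ W) :
    ∃ W' ≤ sourceOrbit k (g : H), (∀ φ : Dual k H, ∀ x ∈ W', legOp k φ x ∈ W') ∧
      W ⊓ W' = ⊥ ∧ W ⊔ W' = sourceOrbit k (g : H) := by
  let R : H →ₗ[k] H := LinearMap.mulRight k (g : H)
  let B : Submodule k H := Subalgebra.toSubmodule (sourceSubalgebra k H)
  have hI : ∀ φ : Dual k H, ∀ y ∈ B ⊓ W.comap R,
      (sw k (1 : H) fun a b => φ (y * b) • a) ∈ B ⊓ W.comap R := fun φ y hy => by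
    refine ⟨sourceCounital_leg _ _, ?_⟩
    have := hs (φ ∘ₗ LinearMap.mulRight k ((g⁻¹ : Hˣ) : H)) (y * g) hy.2
    rw [hg.legOp_mul _ hy.1] at this
    simp only [LinearMap.comp_apply, LinearMap.mulRight_apply, Units.mul_inv_cancel_right] at this
    exact this
  obtain ⟨e, he, hu, hc, het⟩ := exists_unit_of_source_subcomodule (k := k)
    (I := B ⊓ W.comap R) (fun y hy => hy.1) hI
  have hes : εs e = e := he.1
  have hSe : S e = e := by rw [← targetCounital_of_source hes, het]
  refine ⟨(B ⊓ LinearMap.ker (LinearMap.mulLeft k e)).map R,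
    Submodule.map_mono inf_le_left, ?_, ?_, ?_⟩
  · rintro φ _ ⟨y, ⟨hy, hy'⟩, rfl⟩
    replace hy' : e * y = 0 := hy'
    rw [hc y hy] at hy'
    change legOp k φ (y * g) ∈ _
    rw [hg.legOp_mul φ hy]
    refine ⟨_, ⟨sourceCounital_leg _ _, ?_⟩, rfl⟩
    change e * _ = 0
    generalize φ ∘ₗ LinearMap.mulRight k (g : H) = ψ
    have := sw_one_targetCounital_mul (k := k) (F := fun a b => ψ (y * b) • a) (by fun_prop)
      (by fun_prop) e
    rw [het, hSe] at this
    rw [← sw_const_mul]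
    simp only [mul_smul_comm]
    rw [← this]
    simp [← mul_assoc, hy', sw]
  · rw [eq_bot_iff]
    rintro _ ⟨h₁, y, ⟨hy, hy'⟩, rfl⟩
    replace hy' : e * y = 0 := hy'
    rw [Submodule.mem_bot, ← hu y ⟨hy, h₁⟩, hy', map_zero]
  · refine le_antisymm (sup_le hW (Submodule.map_mono inf_le_left)) ?_
    rintro _ ⟨y, hy, rfl⟩
    have hey : e * y ∈ B := source_mul_mem hes hy
    have hey' : e * y ∈ W.comap R := by
      obtain ⟨z, hz, hzy⟩ := exists_target_antipode_eq (k := k) hy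
      have := (hI (ε ∘ₗ LinearMap.mulLeft k z) e he).2
      simp only [LinearMap.comp_apply, LinearMap.mulLeft_apply, ← mul_assoc] at this
      rwa [← sourceCounital_eq, sourceCounital_mul_of_source hes, sourceCounital_of_target hz,
        hzy, ← hc y hy] at this
    refine Submodule.mem_sup.mpr ⟨R (e * y), hey', R (y - e * y),
      ⟨y - e * y, ⟨Submodule.sub_mem _ hy hey, ?_⟩, rfl⟩, by rw [← map_add, add_sub_cancel]⟩
    change e * _ = 0
    rw [mul_sub, ← mul_assoc, hu e he, sub_self]

/-- Among infinitely many right grouplike units, two differ by units of the bases: the subcomodules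
`Hs g` fall into finitely many isomorphism classes. -/
theorem exists_lt_grouplike_eq (g : ℕ → Hˣ) (hg : ∀ n, IsRightGrouplike k (g n : H)) :
    ∃ n m, n < m ∧ ∃ y ∈ sourceUnits k H, ∃ z ∈ targetUnits k H, g m = y * z * g n := by
  obtain ⟨n, m, hnm, T, hT⟩ := exists_lt_equivariant_equiv (Set.range (legOp k (H := H)))
    (fun n => sourceOrbit k (g n : H))
    (by
      rintro n _ ⟨φ, rfl⟩ _ ⟨y, hy, rfl⟩
      rw [LinearMap.mulRight_apply, (hg n).legOp_mul φ hy]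
      exact mul_mem_sourceOrbit (sourceCounital_leg _ _) _)
    (by
      intro n W hW hs
      obtain ⟨W', h₁, h₂, h₃⟩ := exists_compl_sourceOrbit (hg n) hW fun φ => hs _ ⟨φ, rfl⟩
      exact ⟨W', h₁, by rintro _ ⟨φ, rfl⟩; exact h₂ φ, h₃⟩)
  let p : sourceOrbit k (g m : H) := ⟨1 * g m, mul_mem_sourceOrbit sourceCounital_one _⟩
  obtain ⟨w, hw, hwg⟩ := (T.symm p).2
  replace hw : εs w = w := hw
  replace hwg : w * g n = (T.symm p : H) := hwg
  -- the functional `y ↦ ε(T(y gₙ) gₘ⁻¹)` on the source base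
  let χ : H →ₗ[k] k := ε ∘ₗ LinearMap.mulRight k (((g m)⁻¹ : Hˣ) : H) ∘ₗ
    (sourceOrbit k (g m : H)).subtype ∘ₗ T.toLinearMap ∘ₗ
    (LinearMap.mulRight k (g n : H) ∘ₗ εs).codRestrict (sourceOrbit k (g n : H))
      fun x => mul_mem_sourceOrbit (sourceCounital_sourceCounital x) _
  have hχ : ∀ y (hy : εs y = y), χ y = ε ((T ⟨y * g n, mul_mem_sourceOrbit hy _⟩ : H) *
      (((g m)⁻¹ : Hˣ) : H)) := fun y hy => by
    have : (LinearMap.mulRight k (g n : H) ∘ₗ εs).codRestrict (sourceOrbit k (g n : H))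
        (fun x => mul_mem_sourceOrbit (sourceCounital_sourceCounital x) _) y =
        ⟨y * g n, mul_mem_sourceOrbit hy _⟩ := Subtype.ext (by
          change εs y * g n = y * g n
          rw [hy])
    rw [← this]
    rfl
  let z : H := sw k (1 : H) fun a b => χ a • b
  have hz : εt z = z := by
    change εt (sw k (1 : H) fun a b => χ a • b) = sw k (1 : H) fun a b => χ a • b
    clear_value χ
    rw [map_sw]
    simp only [map_smul]
    exact sw_one_targetCounital (F := fun a b => χ a • b) (by fun_prop) (by fun_prop)
  -- `T⁻¹(gₘ) = w gₙ`, and colinearity of `T` gives `gₘ = w χ(1₁) 1₂ gₙ`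
  have key : w * z * g n = g m := by
    rw [← sub_eq_zero]
    refine (Module.forall_dual_apply_eq_zero_iff k _).mp fun φ => ?_
    rw [map_sub, sub_eq_zero]
    have hy := sourceCounital_leg (φ ∘ₗ LinearMap.mulRight k (g n : H)) w
    have h₁ := hT (legOp k φ) ⟨φ, rfl⟩ (T.symm p) ⟨_, mul_mem_sourceOrbit hy (g n : H)⟩ (by
      rw [← hwg, (hg n).legOp_mul φ hw])
    rw [T.apply_symm_apply, (hg m).legOp_mul φ sourceCounital_one] at h₁
    have h₂ := hχ _ hy
    rw [h₁, Units.mul_inv_cancel_right, map_sw, map_sw] at h₂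
    have h := sw_counit_left (k := k) (1 : H) (f := fun b => φ (b * g m)) (by fun_prop)
    simp only [one_mul, smul_eq_mul] at h
    simp only [map_smul, one_mul, smul_eq_mul, LinearMap.comp_apply,
      LinearMap.mulRight_apply] at h₂
    clear_value χ
    rw [← h, sw_congr (k := k) (h := (1 : H)) fun a b => mul_comm (ε a) (φ (b * g m)), ← h₂]
    simp only [z, map_sw, ← sw_const_mul, ← sw_mul_const, map_smul, mul_smul_comm,
      smul_mul_assoc, smul_eq_mul]
    exact sw_congr fun a b => mul_comm _ _
  have hcomm : Commute w z := (targetCounital_commute hz hw).symm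
  have hunit : IsUnit (w * z) := by
    have : w * z = g m * ((g n)⁻¹ : Hˣ) := by rw [← key, Units.mul_inv_cancel_right]
    rw [this]
    exact (g m * (g n)⁻¹).isUnit
  obtain ⟨⟨wu, rfl⟩, zu, hzu⟩ := hcomm.isUnit_mul_iff.mp hunit
  refine ⟨n, m, hnm, wu, hw, zu, ?_, Units.ext ?_⟩
  · change εt (zu : H) = zu
    rw [hzu, hz]
  · rw [Units.val_mul, Units.val_mul, hzu, key]

end Grouplikes

/-! ### Powers of the square of the antipode -/

section FiniteOrder

open Coalgebra WeakBialgebra WeakHopfAlgebra Module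

variable {k : Type*} {H : Type*} {M : Type*} [Field k] [Ring H] [WeakHopfAlgebra k H]
  [AddCommGroup M] [Module k M]

local notation "ε" => Coalgebra.counit (R := k)
local notation "εt" => WeakBialgebra.targetCounital k
local notation "εs" => WeakBialgebra.sourceCounital k
local notation "S" => WeakHopfAlgebra.antipode k
local notation "Δ" => Coalgebra.comul (R := k)

theorem WeakHopfAlgebra.IsAutomorphism.one : IsAutomorphism (1 : Module.End k H) :=
  ⟨Function.bijective_id, rfl, fun _ _ => rfl, fun _ => rfl,
    fun h => by
      change Δ h = TensorProduct.map LinearMap.id LinearMap.id _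
      rw [TensorProduct.map_id]
      rfl, fun _ => rfl⟩

theorem WeakHopfAlgebra.IsAutomorphism.mul {σ τ : Module.End k H} (hσ : IsAutomorphism σ)
    (hτ : IsAutomorphism τ) : IsAutomorphism (σ * τ) where
  bijective := hσ.bijective.comp hτ.bijective
  map_one := by rw [Module.End.mul_apply, hτ.map_one, hσ.map_one]
  map_mul h g := by simp only [Module.End.mul_apply, hτ.map_mul, hσ.map_mul]
  counit_map h := by rw [Module.End.mul_apply, hσ.counit_map, hτ.counit_map]
  comul_map h := by
    rw [Module.End.mul_apply, hσ.comul_map, hτ.comul_map, Module.End.mul_eq_comp,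
      TensorProduct.map_comp, LinearMap.comp_apply]
  antipode_map h := by simp only [Module.End.mul_apply, hτ.antipode_map, hσ.antipode_map]

theorem WeakHopfAlgebra.IsAutomorphism.pow {σ : Module.End k H} (hσ : IsAutomorphism σ) (n : ℕ) :
    IsAutomorphism (σ ^ n) := by
  induction n with
  | zero => exact .one
  | succ n ih => rw [pow_succ]; exact ih.mul hσ

variable [FiniteDimensional k H]

omit [FiniteDimensional k H] in
theorem isAutomorphism_antipode_sq (hS : Function.Bijective (S : H → H)) :
    IsAutomorphism ((antipode k : Module.End k H) ^ 2) where
  bijective := by rw [pow_two]; exact hS.comp hS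
  map_one := by simp only [pow_two, Module.End.mul_apply, antipode_one]
  map_mul h g := by simp only [pow_two, Module.End.mul_apply, antipode_mul_rev]
  counit_map h := by simp only [pow_two, Module.End.mul_apply, counit_antipode]
  comul_map h := by
    rw [pow_two, Module.End.mul_apply, ← sw_tmul, sw_antipode _ (by fun_prop) (by fun_prop),
      sw_antipode _ (by fun_prop) (by fun_prop), ← sw_tmul, map_sw]
    rfl
  antipode_map h := rfl

/-- A weak Hopf algebra automorphism given by conjugation by a product of units of the two bases
is trivial. If it is conjugation by `yz`, then `S(y)z` is central in `H`, so that it is also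
conjugation by `S(y)⁻¹y`. -/
theorem isTrivialAutomorphism_of_conj {σ : Module.End k H} (hσ : IsAutomorphism σ) {y z : Hˣ}
    (hy : y ∈ sourceUnits k H) (hz : z ∈ targetUnits k H)
    (h : ∀ x, σ x * (y * z) = y * z * x) : IsTrivialAutomorphism σ := by
  replace hy : εs (y : H) = y := hy
  replace hz : εt (z : H) = z := hz
  have hyz : (z : H) * y = y * z := targetCounital_commute hz hy
  have hσz : ∀ x, σ x * z = z * (y * x * ((y⁻¹ : Hˣ) : H)) := fun x => by
    calc σ x * z = σ x * (z * y) * ((y⁻¹ : Hˣ) : H) := by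
          rw [← mul_assoc, Units.mul_inv_cancel_right]
      _ = _ := by rw [hyz, h, ← hyz]; simp only [mul_assoc]
  have hσy : ∀ x, σ x * y = y * (z * x * ((z⁻¹ : Hˣ) : H)) := fun x => by
    calc σ x * y = σ x * (y * z) * ((z⁻¹ : Hˣ) : H) := by
          rw [← mul_assoc, Units.mul_inv_cancel_right]
      _ = _ := by rw [h]; simp only [mul_assoc]
  -- comparing the two legs of the comultiplication of `σ(x)zy = yzx`
  have key : ∀ (x : H) (F : H → H → H), (∀ b, Lin k (fun a => F a b)) →
      (∀ a, Lin k (fun b => F a b)) → (sw k x fun a b => F (a * y) (b * z)) =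
      sw k x fun a b => F (y * a) (z * b) := fun x F h₁ h₂ => by
    let G : H → H → H := fun u v => F (((z⁻¹ : Hˣ) : H) * u * y) (((y⁻¹ : Hˣ) : H) * v * z)
    have hG₁ : ∀ b, Lin k (fun a => G a b) := fun b => by unfold G; fun_prop
    have hG₂ : ∀ a, Lin k (fun b => G a b) := fun a => by unfold G; fun_prop
    have e₁ : sw k (σ x * z * y) G = sw k x fun a b => G (σ a * z) (σ b * y) := by
      rw [← hy, sw_mul_sourceCounital hG₁ hG₂, ← hz,
        sw_mul_targetCounital (by fun_prop) (by fun_prop), hz, hy]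
      obtain ⟨B, hB⟩ := exists_lift k (F := fun a b => G (a * z) (b * y)) (by fun_prop)
        (by fun_prop)
      rw [hB, sw_linearMap, hσ.comul_map, ← sw_tmul, map_sw, map_sw]
      refine sw_congr fun a b => ?_
      rw [TensorProduct.map_tmul]
      exact (congr_fun (congr_fun hB (σ a)) (σ b)).symm
    have e₂ : sw k (y * (z * x)) G = sw k x fun a b => G (z * a) (y * b) := by
      rw [← hy, sw_sourceCounital_mul hG₁ hG₂, ← hz,
        sw_targetCounital_mul (by fun_prop) (by fun_prop), hz, hy]
    have e₃ : σ x * z * y = y * (z * x) := by rw [mul_assoc, hyz, h, mul_assoc]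
    rw [e₃, e₂] at e₁
    simp only [hσz, hσy] at e₁
    simpa only [G, Units.inv_mul_cancel_left, Units.inv_mul_cancel_right] using e₁
  -- the case `x = 1` of `key` gives `1₁ ⊗ 1₂q = 1₁ ⊗ q1₂` for `q = S(y)z`
  have hq : ∀ (F : H → H → H), (∀ b, Lin k (fun a => F a b)) →
      (∀ a, Lin k (fun b => F a b)) → (sw k (1 : H) fun a b => F a (b * (S (y : H) * z))) =
      sw k (1 : H) fun a b => F a (S (y : H) * z * b) := fun F h₁ h₂ => by
    obtain ⟨z', hz', hzy⟩ := exists_target_antipode_eq hy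
    have e : ∀ (F : H → H → H), (∀ b, Lin k (fun a => F a b)) →
        (∀ a, Lin k (fun b => F a b)) → (sw k (1 : H) fun a b => F a (b * (S (y : H) * z))) =
        sw k (1 : H) fun a b => F a (z * z' * b) := fun F h₁ h₂ => by
      have e₁ := sw_one_mul_sourceCounital (F := fun a b => F a (b * z)) (by fun_prop)
        (by fun_prop) (y : H)
      have e₂ := sw_one_targetCounital_mul (F := fun a b => F a (z * b)) (by fun_prop)
        (by fun_prop) z'
      rw [hz', hzy] at e₂
      rw [hy] at e₁
      simp only [mul_assoc] at e₁ e₂ ⊢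
      rw [← e₁, e₂, key 1 F h₁ h₂]
    have e₃ : S (y : H) * z = z * z' := by
      have := e (fun a b => ε a • b) (by fun_prop) (by fun_prop)
      rwa [sw_counit_left (k := k) (1 : H) (f := fun b => b * (S (y : H) * z)) (by fun_prop),
        sw_counit_left (k := k) (1 : H) (f := fun b => z * z' * b) (by fun_prop), one_mul,
        mul_one] at this
    rw [e F h₁ h₂, ← e₃]
  set q := S (y : H) * z with hqdef
  have hqt : εt q = q := target_mul_mem (targetCounital_antipode_of_source hy) hz
  have hqc : ∀ w, εt w = w → w * q = q * w := fun w hw => by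
    have e := targetCounital_eq_sw (k := k) w
    rw [hw] at e
    conv_lhs => rw [e]
    conv_rhs => rw [e]
    rw [← sw_mul_const, ← sw_const_mul]
    simp only [smul_mul_assoc, mul_smul_comm]
    exact hq (fun a b => ε (w * a) • b) (by fun_prop) (by fun_prop)
  have hqs : ∀ x, (sw k x fun a b => S a * q * b) = q * εs x := fun x => by
    have e := key x (fun a b => S a * b) (by fun_prop) (by fun_prop)
    simp only [antipode_mul_rev] at e
    rw [hqdef, mul_assoc, targetCounital_commute hz (sourceCounital_sourceCounital x), ← mul_assoc]
    rw [← sw_antipode_mul, ← sw_const_mul, ← sw_mul_const]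
    simp only [mul_assoc] at e ⊢
    exact e.symm
  clear_value q
  -- `qx = qx₁S(x₂)x₃ = x₁S(x₂)qx₃ = x₁qS(x₂)x₃ = xq`
  have hcentral : ∀ x, q * x = x * q := fun x => by
    calc q * x = sw k x fun a b => εt a * q * b := by
          conv_lhs => rw [← sw_targetCounital_mul_self (k := k) x]
          rw [← sw_const_mul]
          exact sw_congr fun a b => by
            rw [hqc _ (targetCounital_targetCounital a), mul_assoc]
      _ = sw k x fun a b => sw k a fun c d => c * (S d * q * b) := sw_congr fun a b => by
          rw [← sw_mul_antipode, ← sw_mul_const, ← sw_mul_const]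
          simp only [mul_assoc]
      _ = sw k x fun a b => a * (q * εs b) := by
          rw [sw_coassoc x (F := fun a c d => a * (S c * q * d)) (by fun_prop) (by fun_prop)
            (by fun_prop)]
          exact sw_congr fun a b => by rw [sw_const_mul, hqs]
      _ = x * q := by
          conv_rhs => rw [← sw_self_mul_sourceCounital (k := k) x]
          rw [← sw_mul_const]
          exact sw_congr fun a b => by
            rw [targetCounital_commute hqt (sourceCounital_sourceCounital b), mul_assoc]
  have hSy : S (y : H) * S ((y⁻¹ : Hˣ) : H) = 1 := by
    rw [← antipode_mul_rev, Units.inv_mul, antipode_one]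
  have hSy' : S ((y⁻¹ : Hˣ) : H) * S (y : H) = 1 := by
    rw [← antipode_mul_rev, Units.mul_inv, antipode_one]
  let s : Hˣ := ⟨S ((y⁻¹ : Hˣ) : H), S (y : H), hSy', hSy⟩
  refine ⟨hσ, y⁻¹, s * y, ⟨_, (sourceUnits k H).inv_mem hy⟩, by rw [inv_inv]; rfl, fun x => ?_⟩
  have hz' : (z : H) = s * q := by
    rw [hqdef, ← mul_assoc]
    exact (by rw [hSy', one_mul])
  have hsy : (y : H) * z = ((s * y : Hˣ) : H) * q := by
    rw [← hyz, hz', Units.val_mul, mul_assoc, mul_assoc, hcentral]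
  have hqu : IsUnit q := by rw [hqdef]; exact (s⁻¹ * z).isUnit
  have hx : σ x * ((s * y : Hˣ) : H) = ((s * y : Hˣ) : H) * x := hqu.mul_left_injective (by
    change _ * q = _ * q
    rw [mul_assoc, ← hsy, h, hsy, mul_assoc, hcentral, ← mul_assoc])
  rw [← hx, Units.mul_inv_cancel_right]

/-- The Nakayama automorphisms of a left and a right integral are, up to the square of the antipode,
a left colinear automorphism `ξ` and a right colinear automorphism `ξ'`. They differ by conjugation
by the modular element `g`. -/
theorem exists_colinear_pair {f : H →ₗ[k] k} (hf : ∀ p, (∀ h, f (p * h) = 0) → p = 0)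
    (hS : Function.Bijective (S : H → H)) :
    ∃ (ξ ξ' : H ≃ₐ[k] H) (g : Hˣ), IsLeftColinear k ξ ∧ IsRightColinear k ξ' ∧
      IsRightGrouplike k (g : H) ∧
      antipodeSq hS * ξ = conjAut k H g * (antipodeSq hS)⁻¹ * ξ' := by
  obtain ⟨r, l, l', hr⟩ := exists_isDualIntegral hf
  obtain ⟨T, hT⟩ := exists_inv_antipode hS
  have hl := hr.left_nondegenerate hS
  have hl' := hr.right_nondegenerate hS
  obtain ⟨θ, hθ⟩ := exists_nakayama hl
  obtain ⟨θ', hθ'⟩ := exists_nakayama hl'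
  obtain ⟨g, hg⟩ := exists_unit_of_nondegenerate hl hl'
  have hTS := inv_antipode_antipode hS hT
  have hσ : ∀ x, (antipodeSq hS)⁻¹ x = T (T x) := fun x => (antipodeSq hS).injective (by
    change antipodeSq hS ((antipodeSq hS).symm x) = _
    rw [AlgEquiv.apply_symm_apply, antipodeSq_apply, hT, hT])
  refine ⟨(antipodeSq hS)⁻¹ * θ, antipodeSq hS * θ', g, fun h => ?_, fun h => ?_,
    hr.isRightGrouplike hS hT hg, ?_⟩
  · simp only [AlgEquiv.mul_apply, hσ]
    rw [← sw_tmul, sw_inv_antipode hS hT _ (by fun_prop) (by fun_prop),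
      sw_inv_antipode hS hT _ (by fun_prop) (by fun_prop),
      hr.sw_nakayama_left hS hT hθ _ (by fun_prop) (by fun_prop)]
    simp only [hTS]
  · simp only [AlgEquiv.mul_apply]
    rw [← sw_tmul, sw_antipodeSq hS _ (by fun_prop) (by fun_prop),
      hr.sw_nakayama_right hS hT hθ' _ (by fun_prop) (by fun_prop)]
    simp only [antipodeSq_apply, hT]
  · rw [mul_inv_cancel_left, mul_assoc, inv_mul_cancel_left]
    -- `l(xθ(h)) = l(hx)` and `l = l'(·g)`
    have key : ∀ h, θ h * g = g * θ' h := fun h => by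
      rw [← sub_eq_zero]
      refine hl' _ fun x => ?_
      rw [mul_sub, map_sub, ← mul_assoc, ← hg, ← hθ, hg, ← mul_assoc, ← hθ', ← mul_assoc, sub_self]
    ext h
    rw [AlgEquiv.mul_apply, conjAut_apply, ← key, Units.mul_inv_cancel_right]

omit [FiniteDimensional k H] in
theorem antipodeSq_pow_mem (hS : Function.Bijective (S : H → H)) (n : ℕ) :
    (∀ y ∈ sourceUnits k H,
      Units.map ((antipodeSq hS ^ n : H ≃ₐ[k] H) : H →* H) y ∈ sourceUnits k H) ∧
    ∀ z ∈ targetUnits k H,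
      Units.map ((antipodeSq hS ^ n : H ≃ₐ[k] H) : H →* H) z ∈ targetUnits k H := by
  induction n with
  | zero => exact ⟨fun y hy => hy, fun z hz => hz⟩
  | succ n ih =>
    have h : ∀ u : Hˣ, Units.map ((antipodeSq hS ^ (n + 1) : H ≃ₐ[k] H) : H →* H) u =
        Units.map ((antipodeSq hS ^ n : H ≃ₐ[k] H) : H →* H)
          (Units.map (antipodeSq hS : H →* H) u) := fun u => by
      rw [pow_succ]
      rfl
    exact ⟨fun y hy => by rw [h]; exact ih.1 _ (antipodeSq_mem_source hS hy),
      fun z hz => by rw [h]; exact ih.2 _ (antipodeSq_mem_target hS hz)⟩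

/-- Some power of `S⁴` is conjugation by a product of units of the two bases. -/
theorem exists_pow_antipodeSq_eq_conjAut {f : H →ₗ[k] k}
    (hf : ∀ p, (∀ h, f (p * h) = 0) → p = 0) (hS : Function.Bijective (S : H → H)) :
    ∃ n, 0 < n ∧ ∃ y ∈ sourceUnits k H, ∃ z ∈ targetUnits k H,
      antipodeSq hS ^ (2 * n) = conjAut k H (y * z) := by
  obtain ⟨ξ, ξ', g, hξ, hξ', hg, hrel⟩ := exists_colinear_pair hf hS
  obtain ⟨a, ha, v, hv, hav⟩ := hξ.exists_pow_eq_conjAut hS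
  obtain ⟨b, hb, w, hw, hbw⟩ := hξ'.exists_pow_eq_conjAut hS
  set σ := antipodeSq hS with hσ
  let A := conjAut k H
  let X := ξ * ξ'⁻¹
  have hX : σ * X = A g * σ⁻¹ := by
    rw [← mul_assoc, hrel, mul_inv_cancel_right]
  -- the modular elements of the powers of `σ`
  let G : ℕ → Hˣ := fun n => Nat.rec 1
    (fun _ u => Units.map ((σ ^ 2 : H ≃ₐ[k] H) : H →* H) u * Units.map (σ : H →* H) g) n
  have hG : ∀ n, IsRightGrouplike k (Units.val (G n)) := fun n => by
    induction n with
    | zero => exact .one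
    | succ n ih => exact ((ih.antipodeSq hS).antipodeSq hS).mul (hg.antipodeSq hS)
  have hGX : ∀ n, σ ^ (2 * n) * X ^ n = A (G n) := fun n => by
    induction n with
    | zero => simp [A, G]
    | succ n ih =>
      have h₁ : σ ^ 2 * X = A (Units.map (σ : H →* H) g) := by
        rw [pow_two, mul_assoc, hX, ← mul_assoc, mul_conjAut, mul_inv_cancel_right]
      change _ = A (Units.map ((σ ^ 2 : H ≃ₐ[k] H) : H →* H) (G n) * Units.map (σ : H →* H) g)
      rw [map_mul, ← h₁, ← mul_assoc, ← mul_conjAut, ← ih, mul_add, mul_one, add_comm (2 * n),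
        pow_add, pow_succ X n]
      simp only [mul_assoc]
  -- a power of `X` is conjugation by a product of units of the bases
  have hXK : X ^ (a * b) = A (v ^ b * w⁻¹ ^ a) := by
    have hc : Commute ξ ξ'⁻¹ := (commute_of_colinear hξ hξ').inv_right
    rw [hc.mul_pow, pow_mul, hav, mul_comm a b, pow_mul, inv_pow, hbw, map_mul, map_pow, map_pow,
      map_inv]
  set u := v ^ b * w⁻¹ ^ a
  obtain ⟨n, m, hnm, y, hy, z, hz, hyz⟩ := exists_lt_grouplike_eq (k := k)
    (fun n => G (a * b * n)) (fun n => hG _)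
  have hab : 0 < a * b := Nat.mul_pos ha hb
  obtain ⟨d, hd, rfl⟩ : ∃ d, 0 < d ∧ m = d + n := ⟨m - n, by omega, by omega⟩
  replace hyz : G (a * b * (d + n)) = y * z * G (a * b * n) := hyz
  let τ : H ≃ₐ[k] H := σ ^ (2 * (a * b * n))
  have h₁ : σ ^ (2 * (a * b * d)) * A (Units.map (τ : H →* H) (u ^ d)) = A (y * z) := by
    have h₂ := hGX (a * b * (d + n))
    rw [hyz, map_mul A, ← hGX (a * b * n), mul_add (a * b), mul_add 2, pow_add X, pow_mul X _ d,
      hXK, ← map_pow A, ← mul_assoc (σ ^ _) (A _), ← mul_assoc (A (y * z)), mul_left_inj,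
      pow_add σ, mul_assoc (σ ^ _), mul_conjAut, ← mul_assoc (σ ^ _), mul_left_inj] at h₂
    exact h₂
  obtain ⟨p, hp, q, hq, hpq⟩ : ∃ p ∈ sourceUnits k H, ∃ q ∈ targetUnits k H,
      Units.map (τ : H →* H) (u ^ d) = p * q := by
    have hvs := (sourceUnits k H).pow_mem hv b
    have hws := (targetUnits k H).pow_mem ((targetUnits k H).inv_mem hw) a
    rw [(commute_of_mem_units hvs hws).mul_pow, map_mul]
    exact ⟨_, (antipodeSq_pow_mem hS _).1 _ ((sourceUnits k H).pow_mem hvs d), _,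
      (antipodeSq_pow_mem hS _).2 _ ((targetUnits k H).pow_mem hws d), rfl⟩
  refine ⟨a * b * d, Nat.mul_pos hab hd, y * p⁻¹,
    (sourceUnits k H).mul_mem hy ((sourceUnits k H).inv_mem hp), z * q⁻¹,
    (targetUnits k H).mul_mem hz ((targetUnits k H).inv_mem hq), ?_⟩
  rw [← mul_inv_eq_iff_eq_mul.mpr h₁.symm, hpq, ← map_inv, ← map_mul]
  congr 1
  rw [mul_inv_rev, mul_assoc, mul_assoc, ← mul_assoc p⁻¹,
    (commute_of_mem_units ((sourceUnits k H).inv_mem hp) hz).eq, mul_assoc z,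
    (commute_of_mem_units ((sourceUnits k H).inv_mem hp) ((targetUnits k H).inv_mem hq)).eq]

end FiniteOrder

theorem mainTheorem2 (k H : Type*) [Field k] [Ring H] [WeakHopfAlgebra k H]
    [FiniteDimensional k H] (hFrob : IsFrobeniusAlgebra k H) :
    (∃ n : ℕ, 1 ≤ n ∧
      WeakHopfAlgebra.IsTrivialAutomorphism
        ((WeakHopfAlgebra.antipode k : Module.End k H) ^ (4 * n))) ∧
    WeakHopfAlgebra.IsAutomorphism ((WeakHopfAlgebra.antipode k : Module.End k H) ^ 2) ∧
    (∃ m : ℕ, 1 ≤ m ∧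
      WeakHopfAlgebra.IsTrivialAutomorphism
        (((WeakHopfAlgebra.antipode k : Module.End k H) ^ 2) ^ m)) := by
  obtain ⟨-, f, hf⟩ := hFrob
  have hf' : ∀ p, (∀ h, f (p * h) = 0) → p = 0 := fun p hp => hf.1 p hp
  have hS := antipode_bijective hf'
  have haut := isAutomorphism_antipode_sq hS
  obtain ⟨n, hn, y, hy, z, hz, h⟩ := exists_pow_antipodeSq_eq_conjAut hf' hS
  have hpow : ∀ (m : ℕ) (x : H), (((WeakHopfAlgebra.antipode k : Module.End k H) ^ 2) ^ m) x =
      (antipodeSq hS ^ m : H ≃ₐ[k] H) x := fun m => by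
    induction m with
    | zero => exact fun x => rfl
    | succ m ih =>
      intro x
      rw [pow_succ _ m, pow_succ _ m, Module.End.mul_apply, AlgEquiv.mul_apply, ih,
        antipodeSq_apply]
      rfl
  have htriv := isTrivialAutomorphism_of_conj (haut.pow (2 * n)) hy hz fun x => by
    rw [hpow, h, ← Units.val_mul, conjAut_apply_mul]
  refine ⟨⟨n, hn, ?_⟩, haut, 2 * n, by omega, htriv⟩
  rwa [← pow_mul, ← mul_assoc] at htriv
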